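/- Let $r\ge 3$. Let $\Gamma_r$ be the graph consisting of $r$ half-lines $[0,\infty)$ glued at $0$, with one loop attached at each of the points $1,2,3,\dots$ of each half-line; it has $r$ ends, all accumulated by loops. Let the core be the star formed by the segments $[0,\tfrac12]$ of the half-lines, and for $1\le i\le r$ and $n\ge 1$ let the piece $Y_{i,n}$ be the segment $[n-\tfrac12,n+\tfrac12]$ of the $i$-th half-line together with the loop attached at its midpoint. Translation along the half-lines identifies any two pieces $Y_{i,n}$ and $Y_{i',n'}$ canonically. A suited subgraph is a connected union of the core and finitely many (possibly no) pieces. Let $\mathrm{Map}(\Gamma_r)$ be the group of proper homotopy equivalences $\Gamma_r\to\Gamma_r$ up to proper homotopy. The graph Houghton group $B_r\le \mathrm{Map}(\Gamma_r)$ is the group of the classes of those proper homotopy equivalences $f$ for which there is a suited subgraph $Z$ such that $f(Z)$ is a suited subgraph, $f|_Z\colon Z\to f(Z)$ is a proper homotopy equivalence, and every piece contained in $\overline{\Gamma_r\setminus Z}$ is mapped by $f$ onto a piece contained in $\overline{\Gamma_r\setminus f(Z)}$ via the canonical identification. The pure graph Houghton group $PB_r$ is the subgroup of the elements of $B_r$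 that fix every end of $\Gamma_r$. Then $PB_r$ has solvable word problem; that is, $PB_r$ is finitely generated, and for every finite generating family $s_1,\dots,s_n$ of $PB_r$ there is an algorithm which decides whether a given word in $s_1^{\pm1},\dots,s_n^{\pm1}$ represents the identity of $PB_r$. -/

import Mathlib

open Set

namespace GraphHoughton

section ProperHomotopy

variable {X Y Z : Type*} [TopologicalSpace X] [TopologicalSpace Y] [TopologicalSpace Z]

/-- Two continuous maps are properly homotopic if there is a homotopy between them which is a
proper map `[0,1] × X → Y`. -/
def ProperlyHomotopic (f g : C(X, Y)) : Prop :=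
  ∃ H : ContinuousMap.Homotopy f g, IsProperMap H

/-- A proper map which has a proper inverse up to proper homotopy. -/
def IsProperHomotopyEquiv (f : C(X, Y)) : Prop :=
  IsProperMap f ∧ ∃ g : C(Y, X), IsProperMap g ∧
    ProperlyHomotopic (g.comp f) (ContinuousMap.id X) ∧
    ProperlyHomotopic (f.comp g) (ContinuousMap.id Y)

theorem ProperlyHomotopic.refl {f : C(X, Y)} (hf : IsProperMap f) : ProperlyHomotopic f f :=
  ⟨ContinuousMap.Homotopy.refl f, hf.comp isProperMap_snd_of_compactSpace⟩

theorem ProperlyHomotopic.symm {f g : C(X, Y)} (h : ProperlyHomotopic f g) :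
    ProperlyHomotopic g f := by
  obtain ⟨H, hH⟩ := h
  refine ⟨H.symm, ?_⟩
  have h1 : IsProperMap (Prod.map unitInterval.symm id : unitInterval × X → unitInterval × X) :=
    (unitInterval.symmHomeomorph.isProperMap).prodMap isProperMap_id
  exact hH.comp h1

theorem ProperlyHomotopic.trans {f g h : C(X, Y)} (h1 : ProperlyHomotopic f g)
    (h2 : ProperlyHomotopic g h) : ProperlyHomotopic f h := by
  obtain ⟨H, hH⟩ := h1
  obtain ⟨K, hK⟩ := h2
  refine ⟨H.trans K, ?_⟩
  -- the two halves of the concatenation, precomposed with the doubling maps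
  let a : unitInterval × X → unitInterval × X := fun p =>
    (⟨p.1 / 2, by constructor <;> linarith [p.1.2.1, p.1.2.2]⟩, p.2)
  let b : unitInterval × X → unitInterval × X := fun p =>
    (⟨(p.1 + 1) / 2, by constructor <;> linarith [p.1.2.1, p.1.2.2]⟩, p.2)
  have ha : Continuous a := by fun_prop
  have hb : Continuous b := by fun_prop
  have hHa : ∀ p, (H.trans K) (a p) = H p := by
    rintro ⟨t, x⟩
    have ht : ((a (t, x)).1 : ℝ) ≤ 1 / 2 := by
      change (t : ℝ) / 2 ≤ 1 / 2
      linarith [t.2.2]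
    rw [show a (t, x) = ((a (t, x)).1, x) from rfl, ContinuousMap.Homotopy.trans_apply, dif_pos ht]
    congr 2
    apply Subtype.ext
    change 2 * ((t : ℝ) / 2) = t
    ring
  have hKb : ∀ p, (H.trans K) (b p) = K p := by
    rintro ⟨t, x⟩
    by_cases ht : ((b (t, x)).1 : ℝ) ≤ 1 / 2
    · have h0 : t = 0 := by
        apply Subtype.ext
        change ((t : ℝ) + 1) / 2 ≤ 1 / 2 at ht
        change (t : ℝ) = 0
        linarith [t.2.1]
      subst h0
      rw [show b (0, x) = ((b (0, x)).1, x) from rfl, ContinuousMap.Homotopy.trans_apply,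
        dif_pos ht, K.apply_zero, ← H.apply_one]
      congr 2
      apply Subtype.ext
      simp [b]
    · rw [show b (t, x) = ((b (t, x)).1, x) from rfl, ContinuousMap.Homotopy.trans_apply,
        dif_neg ht]
      congr 2
      apply Subtype.ext
      change 2 * (((t : ℝ) + 1) / 2) - 1 = t
      ring
  have hcov : ∀ p : unitInterval × X, (∃ q, a q = p) ∨ ∃ q, b q = p := by
    rintro ⟨t, x⟩
    by_cases ht : (t : ℝ) ≤ 1 / 2
    · refine Or.inl ⟨(⟨2 * t, by constructor <;> linarith [t.2.1]⟩, x), ?_⟩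
      refine Prod.ext (Subtype.ext ?_) rfl
      change 2 * (t : ℝ) / 2 = t
      ring
    · refine Or.inr ⟨(⟨2 * t - 1, by constructor <;> linarith [t.2.2]⟩, x), ?_⟩
      refine Prod.ext (Subtype.ext ?_) rfl
      change (2 * (t : ℝ) - 1 + 1) / 2 = t
      ring
  rw [isProperMap_iff_isClosedMap_and_compact_fibers]
  refine ⟨(H.trans K).continuous, fun C hC => ?_, fun y => ?_⟩
  · have : (H.trans K) '' C = H '' (a ⁻¹' C) ∪ K '' (b ⁻¹' C) := by
      ext y
      constructor
      · rintro ⟨p, hp, rfl⟩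
        rcases hcov p with ⟨q, rfl⟩ | ⟨q, rfl⟩
        · exact Or.inl ⟨q, hp, (hHa q).symm⟩
        · exact Or.inr ⟨q, hp, (hKb q).symm⟩
      · rintro (⟨q, hq, rfl⟩ | ⟨q, hq, rfl⟩)
        · exact ⟨a q, hq, hHa q⟩
        · exact ⟨b q, hq, hKb q⟩
    rw [this]
    exact (hH.isClosedMap _ (hC.preimage ha)).union (hK.isClosedMap _ (hC.preimage hb))
  · have : (H.trans K) ⁻¹' {y} = a '' (H ⁻¹' {y}) ∪ b '' (K ⁻¹' {y}) := by
      ext p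
      constructor
      · intro hp
        rcases hcov p with ⟨q, rfl⟩ | ⟨q, rfl⟩
        · exact Or.inl ⟨q, by simpa [hHa q] using hp, rfl⟩
        · exact Or.inr ⟨q, by simpa [hKb q] using hp, rfl⟩
      · rintro (⟨q, hq, rfl⟩ | ⟨q, hq, rfl⟩)
        · simpa [hHa q] using hq
        · simpa [hKb q] using hq
    rw [this]
    exact ((hH.isCompact_preimage isCompact_singleton).image ha).union
      ((hK.isCompact_preimage isCompact_singleton).image hb)

theorem ProperlyHomotopic.comp {f g : C(X, Y)} {k l : C(Y, Z)} (hf : IsProperMap f)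
    (hl : IsProperMap l) (h1 : ProperlyHomotopic f g) (h2 : ProperlyHomotopic k l) :
    ProperlyHomotopic (k.comp f) (l.comp g) := by
  obtain ⟨H, hH⟩ := h1
  obtain ⟨K, hK⟩ := h2
  have e1 : ProperlyHomotopic (k.comp f) (l.comp f) :=
    ⟨{ toFun := fun p => K (p.1, f p.2)
       map_zero_left := by simp
       map_one_left := by simp }, hK.comp (isProperMap_id.prodMap hf)⟩
  have e2 : ProperlyHomotopic (l.comp f) (l.comp g) :=
    ⟨{ toFun := fun p => l (H p)
       map_zero_left := by simp
       map_one_left := by simp }, hl.comp hH⟩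
  exact e1.trans e2

theorem IsProperHomotopyEquiv.id : IsProperHomotopyEquiv (ContinuousMap.id X) :=
  ⟨isProperMap_id, ContinuousMap.id X, isProperMap_id,
    ProperlyHomotopic.refl isProperMap_id, ProperlyHomotopic.refl isProperMap_id⟩

theorem IsProperHomotopyEquiv.comp {f : C(Y, Z)} {g : C(X, Y)} (hf : IsProperHomotopyEquiv f)
    (hg : IsProperHomotopyEquiv g) : IsProperHomotopyEquiv (f.comp g) := by
  obtain ⟨pf, f', pf', hf1, hf2⟩ := hf
  obtain ⟨pg, g', pg', hg1, hg2⟩ := hg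
  refine ⟨pf.comp pg, g'.comp f', pg'.comp pf', ?_, ?_⟩
  · have h1 : ProperlyHomotopic ((f'.comp f).comp g) ((ContinuousMap.id Y).comp g) :=
      (ProperlyHomotopic.refl pg).comp pg isProperMap_id hf1
    have h2 : ProperlyHomotopic (g'.comp ((f'.comp f).comp g)) (g'.comp g) :=
      h1.comp ((pf'.comp pf).comp pg) pg' (ProperlyHomotopic.refl pg')
    exact h2.trans hg1
  · have h1 : ProperlyHomotopic ((g.comp g').comp f') ((ContinuousMap.id Y).comp f') :=
      (ProperlyHomotopic.refl pf').comp pf' isProperMap_id hg2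
    have h2 : ProperlyHomotopic (f.comp ((g.comp g').comp f')) (f.comp f') :=
      h1.comp ((pg.comp pg').comp pf') pf (ProperlyHomotopic.refl pf)
    exact h2.trans hf2

end ProperHomotopy

section MappingClassGroup

/-- The proper homotopy equivalences `X → X`. -/
def PHE (X : Type*) [TopologicalSpace X] : Type _ :=
  {f : C(X, X) // IsProperHomotopyEquiv f}

variable {X : Type*} [TopologicalSpace X]

/-- Proper homotopy, as an equivalence relation on the proper homotopy equivalences. -/
instance pheSetoid (X : Type*) [TopologicalSpace X] : Setoid (PHE X) where
  r f g := ProperlyHomotopic f.1 g.1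
  iseqv := ⟨fun f => ProperlyHomotopic.refl f.2.1, fun h => h.symm, fun h k => h.trans k⟩

/-- A homotopy inverse of a proper homotopy equivalence. -/
noncomputable def PHE.inv (f : PHE X) : PHE X :=
  ⟨f.2.2.choose, f.2.2.choose_spec.1, f.1, f.2.1, f.2.2.choose_spec.2.2, f.2.2.choose_spec.2.1⟩

theorem PHE.inv_comp (f : PHE X) :
    ProperlyHomotopic (f.inv.1.comp f.1) (ContinuousMap.id X) :=
  f.2.2.choose_spec.2.1

theorem PHE.comp_inv (f : PHE X) :
    ProperlyHomotopic (f.1.comp f.inv.1) (ContinuousMap.id X) :=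
  f.2.2.choose_spec.2.2

/-- The mapping class group: proper homotopy equivalences `X → X` up to proper homotopy. -/
def MapGroup (X : Type*) [TopologicalSpace X] : Type _ := Quotient (pheSetoid X)

/-- The mapping class of a proper homotopy equivalence. -/
def mapClass (f : PHE X) : MapGroup X := Quotient.mk (pheSetoid X) f

/-- The product of mapping classes is induced by composition of maps. -/
noncomputable instance : Group (MapGroup X) :=
  letI : Mul (MapGroup X) :=
    ⟨Quotient.map₂ (fun f g => ⟨f.1.comp g.1, f.2.comp g.2⟩)
      (fun _ k hfk g _ hgl => ProperlyHomotopic.comp g.2.1 k.2.1 hgl hfk)⟩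
  letI : One (MapGroup X) := ⟨mapClass ⟨ContinuousMap.id X, IsProperHomotopyEquiv.id⟩⟩
  letI : Inv (MapGroup X) :=
    ⟨Quotient.map PHE.inv (fun f g (h : ProperlyHomotopic f.1 g.1) => by
      change ProperlyHomotopic f.inv.1 g.inv.1
      have h1 : ProperlyHomotopic (f.inv.1.comp (f.1.comp g.inv.1))
          (f.inv.1.comp (ContinuousMap.id X)) :=
        (((ProperlyHomotopic.refl g.inv.2.1).comp g.inv.2.1 g.2.1 h).trans g.comp_inv).comp
          (f.2.1.comp g.inv.2.1) f.inv.2.1 (ProperlyHomotopic.refl f.inv.2.1)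
      have h2 : ProperlyHomotopic ((f.inv.1.comp f.1).comp g.inv.1) g.inv.1 :=
        (ProperlyHomotopic.refl g.inv.2.1).comp g.inv.2.1 isProperMap_id f.inv_comp
      exact h1.symm.trans h2)⟩
  Group.ofLeftAxioms
    (by rintro ⟨f⟩ ⟨g⟩ ⟨h⟩; rfl)
    (by rintro ⟨f⟩; rfl)
    (by rintro ⟨f⟩; exact Quotient.sound f.inv_comp)

theorem mapClass_mul (f g : PHE X) :
    mapClass f * mapClass g = mapClass ⟨f.1.comp g.1, f.2.comp g.2⟩ := rfl

theorem mapClass_one :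
    (1 : MapGroup X) = mapClass ⟨ContinuousMap.id X, IsProperHomotopyEquiv.id⟩ := rfl

theorem mapClass_inv (f : PHE X) : (mapClass f)⁻¹ = mapClass f.inv := rfl

end MappingClassGroup

section Ends

variable {X : Type*} [TopologicalSpace X]

/-- An end of `X`: an element of the inverse limit, over the compact subsets `K` of `X`, of the
sets of connected components of `X \ K`. -/
structure TopEnd (X : Type*) [TopologicalSpace X] where
  comp : TopologicalSpace.Compacts X → Set X
  isComponent : ∀ K : TopologicalSpace.Compacts X, ∃ x, x ∉ (K : Set X) ∧ comp K = connectedComponentIn (K : Set X)ᶜ x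
  mono : ∀ K L : TopologicalSpace.Compacts X, (K : Set X) ⊆ L → comp L ⊆ comp K

/-- A proper map `f` sends an end `e` to the end whose component in the complement of a compact
set `K` contains the image under `f` of the component of `e` in the complement of any compact
`L ⊇ f⁻¹(K)`. This says that the image of `e` is `e`. -/
def FixesEnd (f : C(X, X)) (e : TopEnd X) : Prop :=
  ∀ K L : TopologicalSpace.Compacts X, f ⁻¹' K ⊆ L → f '' e.comp L ⊆ e.comp K

theorem fixesEnd_id (e : TopEnd X) : FixesEnd (ContinuousMap.id X) e := by
  intro K L h
  rintro _ ⟨x, hx, rfl⟩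
  exact e.mono K L h hx

theorem FixesEnd.comp {f g : C(X, X)} {e : TopEnd X} (hfp : IsProperMap f) (hf : FixesEnd f e)
    (hg : FixesEnd g e) : FixesEnd (f.comp g) e := by
  intro K L h
  let M : TopologicalSpace.Compacts X := ⟨f ⁻¹' K, hfp.isCompact_preimage K.2⟩
  have h1 : g '' e.comp L ⊆ e.comp M := hg M L h
  have h2 : f '' e.comp M ⊆ e.comp K := hf K M subset_rfl
  rintro _ ⟨x, hx, rfl⟩
  exact h2 ⟨g x, h1 ⟨x, hx, rfl⟩, rfl⟩

theorem FixesEnd.inv {f g : C(X, X)} {e : TopEnd X} (hfp : IsProperMap f) (hf : FixesEnd f e)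
    (hgf : ProperlyHomotopic (g.comp f) (ContinuousMap.id X)) : FixesEnd g e := by
  intro K L h
  obtain ⟨H, hH⟩ := hgf
  let N : TopologicalSpace.Compacts X :=
    ⟨Prod.snd '' (H ⁻¹' K) ∪ f ⁻¹' L,
      ((hH.isCompact_preimage K.2).image continuous_snd).union (hfp.isCompact_preimage L.2)⟩
  obtain ⟨x, hxN, hx⟩ := e.isComponent N
  have hxe : x ∈ e.comp N := by
    rw [hx]; exact mem_connectedComponentIn hxN
  have havoid : ∀ t, H (t, x) ∉ (K : Set X) := fun t ht => hxN (Or.inl ⟨(t, x), ht, rfl⟩)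
  have hKN : (K : Set X) ⊆ N := fun y hy => Or.inl ⟨(1, y), by simpa using hy, rfl⟩
  have hxK : x ∈ e.comp K := e.mono K N hKN hxe
  have hfx : f x ∈ e.comp L := hf L N (fun y hy => Or.inr hy) ⟨x, hxe, rfl⟩
  obtain ⟨y, hyK, hy⟩ := e.isComponent K
  have hgfx : g (f x) ∈ e.comp K := by
    have hc : IsPreconnected (range fun t : unitInterval => H (t, x)) :=
      isPreconnected_range (by fun_prop)
    have hs : (range fun t : unitInterval => H (t, x)) ⊆ (K : Set X)ᶜ := by
      rintro _ ⟨t, rfl⟩; exact havoid t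
    have h1 : x ∈ range fun t : unitInterval => H (t, x) := ⟨1, by simp⟩
    have h0 : g (f x) ∈ range fun t : unitInterval => H (t, x) := ⟨0, by simp⟩
    have := hc.subset_connectedComponentIn h1 hs h0
    rw [hy] at hxK ⊢
    rwa [connectedComponentIn_eq hxK]
  obtain ⟨z, hzL, hz⟩ := e.isComponent L
  have hc : IsPreconnected (g '' e.comp L) := by
    rw [hz]
    exact isPreconnected_connectedComponentIn.image _ g.continuous.continuousOn
  have hs : g '' e.comp L ⊆ (K : Set X)ᶜ := by
    rintro _ ⟨w, hw, rfl⟩ hwK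
    rw [hz] at hw
    exact connectedComponentIn_subset _ _ hw (h hwK)
  have := hc.subset_connectedComponentIn ⟨f x, hfx, rfl⟩ hs
  rw [hy] at hgfx ⊢
  rwa [connectedComponentIn_eq hgfx]

/-- The pure mapping class group: the mapping classes which fix every end. -/
def pureMapGroup (X : Type*) [TopologicalSpace X] : Subgroup (MapGroup X) where
  carrier := {φ | ∃ f : PHE X, mapClass f = φ ∧ ∀ e : TopEnd X, FixesEnd f.1 e}
  mul_mem' := by
    rintro _ _ ⟨f, rfl, hf⟩ ⟨g, rfl, hg⟩
    exact ⟨_, (mapClass_mul f g).symm, fun e => (hf e).comp f.2.1 (hg e)⟩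
  one_mem' := ⟨_, mapClass_one.symm, fixesEnd_id⟩
  inv_mem' := by
    rintro _ ⟨f, rfl, hf⟩
    exact ⟨f.inv, (mapClass_inv f).symm, fun e => (hf e).inv f.2.1 f.inv_comp⟩

end Ends

section Graph

/-- The graph `Γ_r`: `r` half-lines glued at their origin, the `i`-th one being the half-axis
`{t e_i : t ≥ 0}` of `ℝ^r`, with a circle (in the additional coordinate `ℂ`, touching `0`) attached
at each of the points `e_i, 2 e_i, 3 e_i, …` of each half-line. It is a closed subset of
`ℝ^r × ℂ`, and carries the subspace topology. -/
def graphSet (r : ℕ) : Set ((Fin r → ℝ) × ℂ) :=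
  {p | (∃ i : Fin r, ∃ t : ℝ, 0 ≤ t ∧ p.1 = Pi.single i t ∧ p.2 = 0) ∨
    ∃ i : Fin r, ∃ n : ℕ, p.1 = Pi.single i ((n : ℝ) + 1) ∧ ‖p.2 - 1‖ = 1}

/-- `Γ_r` as a topological space. -/
abbrev Gam (r : ℕ) : Type := graphSet r

/-- The core: the star consisting of the initial segments of length `1/2` of the half-lines. It has
rank `0`. -/
def core (r : ℕ) : Set (Gam r) :=
  {p | ∃ i : Fin r, ∃ t ∈ Icc (0 : ℝ) (1 / 2), p.1.1 = Pi.single i t}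

/-- The pieces: for `j = (i, n)`, the part of the `i`-th half-line between the parameters `n + 1/2`
and `n + 3/2`, together with the circle attached at its midpoint. -/
def piece {r : ℕ} (j : Fin r × ℕ) : Set (Gam r) :=
  {p | ∃ t ∈ Icc ((j.2 : ℝ) + 1 / 2) ((j.2 : ℝ) + 3 / 2), p.1.1 = Pi.single j.1 t}

/-- The marking of the piece `j = (i, n)`, an isomorphism onto the model piece
`{(s, 0) : |s| ≤ 1/2} ∪ {(0, z) : |z - 1| = 1}`, which sends the end point of the piece nearer to
the core to `(-1/2, 0)` and the other one to `(1/2, 0)`. -/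
def mark {r : ℕ} (j : Fin r × ℕ) (p : Gam r) : ℝ × ℂ :=
  (p.1.1 j.1 - ((j.2 : ℝ) + 1), p.1.2)

/-- The inverse of the marking of the piece `j`. -/
def unmark {r : ℕ} (j : Fin r × ℕ) (y : ℝ × ℂ) : (Fin r → ℝ) × ℂ :=
  (Pi.single j.1 (y.1 + ((j.2 : ℝ) + 1)), y.2)

/-- A suited subgraph: a connected union of the core and finitely many pieces. -/
def IsSuited {r : ℕ} (Z : Set (Gam r)) : Prop :=
  IsConnected Z ∧ ∃ F : Finset (Fin r × ℕ), Z = core r ∪ ⋃ j ∈ F, piece j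

/-- The restriction of a continuous map to a subset, as a map onto the image of that subset. -/
def restrictToImage {X Y : Type*} [TopologicalSpace X] [TopologicalSpace Y] (f : C(X, Y))
    (Z : Set X) : C(Z, f '' Z) where
  toFun z := ⟨f z, z, z.2, rfl⟩
  continuous_toFun := by fun_prop

/-- `Z` is a defining graph for `f`. -/
def IsDefiningGraph {r : ℕ} (f : C(Gam r, Gam r)) (Z : Set (Gam r)) : Prop :=
  IsSuited Z ∧ IsProperHomotopyEquiv (restrictToImage f Z) ∧ IsSuited (f '' Z) ∧
    ∀ j : Fin r × ℕ, piece j ⊆ closure Zᶜ →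
      ∃ i : Fin r × ℕ, piece i ⊆ closure (f '' Z)ᶜ ∧ f '' piece j = piece i ∧
        ∀ p ∈ piece j, (f p).1 = unmark i (mark j p)

/-- The asymptotically rigid mapping classes: the classes of those proper homotopy equivalences
that have a defining graph. -/
def asymptoticallyRigid (r : ℕ) : Set (MapGroup (Gam r)) :=
  {φ | ∃ f : PHE (Gam r), mapClass f = φ ∧ ∃ Z, IsDefiningGraph f.1 Z}

/-- The graph Houghton group `B_r = B(0, 1, r)`, the group of asymptotically rigid mapping classes.
These classes are closed under products and inverses, so that the subgroup which they generate
has no further elements. -/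
noncomputable def graphHoughton (r : ℕ) : Subgroup (MapGroup (Gam r)) :=
  Subgroup.closure (asymptoticallyRigid r)

/-- The pure graph Houghton group `PB_r`: the elements of `B_r` that fix every end of `Γ_r`. -/
noncomputable def pureGraphHoughton (r : ℕ) : Subgroup (MapGroup (Gam r)) :=
  graphHoughton r ⊓ pureMapGroup (Gam r)

end Graph

section WordProblem

/-- The element of `G` that a word in the letters `s 0, …, s (n - 1)` and their inverses represents;
the letter `(k, true)` stands for `s k` and `(k, false)` for its inverse. -/
def evalWord {G : Type*} [Group G] {n : ℕ} (s : Fin n → G) (w : List (Fin n × Bool)) : G :=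
  (w.map fun a => if a.2 then s a.1 else (s a.1)⁻¹).prod

/-- `G` is finitely generated, and for every finite generating family there is an algorithm that
decides whether a word in the generators and their inverses represents the identity. -/
def HasSolvableWordProblem (G : Type*) [Group G] : Prop :=
  Group.FG G ∧ ∀ (n : ℕ) (s : Fin n → G), Subgroup.closure (range s) = ⊤ →
    ComputablePred fun w : List (Fin n × Bool) => evalWord s w = 1

end WordProblem

end GraphHoughton

namespace GraphHoughton

/-! ### Automorphisms of a free group that twist, permute or invert letters -/

section FreeGroupAutomorphisms

variable {α : Type*}

open FreeGroup (of lift lift_apply_of)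

/-! The group `PB_r` is identified with a concrete group of automorphisms of the free group `F` on
letters `x_{i,n}`, one for each loop of the graph. A map that translates the tails of the half-lines
acts on `F`, up to conjugation, so that late letters go to `g_i x_{σ i, n + c_i} g_i⁻¹` (`IsRigid`).
Fixing the ends means `σ = 1`, and the inner ambiguity is removed by requiring `g_{i₀} = 1` for one
chosen ray: an element of `F` that commutes with two different letters is trivial, so each mapping
class has exactly one normalized representative. The result is `normalizedRigidEquiv :
normalizedRigid i₀ ≃* pureGraphHoughton r`.

The topology behind this isomorphism starts from an explicit universal cover, which assigns to every
path its `word` in `F`. Paths with the same end points and the same word are homotopic, and every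
functor from the fundamental groupoid to a group factors through words (`PathHom.exists_factor`).
Hence continuous maps induce homomorphisms, and two maps inducing the same one are homotopic. If
both are the same translation on the tails, the commutation argument forces the tracks of the tail
vertices to have trivial words, so the homotopy can be stationary there and is proper
(`TailRigid.properlyHomotopic`). Conversely, `IsRigid.exists_represents` realizes every rigid
automorphism by a map taking a ball onto a ball, and `IsDefiningGraph.exists_tailRigid` shows that
asymptotic rigidity forces translations on the tails.

Finite generation is `normalizedRigid_le`. Shifts between the ray `i₀` and the other rays remove the
translations on those other rays; the total translation is zero (`IsRigid.sum_eq`), so none is left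
on `i₀` either. Conjugations of tails remove the `g_i`. What remains moves finitely many letters,
and the stable form of Nielsen's theorem (`ContainsElementary.mem_of_finitary`), proved by Stallings
folding of labelled graphs, expresses it by elementary automorphisms. All of these factors come from
finitely many generators.

For the word problem, a word of length `l` is rigid from index `C * l` on, for a constant `C`
depending on the generating family. A rigid automorphism that fixes all letters up to two places
into each tail is the identity, so only finitely many letters have to be checked. Their images are
computed by substitution and free reduction, which is primitive recursive
(`computablePred_evalWord`). -/

theorem mulAut_ext {φ ψ : MulAut (FreeGroup α)} (h : ∀ i, φ (of i) = ψ (of i)) : φ = ψ := by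
  apply MulEquiv.toMonoidHom_injective
  ext i
  exact h i

/-- The elements of the free group in which no letter of `B` occurs. -/
def avoiding (B : Set α) : Subgroup (FreeGroup α) := Subgroup.closure (of '' Bᶜ)

theorem of_mem_avoiding {B : Set α} {i : α} (h : i ∉ B) : of i ∈ avoiding B :=
  Subgroup.subset_closure ⟨i, h, rfl⟩

theorem avoiding_induction {B : Set α} {p : (g : FreeGroup α) → g ∈ avoiding B → Prop}
    (hof : ∀ i (hi : i ∉ B), p (of i) (of_mem_avoiding hi)) (hone : p 1 (one_mem _))
    (hmul : ∀ g h hg hh, p g hg → p h hh → p (g * h) (mul_mem hg hh))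
    (hinv : ∀ g hg, p g hg → p g⁻¹ (inv_mem hg)) {g : FreeGroup α} (hg : g ∈ avoiding B) :
    p g hg := by
  refine Subgroup.closure_induction (p := p) ?_ hone hmul hinv hg
  rintro _ ⟨i, hi, rfl⟩
  exact hof i hi

theorem avoiding_anti {B C : Set α} (h : B ⊆ C) : avoiding C ≤ avoiding B :=
  Subgroup.closure_mono (image_mono (compl_subset_compl.2 h))

theorem mk_mem_avoiding {B : Set α} {l : List (α × Bool)} (h : ∀ x ∈ l, x.1 ∉ B) :
    FreeGroup.mk l ∈ avoiding B := by
  induction l with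
  | nil => exact one_mem _
  | cons x l ih =>
    have : FreeGroup.mk (x :: l) = FreeGroup.mk [x] * FreeGroup.mk l := by
      rw [FreeGroup.mul_mk]; rfl
    rw [this]
    refine mul_mem ?_ (ih fun y hy => h y (List.mem_cons_of_mem _ hy))
    have hx := of_mem_avoiding (h x List.mem_cons_self)
    obtain ⟨a, b⟩ := x
    cases b
    · have := inv_mem hx
      rwa [show (of a)⁻¹ = FreeGroup.mk [(a, false)] from rfl] at this
    · exact hx

theorem mem_avoiding_of_toWord [DecidableEq α] {B : Set α} {g : FreeGroup α}
    (h : ∀ x ∈ g.toWord, x.1 ∉ B) : g ∈ avoiding B := by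
  rw [← FreeGroup.mk_toWord (x := g)]
  exact mk_mem_avoiding h

theorem hom_eq_of_avoiding {G : Type*} [Group G] {B : Set α} {f f' : FreeGroup α →* G}
    (h : ∀ i ∉ B, f (of i) = f' (of i)) {g : FreeGroup α} (hg : g ∈ avoiding B) : f g = f' g := by
  have : Set.EqOn f f' (of '' Bᶜ) := by
    rintro _ ⟨i, hi, rfl⟩
    exact h i hi
  exact MonoidHom.eqOn_closure this hg

open Classical in
/-- The endomorphism which sends `x_i` to `u_i x_i v_i` for `i ∈ B` and fixes the other letters. -/
noncomputable def twistHom (B : Set α) (u v : α → FreeGroup α) : FreeGroup α →* FreeGroup α :=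
  lift fun i => if i ∈ B then u i * of i * v i else of i

theorem twistHom_of_mem {B : Set α} {u v : α → FreeGroup α} {i : α} (h : i ∈ B) :
    twistHom B u v (of i) = u i * of i * v i := by simp [twistHom, h]

theorem twistHom_of_notMem {B : Set α} {u v : α → FreeGroup α} {i : α} (h : i ∉ B) :
    twistHom B u v (of i) = of i := by simp [twistHom, h]

theorem twistHom_avoiding {B : Set α} {u v : α → FreeGroup α} {g : FreeGroup α}
    (h : g ∈ avoiding B) : twistHom B u v g = g :=
  hom_eq_of_avoiding (f' := MonoidHom.id _) (fun _ hi => twistHom_of_notMem hi) h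

/-- The factors contain no letter of `B`, so both twists fix them and the factors cancel. -/
theorem twistHom_comp_cancel {B : Set α} {u v : α → FreeGroup α} (hu : ∀ i, u i ∈ avoiding B)
    (hv : ∀ i, v i ∈ avoiding B) :
    (twistHom B u v).comp (twistHom B (fun i => (u i)⁻¹) fun i => (v i)⁻¹) = MonoidHom.id _ := by
  ext i
  by_cases h : i ∈ B
  · simp [twistHom_of_mem h, twistHom_avoiding (hu i), twistHom_avoiding (hv i), mul_assoc]
  · simp [twistHom_of_notMem h]

/-- The automorphism which sends `x_i` to `u_i x_i v_i` for `i ∈ B` and fixes the other letters, where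
no letter of `B` occurs in `u_i` and `v_i`. -/
noncomputable def twistAut (B : Set α) (u v : α → FreeGroup α) (hu : ∀ i, u i ∈ avoiding B)
    (hv : ∀ i, v i ∈ avoiding B) : MulAut (FreeGroup α) :=
  MonoidHom.toMulEquiv (twistHom B u v) (twistHom B (fun i => (u i)⁻¹) fun i => (v i)⁻¹)
    (by simpa using twistHom_comp_cancel (fun i => inv_mem (hu i)) fun i => inv_mem (hv i))
    (twistHom_comp_cancel hu hv)

section
variable {B : Set α} {u v : α → FreeGroup α} {hu : ∀ i, u i ∈ avoiding B}
  {hv : ∀ i, v i ∈ avoiding B}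

theorem twistAut_of_mem {i : α} (h : i ∈ B) :
    twistAut B u v hu hv (of i) = u i * of i * v i := twistHom_of_mem h

theorem twistAut_of_notMem {i : α} (h : i ∉ B) :
    twistAut B u v hu hv (of i) = of i := twistHom_of_notMem h

theorem twistAut_self {j : α} {u v : α → FreeGroup α} {hu : ∀ i, u i ∈ avoiding {j}}
    {hv : ∀ i, v i ∈ avoiding {j}} : twistAut {j} u v hu hv (of j) = u j * of j * v j :=
  twistAut_of_mem (mem_singleton j)

theorem twistAut_of_ne {j : α} {u v : α → FreeGroup α} {hu : ∀ i, u i ∈ avoiding {j}}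
    {hv : ∀ i, v i ∈ avoiding {j}} {i : α} (h : i ≠ j) : twistAut {j} u v hu hv (of i) = of i :=
  twistAut_of_notMem h

theorem twistAut_avoiding {g : FreeGroup α} (h : g ∈ avoiding B) :
    twistAut B u v hu hv g = g := twistHom_avoiding h

end

/-- The automorphism which permutes the letters. -/
def permAut (π : Equiv.Perm α) : MulAut (FreeGroup α) := FreeGroup.freeGroupCongr π

@[simp] theorem permAut_of (π : Equiv.Perm α) (i : α) : permAut π (of i) = of (π i) := by
  simp [permAut]

theorem permAut_mul (π ρ : Equiv.Perm α) : permAut (π * ρ) = permAut π * permAut ρ :=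
  mulAut_ext fun i => by simp

theorem permAut_inv (π : Equiv.Perm α) : permAut π⁻¹ = (permAut π)⁻¹ := by
  rw [eq_inv_iff_mul_eq_one, ← permAut_mul, inv_mul_cancel]
  exact mulAut_ext fun i => by simp

theorem permAut_one : permAut (1 : Equiv.Perm α) = 1 := mulAut_ext fun i => by simp

variable [DecidableEq α]

/-- The automorphism which inverts the letters in `s`. -/
def invAut (s : Finset α) : MulAut (FreeGroup α) :=
  MonoidHom.toMulEquiv (lift fun i => if i ∈ s then (of i)⁻¹ else of i)
    (lift fun i => if i ∈ s then (of i)⁻¹ else of i)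
    (by ext i; by_cases h : i ∈ s <;> simp [h]) (by ext i; by_cases h : i ∈ s <;> simp [h])

theorem invAut_of (s : Finset α) (i : α) :
    invAut s (of i) = if i ∈ s then (of i)⁻¹ else of i := by
  exact lift_apply_of

end FreeGroupAutomorphisms

/-! ### Conjugate letters -/

section FreshLetters

variable {α : Type*}

open FreeGroup (of lift lift_apply_of)

theorem of_ne_one (i : α) : (of i : FreeGroup α) ≠ 1 := FreeGroup.of_ne_one i

theorem eq_of_conj_of_eq {g h : FreeGroup α} {i j : α}
    (e : g * of i * g⁻¹ = h * of j * h⁻¹) : i = j := by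
  classical
  by_contra hne
  have := congrArg (lift fun a => Multiplicative.ofAdd (if a = i then (1 : ℤ) else 0)) e
  simp only [map_mul, map_inv, lift_apply_of, mul_inv_cancel_comm] at this
  simp [Ne.symm hne] at this

end FreshLetters

/-! ### Elementary automorphisms and labelled graphs -/

section Nielsen

variable {α : Type*} [DecidableEq α]

open FreeGroup (of lift lift_apply_of)

/-- A group of automorphisms which contains the elementary Nielsen automorphisms. -/
structure ContainsElementary (H : Subgroup (MulAut (FreeGroup α))) : Prop where
  transvection : ∀ j k, j ≠ k → ∀ φ : MulAut (FreeGroup α), φ (of j) = of j * of k →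
    (∀ i ≠ j, φ (of i) = of i) → φ ∈ H
  inversion : ∀ j, invAut {j} ∈ H
  swap : ∀ j k, permAut (Equiv.swap j k) ∈ H

variable {H : Subgroup (MulAut (FreeGroup α))}

theorem invAut_avoiding {s : Finset α} {g : FreeGroup α} (h : g ∈ avoiding (s : Set α)) :
    invAut s g = g :=
  hom_eq_of_avoiding (f := (invAut s).toMonoidHom) (f' := MonoidHom.id _)
    (fun i hi => (invAut_of s i).trans (if_neg hi)) h

namespace ContainsElementary

/-- As `u` does not involve `j`, the twist is multiplicative in `u`, and for a single letter it is a
transvection. -/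
theorem twist_right (hH : ContainsElementary H) (j : α) (u : FreeGroup α)
    (hu : u ∈ avoiding {j}) :
    twistAut {j} (fun _ => 1) (fun _ => u) (fun _ => one_mem _) (fun _ => hu) ∈ H := by
  refine avoiding_induction (p := fun u hu => twistAut {j} (fun _ => 1) (fun _ => u)
    (fun _ => one_mem _) (fun _ => hu) ∈ H) ?_ ?_ ?_ ?_ hu
  · intro k hk
    refine hH.transvection j k (Ne.symm hk) _ ?_ fun i hi => twistAut_of_ne hi
    rw [twistAut_self, one_mul]
  · convert one_mem H
    refine mulAut_ext fun i => ?_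
    by_cases hi : i = j
    · subst hi; rw [twistAut_self, one_mul, mul_one]; rfl
    · rw [twistAut_of_ne hi]; rfl
  · intro u v hu hv h1 h2
    convert mul_mem h1 h2 using 1
    refine mulAut_ext fun i => ?_
    by_cases hi : i = j
    · subst hi
      rw [MulAut.mul_apply, twistAut_self, twistAut_self, map_mul, map_mul, map_one,
        twistAut_self, twistAut_avoiding hv]
      simp [mul_assoc]
    · rw [MulAut.mul_apply, twistAut_of_ne hi, twistAut_of_ne hi, twistAut_of_ne hi]
  · intro u hu h1
    convert inv_mem h1 using 1
    rw [eq_inv_iff_mul_eq_one]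
    refine mulAut_ext fun i => ?_
    by_cases hi : i = j
    · subst hi
      rw [MulAut.mul_apply, twistAut_self, map_mul, map_mul, map_one,
        twistAut_self, twistAut_avoiding hu]
      simp
    · rw [MulAut.mul_apply, twistAut_of_ne hi, twistAut_of_ne hi]; rfl

/-- Left multiplication by `u` is right multiplication by `u⁻¹` conjugated by the inversion of the
letter `j`. -/
theorem twist_single (hH : ContainsElementary H) (j : α) (u v : α → FreeGroup α)
    (hu : ∀ i, u i ∈ avoiding {j}) (hv : ∀ i, v i ∈ avoiding {j}) :
    twistAut {j} u v hu hv ∈ H := by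
  have h1 := hH.twist_right j _ (inv_mem (hu j))
  have h2 := hH.twist_right j _ (hv j)
  have h3 := hH.inversion j
  convert mul_mem (mul_mem (mul_mem h3 h1) h3) h2 using 1
  have hj : ∀ g ∈ avoiding {j}, invAut {j} g = g := fun g hg => invAut_avoiding (by simpa using hg)
  refine mulAut_ext fun i => ?_
  by_cases hi : i = j
  · subst hi
    simp only [MulAut.mul_apply]
    have hii : invAut {i} (of i) = (of i)⁻¹ := by rw [invAut_of, if_pos (by simp)]
    rw [twistAut_self, twistAut_self, map_mul, map_mul, map_mul, map_mul, map_mul,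
      map_mul, map_one, hj _ (hv i), hii, map_one, map_one, map_inv,
      twistAut_self, twistAut_avoiding (hv i), hj _ (hv i), map_inv, map_mul, map_mul, map_one,
      map_inv, hj _ (hu i), hii]
    simp
  · simp only [MulAut.mul_apply]
    have hij : invAut {j} (of i) = of i := hj _ (of_mem_avoiding hi)
    rw [twistAut_of_ne hi, twistAut_of_ne hi, hij, twistAut_of_ne hi, hij]

theorem twist (hH : ContainsElementary H) (s : Finset α) (u v : α → FreeGroup α)
    (hu : ∀ i, u i ∈ avoiding (s : Set α)) (hv : ∀ i, v i ∈ avoiding (s : Set α)) :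
    twistAut (s : Set α) u v hu hv ∈ H := by
  induction s using Finset.induction_on with
  | empty =>
    convert one_mem H
    exact mulAut_ext fun i => twistAut_of_notMem (by simp)
  | insert j s hj ih =>
    have hs : ∀ g ∈ avoiding ((insert j s : Finset α) : Set α), g ∈ avoiding (s : Set α) :=
      fun g hg => avoiding_anti (by simp) hg
    have hj' : ∀ g ∈ avoiding ((insert j s : Finset α) : Set α), g ∈ avoiding {j} :=
      fun g hg => avoiding_anti (by simp) hg
    have h1 := hH.twist_single j u v (fun i => hj' _ (hu i)) fun i => hj' _ (hv i)
    have h2 := ih (fun i => hs _ (hu i)) fun i => hs _ (hv i)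
    convert mul_mem h1 h2 using 1
    refine mulAut_ext fun i => ?_
    rw [MulAut.mul_apply]
    by_cases hi : i = j
    · subst hi
      rw [twistAut_of_notMem (B := (s : Set α)) hj, twistAut_self, twistAut_of_mem (by simp)]
    · by_cases his : i ∈ s
      · rw [twistAut_of_mem (B := (s : Set α)) his, twistAut_of_mem (by simp [his]), map_mul,
          map_mul, twistAut_avoiding (hj' _ (hu i)), twistAut_avoiding (hj' _ (hv i)),
          twistAut_of_ne hi]
      · rw [twistAut_of_notMem (B := (s : Set α)) his, twistAut_of_notMem (by simp [his, hi]),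
          twistAut_of_ne hi]

theorem inv_finset (hH : ContainsElementary H) (s : Finset α) : invAut s ∈ H := by
  induction s using Finset.induction_on with
  | empty =>
    convert one_mem H
    exact mulAut_ext fun i => by simp [invAut_of]
  | insert j s hj ih =>
    convert mul_mem (hH.inversion j) ih using 1
    refine mulAut_ext fun i => ?_
    rw [MulAut.mul_apply, invAut_of, invAut_of]
    by_cases hi : i = j
    · subst hi; simp [hj, invAut_of]
    · by_cases his : i ∈ s <;> simp [his, hi, invAut_of]

/-- Automorphisms which permute finitely many letters. -/
theorem mem_of_permutes (hH : ContainsElementary H) (A : Finset α) :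
    ∀ (n : ℕ) (φ : MulAut (FreeGroup α)), (∀ i, ∃ k, φ (of i) = of k) →
      (∀ i ∉ A, φ (of i) = of i) → (A.filter fun i => φ (of i) ≠ of i).card ≤ n → φ ∈ H := by
  intro n
  induction n with
  | zero =>
    intro φ _ h2 h3
    have h4 : (A.filter fun i => φ (of i) ≠ of i) = ∅ := Finset.card_eq_zero.1 (by omega)
    convert one_mem H
    refine mulAut_ext fun i => ?_
    by_cases hi : i ∈ A
    · by_contra h
      exact Finset.notMem_empty i (h4 ▸ Finset.mem_filter.2 ⟨hi, h⟩)
    · exact h2 i hi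
  | succ n ih =>
    intro φ h1 h2 h3
    by_cases hall : ∀ i ∈ A, φ (of i) = of i
    · exact ih φ h1 h2 (by rw [Finset.filter_false_of_mem (by simpa using hall)]; simp)
    push Not at hall
    obtain ⟨e, heA, he⟩ := hall
    obtain ⟨k, hk⟩ := h1 e
    have hke : k ≠ e := fun h => he (by rw [hk, h])
    -- The swap of `e` with its image `k` makes `e` fixed and spoils no letter that is already
    -- fixed, so the number of moved letters drops.
    have hfix : ∀ f, φ (of f) = of f → permAut (Equiv.swap e k) (φ (of f)) = of f := by
      intro f hf
      rw [hf, permAut_of, Equiv.swap_apply_of_ne_of_ne]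
      · rintro rfl; exact he hf
      · rintro rfl
        exact hke (FreeGroup.of_injective (φ.injective (hf.trans hk.symm)))
    have hmem : permAut (Equiv.swap e k) * φ ∈ H := by
      refine ih _ (fun i => ?_) (fun i hi => hfix i (h2 i hi)) ?_
      · obtain ⟨l, hl⟩ := h1 i
        exact ⟨_, by rw [MulAut.mul_apply, hl, permAut_of]⟩
      · refine Nat.lt_succ_iff.1 (lt_of_lt_of_le (Finset.card_lt_card ?_) h3)
        refine (Finset.ssubset_iff_of_subset fun i hi => ?_).2 ⟨e, ?_, ?_⟩
        · rw [Finset.mem_filter] at hi ⊢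
          exact ⟨hi.1, fun h' => hi.2 (hfix i h')⟩
        · exact Finset.mem_filter.2 ⟨heA, he⟩
        · rw [Finset.mem_filter, MulAut.mul_apply, hk, permAut_of]
          simp
    exact (Subgroup.mul_mem_cancel_left H (hH.swap e k)).1 hmem

end ContainsElementary

/-- The letter of a vertex; the base point has the trivial one. -/
def vertexLetter {β : Type*} : Option β → FreeGroup β
  | none => 1
  | some v => of v

/-- In a folded graph every label acts on the vertices as a partial injection; this turns it into a
permutation. -/
theorem exists_perm_extending {ι β : Type*} [DecidableEq β] (E : Finset ι) (s t : ι → β)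
    (hs : Set.InjOn s E) (ht : Set.InjOn t E) : ∃ π : Equiv.Perm β, ∀ e ∈ E, π (s e) = t e := by
  classical
  induction E using Finset.induction_on with
  | empty => exact ⟨1, by simp⟩
  | insert e₀ E he ih =>
    obtain ⟨π, hπ⟩ := ih (hs.mono (by simp)) (ht.mono (by simp))
    refine ⟨Equiv.swap (π (s e₀)) (t e₀) * π, fun e h => ?_⟩
    rw [Equiv.Perm.mul_apply]
    rcases Finset.mem_insert.1 h with rfl | h'
    · simp
    · have hne : e ≠ e₀ := by rintro rfl; exact he h'
      rw [Equiv.swap_apply_of_ne_of_ne, hπ e h']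
      · exact fun h2 => hne (hs (by simp [h']) (by simp) (π.injective h2))
      · rw [hπ e h']
        exact fun h2 => hne (ht (by simp [h']) (by simp) h2)

/-- The automorphism `φ` is described by a finite graph with edges `E`, the extra vertices `E \ A`
and the labels `l`, which are words in the letters of `A`. -/
structure IsLabelled (φ : MulAut (FreeGroup α)) (A E : Finset α) (v w : α → Option α)
    (l : α → List (α × Bool)) : Prop where
  subset : A ⊆ E
  source : ∀ e ∈ E, ∀ x ∈ v e, x ∈ E ∧ x ∉ A
  target : ∀ e ∈ E, ∀ x ∈ w e, x ∈ E ∧ x ∉ A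
  label : ∀ e ∈ E, ∀ x ∈ l e, x.1 ∈ A
  apply : ∀ e ∈ E,
    φ (of e) = vertexLetter (v e) * FreeGroup.mk (l e) * (vertexLetter (w e))⁻¹
  fixed : ∀ e ∉ E, φ (of e) = of e

theorem vertexLetter_avoiding {β : Type*} {B : Set β} {v : Option β} (h : ∀ x ∈ v, x ∉ B) :
    vertexLetter v ∈ avoiding B := by
  cases v with
  | none => exact one_mem _
  | some x => exact of_mem_avoiding (h x rfl)

/-- A vertex is eliminated with the help of an edge with trivial label. -/
theorem IsLabelled.collapse (hH : ContainsElementary H) {φ : MulAut (FreeGroup α)} {A E : Finset α}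
    {v w : α → Option α} {l : α → List (α × Bool)} (h : IsLabelled φ A E v w l) {e z : α}
    (he : e ∈ E) (hz : w e = some z) (hl : l e = []) :
    ∃ ψ v' w' l', (ψ ∈ H → φ ∈ H) ∧ IsLabelled ψ A (E.erase z) v' w' l' ∧
      ∀ f ∈ E.erase z, l' f = l (Equiv.swap e z f) := by
  have hzE := h.target e he z hz
  have hev := h.apply e he
  rw [hl, hz, ← FreeGroup.one_eq_mk, mul_one] at hev
  have hvz : v e ≠ some z := by
    intro hv
    rw [hv, mul_inv_cancel] at hev
    exact of_ne_one e (φ.injective (hev.trans (map_one φ).symm))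
  have hva : vertexLetter (v e) ∈ avoiding {z} :=
    vertexLetter_avoiding fun x hx => by rintro rfl; exact hvz hx
  -- The image of `e` is `vertexLetter (v e) * z⁻¹`. Merging the vertex `z` into `v e` by means of
  -- `θ` turns it into `z⁻¹`.
  let θ := twistAut {z} (fun _ => 1) (fun _ => vertexLetter (v e)) (fun _ => one_mem _)
    (fun _ => hva)
  have hθ : θ ∈ H := hH.twist_single _ _ _ _ _
  have hθz : θ (of z) = of z * vertexLetter (v e) := by
    simp only [θ]; rw [twistAut_self, one_mul]
  -- Other edges that start or end at `z` pick up a stray `z` from `θ`. Factors `e` and `e⁻¹`, whose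
  -- images are now `z⁻¹` and `z`, remove it.
  let a : α → FreeGroup α := fun f => if v f = some z then of e else 1
  let b : α → FreeGroup α := fun f => if w f = some z then (of e)⁻¹ else 1
  have hoe : of e ∈ avoiding ((E.erase e : Finset α) : Set α) := of_mem_avoiding (by simp)
  have ha : ∀ f, a f ∈ avoiding ((E.erase e : Finset α) : Set α) := by
    intro f; simp only [a]; split_ifs
    exacts [hoe, one_mem _]
  have hb : ∀ f, b f ∈ avoiding ((E.erase e : Finset α) : Set α) := by
    intro f; simp only [b]; split_ifs
    exacts [inv_mem hoe, one_mem _]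
  let ε := twistAut ((E.erase e : Finset α) : Set α) a b ha hb
  have hε : ε ∈ H := hH.twist _ _ _ _ _
  let p : Option α → Option α := fun x => if x = some z then v e else x
  have hp : ∀ x, (θ (vertexLetter x)) =
      (if x = some z then of z else 1) * vertexLetter (p x) := by
    intro x
    by_cases hx : x = some z
    · subst hx; simp [p, vertexLetter, hθz]
    · simp only [p, hx, if_false, one_mul]
      exact twistAut_avoiding (vertexLetter_avoiding fun y hy => by rintro rfl; exact hx hy)
  have hθe : θ (φ (of e)) = (of z)⁻¹ := by
    rw [hev, map_mul, map_inv, hp]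
    simp [hvz, p, vertexLetter, hθz]
  have hmk : ∀ f ∈ E, θ (FreeGroup.mk (l f)) = FreeGroup.mk (l f) := fun f hf =>
    twistAut_avoiding (mk_mem_avoiding fun x hx => by
      rintro rfl; exact hzE.2 (h.label f hf x hx))
  have hmain : ∀ f ∈ E, f ≠ e → (θ * φ * ε) (of f) =
      vertexLetter (p (v f)) * FreeGroup.mk (l f) * (vertexLetter (p (w f)))⁻¹ := by
    intro f hf hfe
    rw [MulAut.mul_apply, MulAut.mul_apply]
    simp only [ε]
    rw [twistAut_of_mem (by simp [hf, hfe]), map_mul, map_mul, map_mul, map_mul, h.apply f hf]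
    have h1 : θ (φ (a f)) = (if v f = some z then of z else 1)⁻¹ := by
      simp only [a]; split_ifs <;> simp [hθe]
    have h2 : θ (φ (b f)) = (if w f = some z then of z else 1) := by
      simp only [b]; split_ifs <;> simp [hθe]
    rw [h1, h2, map_mul, map_mul, map_inv, hp, hp, hmk f hf]
    group
  -- Now `e` goes to `z⁻¹` and the images of the other edges no longer mention the vertex `z`.
  -- Swapping and inverting makes the letter `z` fixed, so it leaves the graph; the edge that was
  -- called `z` takes over the free name `e`.
  let ψ := θ * φ * ε * permAut (Equiv.swap e z) * invAut {z}
  have hpE : ∀ x, (∀ y ∈ x, y ∈ E ∧ y ∉ A) → ∀ y ∈ p x, y ∈ E.erase z ∧ y ∉ A := by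
    intro x hx y hy
    simp only [p] at hy
    split_ifs at hy with h1
    · have := h.source e he y hy
      exact ⟨Finset.mem_erase.2 ⟨by rintro rfl; exact hvz hy, this.1⟩, this.2⟩
    · have := hx y hy
      exact ⟨Finset.mem_erase.2 ⟨by rintro rfl; exact h1 hy, this.1⟩, this.2⟩
  have hsw : ∀ f ∈ E.erase z, Equiv.swap e z f ∈ E ∧ Equiv.swap e z f ≠ e := by
    intro f hf
    rw [Finset.mem_erase] at hf
    constructor
    · rcases eq_or_ne f e with rfl | hfe
      · rw [Equiv.swap_apply_left]; exact hzE.1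
      · rw [Equiv.swap_apply_of_ne_of_ne hfe hf.1]; exact hf.2
    · intro h1
      exact hf.1 ((Equiv.swap e z).injective (h1.trans (Equiv.swap_apply_right e z).symm))
  refine ⟨ψ, fun f => p (v (Equiv.swap e z f)), fun f => p (w (Equiv.swap e z f)),
    fun f => l (Equiv.swap e z f), fun hψ => ?_, ?_, fun _ _ => rfl⟩
  · rwa [Subgroup.mul_mem_cancel_right H (hH.inversion z),
      Subgroup.mul_mem_cancel_right H (hH.swap e z), Subgroup.mul_mem_cancel_right H hε,
      Subgroup.mul_mem_cancel_left H hθ] at hψ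
  · refine ⟨fun x hx => Finset.mem_erase.2 ⟨by rintro rfl; exact hzE.2 hx, h.subset hx⟩,
      fun f hf => hpE _ (h.source _ (hsw f hf).1), fun f hf => hpE _ (h.target _ (hsw f hf).1),
      fun f hf => h.label _ (hsw f hf).1, fun f hf => ?_, fun f hf => ?_⟩
    · rw [← hmain _ (hsw f hf).1 (hsw f hf).2]
      simp only [ψ, MulAut.mul_apply]
      rw [invAut_of, if_neg (by simpa using (Finset.mem_erase.1 hf).1), permAut_of]
    · simp only [ψ, MulAut.mul_apply]
      by_cases hfz : f = z
      · subst hfz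
        rw [invAut_of, if_pos (by simp), map_inv, permAut_of, Equiv.swap_apply_right, map_inv,
          map_inv, map_inv]
        simp only [ε]
        rw [twistAut_of_notMem (by simp), hθe, inv_inv]
      · have hfE : f ∉ E := fun hfE => hf (Finset.mem_erase.2 ⟨hfz, hfE⟩)
        rw [invAut_of, if_neg (by simpa using hfz), permAut_of,
          Equiv.swap_apply_of_ne_of_ne (by rintro rfl; exact hfE he) hfz]
        simp only [ε]
        rw [twistAut_of_notMem (by simp [hfE]), h.fixed f hfE]
        exact twistAut_of_notMem hfz

end Nielsen

/-! ### Nielsen's theorem by Stallings folding -/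

section NielsenGeneration

variable {α : Type*} [DecidableEq α]

open FreeGroup (of lift lift_apply_of)

variable {H : Subgroup (MulAut (FreeGroup α))}

/-- Inverting letters before applying `φ` reverses the corresponding edges of the graph. -/
theorem IsLabelled.flip {φ : MulAut (FreeGroup α)} {A E : Finset α}
    {v w : α → Option α} {l : α → List (α × Bool)} (h : IsLabelled φ A E v w l) {s : Finset α}
    (hs : s ⊆ E) :
    IsLabelled (φ * invAut s) A E (fun f => if f ∈ s then w f else v f)
      (fun f => if f ∈ s then v f else w f)
      fun f => if f ∈ s then FreeGroup.invRev (l f) else l f where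
  subset := h.subset
  source f hf x hx := by
    split_ifs at hx
    exacts [h.target f hf x hx, h.source f hf x hx]
  target f hf x hx := by
    split_ifs at hx
    exacts [h.source f hf x hx, h.target f hf x hx]
  label f hf x hx := by
    split_ifs at hx
    · obtain ⟨y, hy, rfl⟩ := List.mem_map.1 (List.mem_reverse.1 hx)
      exact h.label f hf y hy
    · exact h.label f hf x hx
  apply f hf := by
    rw [MulAut.mul_apply, invAut_of]
    split_ifs
    · rw [map_inv, h.apply f hf, ← FreeGroup.inv_mk]
      group
    · exact h.apply f hf
  fixed f hf := by
    rw [MulAut.mul_apply, invAut_of, if_neg fun h' => hf (hs h'), h.fixed f hf]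

/-- Two edges with the same label and the same source: one of them is folded onto the other one. -/
theorem IsLabelled.fold (hH : ContainsElementary H) {φ : MulAut (FreeGroup α)} {A E : Finset α}
    {v w : α → Option α} {l : α → List (α × Bool)} (h : IsLabelled φ A E v w l) {e f : α}
    (he : e ∈ E) (hf : f ∈ E) (hef : e ≠ f) (hv : v e = v f) (hl : l e = l f) :
    ∃ ψ v', (ψ ∈ H → φ ∈ H) ∧
      IsLabelled ψ A E v' w fun i => if i = f then [] else l i := by
  -- The image of `e⁻¹ f` runs back along `e` and then along `f`. The common source and label
  -- cancel, which leaves an edge from `w e` to `w f` with empty label.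
  have ha : (of e)⁻¹ ∈ avoiding {f} := inv_mem (of_mem_avoiding hef)
  refine ⟨φ * twistAut {f} (fun _ => (of e)⁻¹) (fun _ => 1) (fun _ => ha) fun _ => one_mem _,
    fun i => if i = f then w e else v i,
    (Subgroup.mul_mem_cancel_right H (hH.twist_single _ _ _ _ _)).1, h.subset, ?_, h.target, ?_,
    ?_, ?_⟩
  · intro i hi x hx
    split_ifs at hx
    exacts [h.target e he x hx, h.source i hi x hx]
  · intro i hi x hx
    split_ifs at hx
    exacts [by simp at hx, h.label i hi x hx]
  · intro i hi
    rw [MulAut.mul_apply]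
    by_cases hif : i = f
    · subst hif
      rw [twistAut_self, map_mul, map_mul, map_inv, h.apply e he, h.apply i hi, if_pos rfl,
        if_pos rfl, ← FreeGroup.one_eq_mk, hv, hl, map_one]
      group
    · rw [twistAut_of_ne hif, h.apply i hi, if_neg hif, if_neg hif]
  · intro i hi
    rw [MulAut.mul_apply, twistAut_of_ne (by rintro rfl; exact hi hf), h.fixed i hi]

/-- Surjectivity of `φ` enters here: the images of the letters generate, so a point fixed by all of
them is fixed by the whole group. -/
theorem perm_fixes_of_surjective {γ β : Type*} {φ : MulAut (FreeGroup γ)}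
    {ρ : FreeGroup γ →* Equiv.Perm β} {b : β} (h : ∀ i, ρ (φ (of i)) b = b) (g : FreeGroup γ) :
    ρ g b = b := by
  obtain ⟨g, rfl⟩ := φ.surjective g
  refine FreeGroup.induction_on g (by simp) h (fun i _ => ?_) fun x y hx hy => ?_
  · rw [map_inv, map_inv, Equiv.Perm.inv_eq_iff_eq]
    exact (h i).symm
  · rw [map_mul, map_mul, Equiv.Perm.mul_apply, hy, hx]

/-- A folded graph has no vertex besides the base point. -/
theorem IsLabelled.eq_of_folded {φ : MulAut (FreeGroup α)} {A E : Finset α}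
    {v w : α → Option α} {a : α → α} (h : IsLabelled φ A E v w fun e => [(a e, true)])
    (hv : ∀ e ∈ E, ∀ f ∈ E, a e = a f → v e = v f → e = f)
    (hw : ∀ e ∈ E, ∀ f ∈ E, a e = a f → w e = w f → e = f) : E ⊆ A := by
  have hπ : ∀ c, ∃ π : Equiv.Perm (Option α), ∀ e ∈ E.filter fun e => a e = c,
      π (w e) = v e := by
    intro c
    refine exists_perm_extending _ _ _ ?_ ?_
    · intro e he f hf hef
      simp only [Finset.coe_filter, mem_ofPred_eq] at he hf
      exact hw e he.1 f hf.1 (he.2.trans hf.2.symm) hef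
    · intro e he f hf hef
      simp only [Finset.coe_filter, mem_ofPred_eq] at he hf
      exact hv e he.1 f hf.1 (he.2.trans hf.2.symm) hef
  choose π hπ using hπ
  -- Letters of `A` act by permutations that extend the edges they label, and an extra vertex acts
  -- by its transposition with the base point. Then each `φ (of i)` fixes the base point, whereas
  -- the letter of an extra vertex moves it.
  let ρ : FreeGroup α →* Equiv.Perm (Option α) := lift fun i =>
    if i ∈ A then π i else if i ∈ E then Equiv.swap none (some i) else 1
  have hρ : ∀ x : Option α, (∀ y ∈ x, y ∈ E ∧ y ∉ A) →
      ρ (vertexLetter x) none = x ∧ ρ (vertexLetter x) x = none := by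
    rintro (_ | x) hx
    · simp [vertexLetter]
    · simp [vertexLetter, ρ, hx x rfl]
  have hfix := perm_fixes_of_surjective (φ := φ) (ρ := ρ) (b := none) fun i => by
    by_cases hi : i ∈ E
    · rw [h.apply i hi, map_mul, map_mul, map_inv, Equiv.Perm.mul_apply, Equiv.Perm.mul_apply]
      have h1 := (hρ _ (h.source i hi)).2
      have h2 := (Equiv.Perm.inv_eq_iff_eq).2 (hρ _ (h.target i hi)).2.symm
      have h3 : ρ (FreeGroup.mk [(a i, true)]) = π (a i) := by
        have := h.label i hi (a i, true) (by simp)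
        simp only [ρ]
        simp [this]
      rw [h2, h3, hπ (a i) i (by simp [hi]), h1]
    · rw [h.fixed i hi]
      have : i ∉ A := fun hA => hi (h.subset hA)
      simp [ρ, hi, this]
  intro x hx
  by_contra hxA
  have h1 := (hρ (some x) (by rintro y ⟨⟩; exact ⟨hx, hxA⟩)).1
  rw [hfix] at h1
  cases h1

/-- Such an edge is collapsed, after a reversal if only its source is an extra vertex. If both of
its ends were the base point, `φ` would send its letter to `1`. -/
theorem IsLabelled.mem_of_empty_label (hH : ContainsElementary H) {φ : MulAut (FreeGroup α)}
    {A E : Finset α} {v w : α → Option α} {l : α → List (α × Bool)} (h : IsLabelled φ A E v w l)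
    (hl : ∀ e ∈ E, (l e).length ≤ 1) {e : α} (he : e ∈ E) (hle : l e = [])
    (ih : ∀ (E' : Finset α) (φ : MulAut (FreeGroup α)) (v w : α → Option α)
      (l : α → List (α × Bool)), E' ⊂ E → IsLabelled φ A E' v w l →
      (∀ e ∈ E', (l e).length ≤ 1) → φ ∈ H) : φ ∈ H := by
  have key : ∀ (φ : MulAut (FreeGroup α)) (v w : α → Option α) (l : α → List (α × Bool)),
      IsLabelled φ A E v w l → (∀ e ∈ E, (l e).length ≤ 1) → ∀ z, w e = some z → l e = [] →
      φ ∈ H := by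
    intro φ v w l h hl z hz hle
    obtain ⟨ψ, v', w', l', h1, h2, h3⟩ := h.collapse hH he hz hle
    refine h1 (ih _ ψ v' w' l' (Finset.erase_ssubset (h.target e he z hz).1) h2 fun f hf => ?_)
    rw [h3 f hf]
    refine hl _ ?_
    rcases eq_or_ne f e with rfl | hfe
    · rw [Equiv.swap_apply_left]; exact (h.target f he z hz).1
    · rw [Equiv.swap_apply_of_ne_of_ne hfe (Finset.mem_erase.1 hf).1]; exact (Finset.mem_erase.1 hf).2
  cases hw : w e with
  | some z => exact key φ v w l h hl z hw hle
  | none =>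
    cases hv : v e with
    | none =>
      have := h.apply e he
      rw [hw, hv, hle, ← FreeGroup.one_eq_mk] at this
      simp only [vertexLetter, mul_one, inv_one] at this
      exact absurd (φ.injective (this.trans (map_one φ).symm)) (of_ne_one e)
    | some z =>
      refine (Subgroup.mul_mem_cancel_right H (hH.inversion e)).1
        (key _ _ _ _ (h.flip (s := {e}) (by simpa using he)) (fun f hf => ?_) z (by simp [hv])
          (by simp [hle]))
      split_ifs
      · rw [FreeGroup.invRev_length]; exact hl f hf
      · exact hl f hf

/-- Induction on the set of edges. When no label is empty, reversals make every label a positive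
letter. A fold of two edges with the same letter and a common end creates an empty label, hence a
smaller graph; if no fold is possible, there are no extra vertices and `φ` permutes letters. -/
theorem IsLabelled.mem_of_short (hH : ContainsElementary H) (A E : Finset α) :
    ∀ (φ : MulAut (FreeGroup α)) (v w : α → Option α) (l : α → List (α × Bool)),
      IsLabelled φ A E v w l → (∀ e ∈ E, (l e).length ≤ 1) → φ ∈ H := by
  induction E using Finset.strongInduction with
  | H E ih =>
    intro φ v w l h hl
    by_cases hex : ∃ e ∈ E, l e = []
    · obtain ⟨e, he, hle⟩ := hex
      exact h.mem_of_empty_label hH hl he hle fun E' φ v w l hE' => ih E' hE' φ v w l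
    push Not at hex
    classical
    have hpos : ∃ (φ' : MulAut (FreeGroup α)) (v w : α → Option α) (a : α → α),
        (φ' ∈ H → φ ∈ H) ∧ IsLabelled φ' A E v w fun e => [(a e, true)] := by
      let s := E.filter fun e => ∃ c, l e = [(c, false)]
      have hlet : ∀ e ∈ E, ∃ c, l e = [(c, !decide (e ∈ s))] := by
        intro e he
        obtain ⟨⟨c, b⟩, hx⟩ := List.length_eq_one_iff.1
          (le_antisymm (hl e he) (List.length_pos_iff.2 (hex e he)))
        refine ⟨c, ?_⟩
        cases b <;> simp [s, he, hx]
      choose! a ha using hlet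
      have h1 := h.flip (s := s) (Finset.filter_subset _ _)
      refine ⟨_, _, _, a, (Subgroup.mul_mem_cancel_right H (hH.inv_finset s)).1,
        h1.subset, h1.source, h1.target, fun e he x hx => ?_, fun e he => ?_, h1.fixed⟩
      · have := h.label e he (a e, !decide (e ∈ s)) (by rw [ha e he]; simp)
        simp only [List.mem_singleton] at hx
        rw [hx]; exact this
      · rw [h1.apply e he, ha e he]
        by_cases hes : e ∈ s <;> simp [hes, FreeGroup.invRev]
    obtain ⟨φ', v, w, a, hφ, h⟩ := hpos
    refine hφ ?_
    by_cases hfv : ∀ e ∈ E, ∀ f ∈ E, a e = a f → v e = v f → e = f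
    · by_cases hfw : ∀ e ∈ E, ∀ f ∈ E, a e = a f → w e = w f → e = f
      · have hEA := h.eq_of_folded hfv hfw
        have hnone : ∀ x : Option α, (∀ y ∈ x, y ∈ E ∧ y ∉ A) → vertexLetter x = 1 := by
          rintro (_ | x) hx
          · rfl
          · exact absurd (hEA (hx x rfl).1) (hx x rfl).2
        refine hH.mem_of_permutes E _ φ' (fun i => ?_) h.fixed le_rfl
        by_cases hi : i ∈ E
        · refine ⟨a i, ?_⟩
          rw [h.apply i hi, hnone _ (h.source i hi), hnone _ (h.target i hi)]
          simp [of]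
        · exact ⟨i, h.fixed i hi⟩
      · push Not at hfw
        obtain ⟨e, he, f, hf, haef, hwef, hef⟩ := hfw
        -- Reversing all edges turns the common target into a common source.
        have h1 := h.flip (s := E) subset_rfl
        obtain ⟨ψ, v', hψ, h2⟩ := h1.fold hH he hf hef (by simp [he, hf, hwef])
          (by simp [he, hf, haef])
        refine (Subgroup.mul_mem_cancel_right H (hH.inv_finset E)).1 (hψ ?_)
        refine h2.mem_of_empty_label hH (fun i hi => ?_) hf (by simp)
          fun E' φ v w l hE' => ih E' hE' φ v w l
        split_ifs <;> simp [FreeGroup.invRev]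
    · push Not at hfv
      obtain ⟨e, he, f, hf, haef, hvef, hef⟩ := hfv
      obtain ⟨ψ, v', hψ, h2⟩ := h.fold hH he hf hef hvef (by simp [haef])
      refine hψ (h2.mem_of_empty_label hH (fun i hi => ?_) hf (by simp)
        fun E' φ v w l hE' => ih E' hE' φ v w l)
      split_ifs <;> simp

/-- Long labels are subdivided, by induction on the total excess length. The infinite alphabet
supplies a fresh name for the new edge and the new vertex. -/
theorem IsLabelled.mem [Infinite α] (hH : ContainsElementary H) (A : Finset α) :
    ∀ (n : ℕ) (E : Finset α) (φ : MulAut (FreeGroup α)) (v w : α → Option α)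
      (l : α → List (α × Bool)), IsLabelled φ A E v w l →
      ∑ e ∈ E, ((l e).length - 1) ≤ n → φ ∈ H := by
  intro n
  induction n with
  | zero =>
    intro E φ v w l h hn
    refine IsLabelled.mem_of_short hH A E φ v w l h fun e he => ?_
    have := Finset.sum_eq_zero_iff.1 (Nat.le_zero.1 hn) e he
    omega
  | succ n ih =>
    intro E φ v w l h hn
    by_cases hshort : ∀ e ∈ E, (l e).length ≤ 1
    · exact IsLabelled.mem_of_short hH A E φ v w l h hshort
    push Not at hshort
    obtain ⟨e, he, hle⟩ := hshort
    obtain ⟨z, hz⟩ := Infinite.exists_notMem_finset E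
    have hze : z ≠ e := by rintro rfl; exact hz he
    obtain ⟨c, l', hcl⟩ : ∃ c l', l e = c :: l' := List.exists_cons_of_length_pos (by omega)
    have hzA : z ∉ A := fun hA => hz (h.subset hA)
    have hav : ∀ x : Option α, (∀ y ∈ x, y ∈ E ∧ y ∉ A) → vertexLetter x ∈ avoiding {z} :=
      fun x hx => vertexLetter_avoiding fun y hy => by
        rintro rfl; exact hz (hx y hy).1
    have hal : ∀ f ∈ E, FreeGroup.mk (l f) ∈ avoiding {z} := fun f hf =>
      mk_mem_avoiding fun x hx => by rintro rfl; exact hzA (h.label f hf x hx)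
    have hac : FreeGroup.mk [c] ∈ avoiding {z} := mk_mem_avoiding fun x hx => by
      rw [List.mem_singleton.1 hx]
      rintro rfl; exact hzA (h.label e he c (by simp [hcl]))
    -- The first letter `c` is split off: the new edge `z` reads `c` from `v e` to the new vertex
    -- `z`, so its image must be `g * z⁻¹`; the edge `e` keeps the rest of the label and starts at
    -- the vertex `z`.
    let g := vertexLetter (v e) * FreeGroup.mk [c]
    have hg : g ∈ avoiding {z} := mul_mem (hav _ (h.source e he)) hac
    let θ := twistAut {z} (fun _ => 1) (fun _ => g⁻¹) (fun _ => one_mem _) fun _ => inv_mem hg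
    have hθ : θ ∈ H := hH.twist_single _ _ _ _ _
    have hθa : ∀ x ∈ avoiding {z}, (θ * invAut {z}) x = x := by
      intro x hx
      rw [MulAut.mul_apply, invAut_avoiding (by simpa using hx)]
      exact twistAut_avoiding hx
    have hθz : (θ * invAut {z}) (of z) = g * (of z)⁻¹ := by
      rw [MulAut.mul_apply, invAut_of, if_pos (by simp), map_inv]
      simp only [θ]
      rw [twistAut_self]
      group
    have hoz : (of z)⁻¹ ∈ avoiding {e} := inv_mem (of_mem_avoiding hze)
    let ε := twistAut {e} (fun _ => (of z)⁻¹) (fun _ => 1) (fun _ => hoz) fun _ => one_mem _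
    have hε : ε ∈ H := hH.twist_single _ _ _ _ _
    let ψ := (θ * invAut {z}) * φ * ε
    have hψ : ψ ∈ H → φ ∈ H := fun hψ => by
      rwa [Subgroup.mul_mem_cancel_right H hε,
        Subgroup.mul_mem_cancel_left H (mul_mem hθ (hH.inversion z))] at hψ
    have hφE : ∀ f ∈ E, (θ * invAut {z}) (φ (of f)) = φ (of f) := fun f hf => by
      refine hθa _ ?_
      rw [h.apply f hf]
      exact mul_mem (mul_mem (hav _ (h.source f hf)) (hal f hf)) (inv_mem (hav _ (h.target f hf)))
    have hφz : (θ * invAut {z}) (φ (of z)) = g * (of z)⁻¹ := by rw [h.fixed z hz, hθz]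
    have hzE : ∀ f ∈ E, f ≠ z := by rintro f hf rfl; exact hz hf
    refine hψ (ih (insert z E) ψ (fun f => if f = e then some z else if f = z then v e else v f)
      (fun f => if f = z then some z else w f)
      (fun f => if f = e then l' else if f = z then [c] else l f) ⟨?_, ?_, ?_, ?_, ?_, ?_⟩ ?_)
    · exact h.subset.trans (Finset.subset_insert _ _)
    · intro f hf x hx
      have hsub : ∀ y, y ∈ E ∧ y ∉ A → y ∈ insert z E ∧ y ∉ A :=
        fun y hy => ⟨Finset.mem_insert_of_mem hy.1, hy.2⟩
      split_ifs at hx with h1 h2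
      · cases hx; exact ⟨Finset.mem_insert_self _ _, hzA⟩
      · exact hsub x (h.source e he x hx)
      · exact hsub x (h.source f ((Finset.mem_insert.1 hf).resolve_left h2) x hx)
    · intro f hf x hx
      split_ifs at hx with h1
      · cases hx; exact ⟨Finset.mem_insert_self _ _, hzA⟩
      · have := h.target f ((Finset.mem_insert.1 hf).resolve_left h1) x hx
        exact ⟨Finset.mem_insert_of_mem this.1, this.2⟩
    · intro f hf x hx
      split_ifs at hx with h1 h2
      · exact h.label e he x (by simp [hcl, hx])
      · rw [List.mem_singleton.1 hx]; exact h.label e he c (by simp [hcl])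
      · exact h.label f ((Finset.mem_insert.1 hf).resolve_left h2) x hx
    · intro f hf
      simp only [ψ]
      rw [MulAut.mul_apply, MulAut.mul_apply]
      simp only [ε]
      by_cases h1 : f = e
      · subst h1
        rw [twistAut_self, map_mul, map_mul, map_mul, map_mul, map_inv, map_inv, hφE f he, hφz,
          h.apply f he, hcl, if_pos rfl, if_pos rfl, if_neg hze.symm, map_one, map_one]
        rw [show FreeGroup.mk (c :: l') = FreeGroup.mk [c] * FreeGroup.mk l' by
          rw [FreeGroup.mul_mk]; rfl]
        simp only [g, vertexLetter]
        group
      · rw [twistAut_of_ne h1, if_neg h1, if_neg h1]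
        by_cases h2 : f = z
        · subst h2
          rw [hφz, if_pos rfl, if_pos rfl, if_pos rfl]
          simp only [g, vertexLetter]
        · have hfE := (Finset.mem_insert.1 hf).resolve_left h2
          rw [hφE f hfE, if_neg h2, if_neg h2, if_neg h2, h.apply f hfE]
    · intro f hf
      rw [Finset.mem_insert, not_or] at hf
      simp only [ψ]
      rw [MulAut.mul_apply, MulAut.mul_apply]
      simp only [ε]
      rw [twistAut_of_ne (by rintro rfl; exact hf.2 he), h.fixed f hf.2]
      exact hθa _ (of_mem_avoiding hf.1)
    · rw [Finset.sum_insert hz, if_neg hze, if_pos rfl]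
      have h1 : ∑ f ∈ E, ((if f = e then l' else if f = z then [c] else l f).length - 1) + 1 =
          ∑ f ∈ E, ((l f).length - 1) := by
        rw [← Finset.add_sum_erase E _ he, ← Finset.add_sum_erase E _ he, if_pos rfl, hcl]
        have h2 : ∑ f ∈ E.erase e, ((if f = e then l' else if f = z then [c] else l f).length - 1) =
            ∑ f ∈ E.erase e, ((l f).length - 1) := by
          refine Finset.sum_congr rfl fun f hf => ?_
          rw [if_neg (Finset.mem_erase.1 hf).1, if_neg (hzE f (Finset.mem_erase.1 hf).2)]
        rw [h2]
        rw [hcl] at hle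
        simp only [List.length_cons] at hle ⊢
        omega
      simp only [List.length_singleton]
      omega

/-- **Nielsen's theorem**, in a stable form: the automorphisms of a free group of infinite rank which
fix all but finitely many letters are generated by the elementary ones. -/
theorem ContainsElementary.mem_of_finitary [Infinite α] (hH : ContainsElementary H)
    (φ : MulAut (FreeGroup α)) (A : Finset α) (hφ : ∀ i ∉ A, φ (of i) = of i) : φ ∈ H := by
  -- With all letters of the images included, `φ` is described by a rose: every edge is a loop at
  -- the base point, labelled by its image.
  let A' : Finset α := A ∪ A.biUnion fun a => ((φ (of a)).toWord.map Prod.fst).toFinset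
  refine IsLabelled.mem hH A' _ A' φ (fun _ => none) (fun _ => none) (fun e => (φ (of e)).toWord)
    ⟨subset_rfl, by simp, by simp, fun e he x hx => ?_, fun e he => ?_, fun e he => hφ e ?_⟩ le_rfl
  · by_cases heA : e ∈ A
    · exact Finset.mem_union_right _ (Finset.mem_biUnion.2 ⟨e, heA,
        List.mem_toFinset.2 (List.mem_map.2 ⟨x, hx, rfl⟩)⟩)
    · rw [hφ e heA, FreeGroup.toWord_of, List.mem_singleton] at hx
      rw [hx]; exact he
  · rw [FreeGroup.mk_toWord]; simp [vertexLetter]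
  · exact fun h => he (Finset.mem_union_left _ h)

end NielsenGeneration

/-! ### Automorphisms that are conjugated translations on the rays -/

section Rigid

open FreeGroup (of lift lift_apply_of)

variable {r : ℕ}

/-- The automorphism `φ` sends the letters `x_{i,n}` with `n ≥ N i` to the conjugates under `g i` of the
letters `x_{σ i,n - N i + k i}`. -/
def IsRigid (φ : MulAut (FreeGroup (Fin r × ℕ))) (σ : Equiv.Perm (Fin r)) (N k : Fin r → ℕ)
    (g : Fin r → FreeGroup (Fin r × ℕ)) : Prop :=
  ∀ i m, φ (of (i, N i + m)) = g i * of (σ i, k i + m) * (g i)⁻¹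

variable {φ ψ : MulAut (FreeGroup (Fin r × ℕ))} {σ τ : Equiv.Perm (Fin r)} {N k N' k' : Fin r → ℕ}
  {g g' : Fin r → FreeGroup (Fin r × ℕ)}

theorem IsRigid.shift (h : IsRigid φ σ N k g) (M : Fin r → ℕ) :
    IsRigid φ σ (fun i => N i + M i) (fun i => k i + M i) g := fun i m => by
  simp only [add_assoc]
  exact h i _

theorem IsRigid.one : IsRigid (1 : MulAut (FreeGroup (Fin r × ℕ))) 1 0 0 1 := fun i m => by simp

/-- The image tails of `ψ` must lie in the tails of `φ`. At least one of the two truncated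
differences is zero, according to which of `k' i` and `N (τ i)` is larger. -/
theorem IsRigid.mul (h : IsRigid φ σ N k g) (h' : IsRigid ψ τ N' k' g') :
    IsRigid (φ * ψ) (σ * τ) (fun i => N' i + (N (τ i) - k' i))
      (fun i => k (τ i) + (k' i - N (τ i))) (fun i => φ (g' i) * g (τ i)) := fun i m => by
  have h1 : k' i + (N (τ i) - k' i + m) = N (τ i) + (k' i - N (τ i) + m) := by omega
  rw [MulAut.mul_apply, add_assoc, h', map_mul, map_mul, map_inv, h1, h, Equiv.Perm.mul_apply,
    add_assoc]
  group

theorem IsRigid.inv (h : IsRigid φ σ N k g) :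
    IsRigid φ⁻¹ σ⁻¹ (fun i => k (σ⁻¹ i)) (fun i => N (σ⁻¹ i))
      (fun i => (φ⁻¹ (g (σ⁻¹ i)))⁻¹) := fun i m => by
  apply φ.injective
  have hσ : σ (σ⁻¹ i) = i := Equiv.apply_symm_apply σ i
  simp only [map_mul, map_inv, MulAut.apply_inv_self, inv_inv]
  rw [h, hσ]
  group

/-- The automorphisms which are rigid on the tails of all the rays, preserve the rays and are a
translation on the tail of the ray `i₀`. -/
def normalizedRigid (i₀ : Fin r) : Subgroup (MulAut (FreeGroup (Fin r × ℕ))) where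
  carrier := {φ | ∃ N k g, IsRigid φ 1 N k g ∧ g i₀ = 1}
  mul_mem' := by
    rintro φ ψ ⟨N, k, g, h, hg⟩ ⟨N', k', g', h', hg'⟩
    exact ⟨_, _, _, by simpa using h.mul h', by simp [hg, hg']⟩
  one_mem' := ⟨_, _, _, IsRigid.one, rfl⟩
  inv_mem' := by
    rintro φ ⟨N, k, g, h, hg⟩
    exact ⟨_, _, _, by simpa using h.inv, by simp [hg]⟩

/-- The homomorphisms to `ℤ/2` which vanish on the letters `x_{i,n}` with `n ≥ N i`. -/
def tailKilling (N : Fin r → ℕ) : Set (FreeGroup (Fin r × ℕ) →* Multiplicative (ZMod 2)) :=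
  {χ | ∀ i m, χ (of (i, N i + m)) = 1}

open Classical in
noncomputable def tailKillingEquiv (N : Fin r → ℕ) :
    tailKilling N ≃ ((Σ i, Fin (N i)) → Multiplicative (ZMod 2)) where
  toFun χ p := χ.1 (of (p.1, p.2))
  invFun f := ⟨lift fun j => if h : j.2 < N j.1 then f ⟨j.1, j.2, h⟩ else 1, fun i m => by simp⟩
  left_inv χ := by
    ext ⟨i, n⟩
    by_cases h : n < N i
    · simp [h]
    · obtain ⟨m, rfl⟩ := Nat.exists_eq_add_of_le (not_lt.1 h)
      simp [χ.2 i m]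
  right_inv f := by
    funext p
    simp

/-- Homomorphisms to `ℤ/2` ignore the conjugators, so composition with `φ` matches those that vanish
beyond `k` with those that vanish beyond `N`. They are free on the letters before the tails, so
there are `2 ^ ∑ k` and `2 ^ ∑ N` of them. -/
theorem IsRigid.sum_eq (h : IsRigid φ 1 N k g) : ∑ i, N i = ∑ i, k i := by
  have hχ : ∀ (χ : FreeGroup (Fin r × ℕ) →* Multiplicative (ZMod 2)) i m,
      χ (φ (of (i, N i + m))) = χ (of (i, k i + m)) := fun χ i m => by
    rw [h, map_mul, map_mul, map_inv, mul_inv_cancel_comm]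
    rfl
  let e : tailKilling k ≃ tailKilling N :=
    { toFun := fun χ => ⟨χ.1.comp φ.toMonoidHom, fun i m => (hχ χ.1 i m).trans (χ.2 i m)⟩
      invFun := fun χ => ⟨χ.1.comp φ.symm.toMonoidHom, fun i m => by
        rw [← χ.2 i m, ← hχ]
        simp⟩
      left_inv := fun χ => by ext; simp
      right_inv := fun χ => by ext; simp }
  have h1 := Nat.card_congr ((tailKillingEquiv k).symm.trans (e.trans (tailKillingEquiv N)))
  simp only [Nat.card_eq_fintype_card, Fintype.card_fun, Fintype.card_sigma, Fintype.card_fin] at h1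
  have h2 : Fintype.card (Multiplicative (ZMod 2)) = 2 := rfl
  rw [h2] at h1
  exact (Nat.pow_right_injective le_rfl h1).symm

end Rigid

/-! ### The generators: shifts, a swap, an inversion, a transvection, conjugated rays -/

section FiniteGeneration

open FreeGroup (of lift lift_apply_of)

variable {r : ℕ} (i₀ : Fin r)

/-- The permutation of the letters which moves those on the ray `i₀` away from the core and those on the
ray `i` towards the core. -/
def shiftPerm (i : Fin r) (hi : i ≠ i₀) : Equiv.Perm (Fin r × ℕ) where
  toFun j := if j.1 = i₀ then (i₀, j.2 + 1) else if j.1 = i then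
    (if j.2 = 0 then (i₀, 0) else (i, j.2 - 1)) else j
  invFun j := if j.1 = i then (i, j.2 + 1) else if j.1 = i₀ then
    (if j.2 = 0 then (i, 0) else (i₀, j.2 - 1)) else j
  left_inv := by
    rintro ⟨a, n⟩
    by_cases h1 : a = i₀
    · subst h1; simp [hi.symm]
    · by_cases h2 : a = i
      · subst h2
        rcases n with _ | n <;> simp [h1, hi.symm]
      · simp [h1, h2]
  right_inv := by
    rintro ⟨a, n⟩
    by_cases h1 : a = i
    · subst h1; simp [hi]
    · by_cases h2 : a = i₀
      · subst h2
        rcases n with _ | n <;> simp [h1, hi]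
      · simp [h1, h2]

variable {i₀} {i : Fin r} {hi : i ≠ i₀}

@[simp] theorem shiftPerm_base (n : ℕ) : shiftPerm i₀ i hi (i₀, n) = (i₀, n + 1) := by
  simp [shiftPerm]

@[simp] theorem shiftPerm_zero : shiftPerm i₀ i hi (i, 0) = (i₀, 0) := by
  simp [shiftPerm, hi]

@[simp] theorem shiftPerm_succ (n : ℕ) : shiftPerm i₀ i hi (i, n + 1) = (i, n) := by
  simp [shiftPerm, hi]

theorem shiftPerm_other {a : Fin r} (h : a ≠ i₀) (h' : a ≠ i) (n : ℕ) :
    shiftPerm i₀ i hi (a, n) = (a, n) := by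
  simp [shiftPerm, h, h']

theorem shiftPerm_rigid (hi : i ≠ i₀) : IsRigid (permAut (shiftPerm i₀ i hi)) 1
    (Pi.single i 1) (Pi.single i₀ 1) 1 := fun a m => by
  rw [permAut_of]
  by_cases h1 : a = i₀
  · subst h1; simp [hi.symm, add_comm]
  · by_cases h2 : a = i
    · subst h2; simp [h1, add_comm]
    · simp [h1, h2, shiftPerm_other]

/-- The tail of the ray `i`. -/
def tail (i : Fin r) (N : ℕ) : Set (Fin r × ℕ) := {j | j.1 = i ∧ N ≤ j.2}

/-- The generators of the group of normalized rigid automorphisms. -/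
inductive IsGenerator (i₀ : Fin r) : MulAut (FreeGroup (Fin r × ℕ)) → Prop
  | shift (i : Fin r) (hi : i ≠ i₀) : IsGenerator i₀ (permAut (shiftPerm i₀ i hi))
  | swap : IsGenerator i₀ (permAut (Equiv.swap (i₀, 0) (i₀, 1)))
  | inversion : IsGenerator i₀ (invAut {(i₀, 0)})
  | transvection (φ : MulAut (FreeGroup (Fin r × ℕ)))
      (h0 : φ (of (i₀, 0)) = of (i₀, 0) * of (i₀, 1)) (h1 : ∀ j ≠ (i₀, 0), φ (of j) = of j) :
      IsGenerator i₀ φ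
  | conj (i : Fin r) (hi : i ≠ i₀) (φ : MulAut (FreeGroup (Fin r × ℕ)))
      (h0 : ∀ n, φ (of (i, n)) = of (i₀, 0) * of (i, n) * (of (i₀, 0))⁻¹)
      (h1 : ∀ j, j.1 ≠ i → φ (of j) = of j) : IsGenerator i₀ φ

theorem finite_generators (i₀ : Fin r) : {φ | IsGenerator i₀ φ}.Finite := by
  classical
  let S : Set (MulAut (FreeGroup (Fin r × ℕ))) :=
    (range fun p : {i : Fin r // i ≠ i₀} => permAut (shiftPerm i₀ p.1 p.2)) ∪
    {permAut (Equiv.swap (i₀, 0) (i₀, 1)), invAut {(i₀, 0)}} ∪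
    {φ | φ (of (i₀, 0)) = of (i₀, 0) * of (i₀, 1) ∧ ∀ j ≠ (i₀, 0), φ (of j) = of j} ∪
    ⋃ i : Fin r, {φ | (∀ n, φ (of (i, n)) = of (i₀, 0) * of (i, n) * (of (i₀, 0))⁻¹) ∧
      ∀ j, j.1 ≠ i → φ (of j) = of j}
  refine Set.Finite.subset (s := S) ?_ ?_
  · refine ((Set.finite_range _).union (by simp)).union ?_ |>.union (Set.finite_iUnion fun i => ?_)
    -- The last two families prescribe the values on all letters, so each of the sets has at most
    -- one element.
    · refine Set.Subsingleton.finite fun φ hφ ψ hψ => mulAut_ext fun j => ?_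
      by_cases hj : j = (i₀, 0)
      · subst hj; rw [hφ.1, hψ.1]
      · rw [hφ.2 j hj, hψ.2 j hj]
    · refine Set.Subsingleton.finite fun φ hφ ψ hψ => mulAut_ext fun ⟨a, n⟩ => ?_
      by_cases hj : a = i
      · subst hj; rw [hφ.1, hψ.1]
      · rw [hφ.2 _ hj, hψ.2 _ hj]
  · rintro φ (⟨i, hi⟩ | _ | _ | ⟨_, h0, h1⟩ | ⟨i, hi, _, h0, h1⟩)
    · exact Or.inl (Or.inl (Or.inl ⟨⟨i, hi⟩, rfl⟩))
    · exact Or.inl (Or.inl (Or.inr (by simp)))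
    · exact Or.inl (Or.inl (Or.inr (by simp)))
    · exact Or.inl (Or.inr ⟨h0, h1⟩)
    · exact Or.inr (mem_iUnion.2 ⟨i, h0, h1⟩)

theorem isRigid_of_fixed {φ : MulAut (FreeGroup (Fin r × ℕ))} {M : ℕ}
    (h : ∀ j : Fin r × ℕ, M ≤ j.2 → φ (of j) = of j) : IsRigid φ 1 (fun _ => M) (fun _ => M) 1 :=
  fun i m => by rw [h _ (by simp)]; simp

theorem IsGenerator.mem_normalizedRigid {φ : MulAut (FreeGroup (Fin r × ℕ))}
    (h : IsGenerator i₀ φ) : φ ∈ normalizedRigid i₀ := by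
  cases h with
  | shift i hi => exact ⟨_, _, _, shiftPerm_rigid hi, rfl⟩
  | swap =>
    refine ⟨_, _, _, isRigid_of_fixed (M := 2) fun j hj => ?_, rfl⟩
    rw [permAut_of, Equiv.swap_apply_of_ne_of_ne] <;> rintro rfl <;> simp at hj
  | inversion =>
    refine ⟨_, _, _, isRigid_of_fixed (M := 2) fun j hj => ?_, rfl⟩
    rw [invAut_of, if_neg]
    simp only [Finset.mem_singleton]
    rintro rfl; simp at hj
  | transvection _ h0 h1 =>
    exact ⟨_, _, _, isRigid_of_fixed (M := 2) fun j hj => h1 _ (by rintro rfl; simp at hj), rfl⟩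
  | conj i hi _ h0 h1 =>
    refine ⟨0, 0, fun a => if a = i then of (i₀, 0) else 1, fun a m => ?_, by simp [hi.symm]⟩
    by_cases ha : a = i
    · subst ha; simp [h0]
    · simp [ha, h1]

end FiniteGeneration

/-! ### Finite generation of the normalized rigid automorphisms -/

section FiniteGeneration

open FreeGroup (of lift lift_apply_of)

variable {r : ℕ} {i₀ : Fin r} {H : Subgroup (MulAut (FreeGroup (Fin r × ℕ)))}

theorem permAut_swap_conj {α : Type*} [DecidableEq α] {H : Subgroup (MulAut (FreeGroup α))}
    {π : Equiv.Perm α} {a b : α} (hπ : permAut π ∈ H) (h : permAut (Equiv.swap a b) ∈ H) :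
    permAut (Equiv.swap (π a) (π b)) ∈ H := by
  rw [Equiv.swap_apply_apply, permAut_mul, permAut_mul, permAut_inv]
  exact mul_mem (mul_mem hπ h) (inv_mem hπ)

theorem permAut_swap_trans {α : Type*} [DecidableEq α] {H : Subgroup (MulAut (FreeGroup α))}
    {a b c : α} (h : permAut (Equiv.swap a b) ∈ H) (h' : permAut (Equiv.swap b c) ∈ H) :
    permAut (Equiv.swap a c) ∈ H := by
  by_cases hca : c = a
  · subst hca; rw [Equiv.swap_self]; exact permAut_one (α := α) ▸ one_mem H
  by_cases hcb : c = b
  · subst hcb; exact h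
  · have := permAut_swap_conj h h'
    rwa [Equiv.swap_apply_right, Equiv.swap_apply_of_ne_of_ne hca hcb] at this

theorem permAut_swap_comm {α : Type*} [DecidableEq α] {H : Subgroup (MulAut (FreeGroup α))}
    {a b : α} (h : permAut (Equiv.swap a b) ∈ H) : permAut (Equiv.swap b a) ∈ H := by
  rwa [Equiv.swap_comm]

/-- A shift, acting by conjugation, carries the swap of the first two letters out along the ray
`i₀`; inverse shifts carry letters from the ray `i₀` onto the other rays. -/
theorem swap_mem_of_generators (hH : ∀ φ, IsGenerator i₀ φ → φ ∈ H) (hr : 2 ≤ r)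
    (j k : Fin r × ℕ) : permAut (Equiv.swap j k) ∈ H := by
  obtain ⟨i₁, hi₁⟩ : ∃ i₁ : Fin r, i₁ ≠ i₀ :=
    haveI : Nontrivial (Fin r) := Fin.nontrivial_iff_two_le.2 hr
    exists_ne i₀
  have h1 : ∀ n, permAut (Equiv.swap (i₀, n) (i₀, n + 1)) ∈ H := by
    intro n
    induction n with
    | zero => exact hH _ .swap
    | succ n ih => simpa using permAut_swap_conj (hH _ (.shift i₁ hi₁)) ih
  have h2 : ∀ n, permAut (Equiv.swap (i₀, 0) (i₀, n)) ∈ H := by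
    intro n
    induction n with
    | zero => rw [Equiv.swap_self]; exact permAut_one (α := Fin r × ℕ) ▸ one_mem H
    | succ n ih => exact permAut_swap_trans ih (h1 n)
  have h3 : ∀ i ≠ i₀, ∀ m n, permAut (Equiv.swap (i, m) (i₀, n)) ∈ H := by
    intro i hi m
    have hinv : permAut (shiftPerm i₀ i hi)⁻¹ ∈ H :=
      permAut_inv (shiftPerm i₀ i hi) ▸ inv_mem (hH _ (.shift i hi))
    have e1 : (shiftPerm i₀ i hi)⁻¹ (i₀, 0) = (i, 0) :=
      (Equiv.symm_apply_eq _).2 (by simp)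
    have e2 : ∀ n, (shiftPerm i₀ i hi)⁻¹ (i₀, n + 1) = (i₀, n) :=
      fun n => (Equiv.symm_apply_eq _).2 (by simp)
    have e3 : ∀ n, (shiftPerm i₀ i hi)⁻¹ (i, n) = (i, n + 1) :=
      fun n => (Equiv.symm_apply_eq _).2 (by simp)
    induction m with
    | zero =>
      intro n
      have := permAut_swap_conj hinv (h2 (n + 1))
      rwa [e1, e2] at this
    | succ m ih =>
      intro n
      have := permAut_swap_conj hinv (ih (n + 1))
      rwa [e3, e2] at this
  have h4 : ∀ j, permAut (Equiv.swap j (i₀, 0)) ∈ H := by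
    rintro ⟨i, n⟩
    by_cases hi : i = i₀
    · subst hi; exact permAut_swap_comm (h2 n)
    · exact h3 i hi n 0
  exact permAut_swap_trans (h4 j) (permAut_swap_comm (h4 k))

/-- Swaps are available, and inversions and transvections are conjugate under products of swaps to
the chosen generators. -/
theorem containsElementary_of_generators (hH : ∀ φ, IsGenerator i₀ φ → φ ∈ H) (hr : 2 ≤ r) :
    ContainsElementary H where
  swap := swap_mem_of_generators hH hr
  inversion j := by
    have h1 := swap_mem_of_generators hH hr (i₀, 0) j
    refine (Subgroup.mul_mem_cancel_right H h1).1 ?_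
    convert mul_mem h1 (hH _ .inversion) using 1
    refine mulAut_ext fun i => ?_
    rw [MulAut.mul_apply, MulAut.mul_apply, permAut_of, invAut_of, invAut_of]
    simp only [Finset.mem_singleton]
    by_cases hi : i = (i₀, 0)
    · subst hi; simp
    · rw [if_neg hi, if_neg, permAut_of]
      rwa [Equiv.swap_apply_eq_iff, Equiv.swap_apply_right]
  transvection j k hjk φ h1 h2 := by
    have hne : ((i₀, 0) : Fin r × ℕ) ≠ (i₀, 1) := by simp
    let b := Equiv.swap (i₀, 0) j (i₀, 1)
    have hb : b ≠ j := fun h => by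
      have h' : Equiv.swap (i₀, 0) j (i₀, 1) = j := h
      rw [Equiv.swap_apply_eq_iff, Equiv.swap_apply_right] at h'
      exact hne h'.symm
    -- The first swap puts `(i₀, 0)` at `j` and `(i₀, 1)` at `b`; the second moves `b` to `k` and
    -- leaves `j`, which differs from both, in place.
    let π := Equiv.swap b k * Equiv.swap (i₀, 0) j
    have hπ : permAut π ∈ H := by
      rw [permAut_mul]
      exact mul_mem (swap_mem_of_generators hH hr _ _) (swap_mem_of_generators hH hr _ _)
    have hπ0 : π (i₀, 0) = j := by
      simp only [π, Equiv.Perm.mul_apply, Equiv.swap_apply_left]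
      exact Equiv.swap_apply_of_ne_of_ne hb.symm hjk
    have hπ1 : π (i₀, 1) = k := Equiv.swap_apply_left b k
    let T := twistAut {((i₀, 0) : Fin r × ℕ)} (fun _ => 1) (fun _ => of (i₀, 1))
      (fun _ => one_mem _) fun _ => of_mem_avoiding (Ne.symm hne)
    have hT0 : T (of (i₀, 0)) = of (i₀, 0) * of (i₀, 1) := by
      simp only [T]; rw [twistAut_self, one_mul]
    have hT1 : ∀ i ≠ (i₀, 0), T (of i) = of i := fun i hi => twistAut_of_ne hi
    refine (Subgroup.mul_mem_cancel_right H hπ).1 ?_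
    convert mul_mem hπ (hH T (.transvection T hT0 hT1)) using 1
    refine mulAut_ext fun i => ?_
    rw [MulAut.mul_apply, MulAut.mul_apply, permAut_of]
    by_cases hi : i = (i₀, 0)
    · subst hi
      rw [hπ0, h1, hT0, map_mul, permAut_of, permAut_of, hπ0, hπ1]
    · rw [hT1 i hi, permAut_of, h2]
      rw [← hπ0]
      exact fun h => hi (π.injective h)

/-- The conjugation is multiplicative in `g`, with the order reversed, because `g` avoids the tail.
It therefore suffices to conjugate by a single letter. -/
theorem tail_conj_mem (hH : ∀ φ, IsGenerator i₀ φ → φ ∈ H) (hr : 2 ≤ r) {i : Fin r} (hi : i ≠ i₀)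
    (N : ℕ) (g : FreeGroup (Fin r × ℕ)) (hg : g ∈ avoiding (tail i N)) :
    twistAut (tail i N) (fun _ => g) (fun _ => g⁻¹) (fun _ => hg) (fun _ => inv_mem hg) ∈ H := by
  have hE := containsElementary_of_generators hH hr
  have hbase : ∀ M, of (i₀, 0) ∈ avoiding (tail i M) := fun M =>
    of_mem_avoiding fun h => hi h.1.symm
  refine avoiding_induction (p := fun g hg => twistAut (tail i N) (fun _ => g) (fun _ => g⁻¹)
    (fun _ => hg) (fun _ => inv_mem hg) ∈ H) ?_ ?_ ?_ ?_ hg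
  · intro k hk
    let T0 := twistAut (tail i N) (fun _ => of (i₀, 0)) (fun _ => (of (i₀, 0))⁻¹)
      (fun _ => hbase N) fun _ => inv_mem (hbase N)
    have hT0 : T0 ∈ H := by
      -- The generator `K` conjugates the entire ray; a twist of the first `N` letters undoes this
      -- before the tail.
      let K := twistAut (tail i 0) (fun _ => of (i₀, 0)) (fun _ => (of (i₀, 0))⁻¹)
        (fun _ => hbase 0) fun _ => inv_mem (hbase 0)
      have hK : K ∈ H := hH K (.conj i hi K
        (fun n => twistAut_of_mem ⟨rfl, Nat.zero_le n⟩)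
        fun j hj => twistAut_of_notMem fun h => hj h.1)
      let s : Finset (Fin r × ℕ) := {i} ×ˢ Finset.range N
      have hs : of (i₀, 0) ∈ avoiding (s : Set (Fin r × ℕ)) :=
        of_mem_avoiding (by simpa [s] using fun _ => hi)
      have hF := hE.twist s (fun _ => (of (i₀, 0))⁻¹) (fun _ => of (i₀, 0))
        (fun _ => inv_mem hs) (fun _ => hs)
      convert mul_mem hK hF using 1
      refine mulAut_ext fun ⟨a, n⟩ => ?_
      simp only [T0, K]
      rw [MulAut.mul_apply]
      by_cases ha : a = i
      · subst ha
        have hn0 : (a, n) ∈ tail a 0 := ⟨rfl, Nat.zero_le n⟩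
        by_cases hn : N ≤ n
        · have hnN : (a, n) ∈ tail a N := ⟨rfl, hn⟩
          rw [twistAut_of_mem hnN, twistAut_of_notMem (by simp [s, hn]), twistAut_of_mem hn0]
        · rw [twistAut_of_notMem fun h => hn h.2, twistAut_of_mem (by simpa [s] using hn), map_mul,
            map_mul, twistAut_of_mem hn0, map_inv, twistAut_avoiding (hbase 0)]
          group
      · rw [twistAut_of_notMem fun h => ha h.1, twistAut_of_notMem (by simpa [s] using fun _ => Ne.symm ha),
          twistAut_of_notMem fun h => ha h.1]
    -- This swap fixes the tail letterwise, so conjugation by it replaces the conjugating letter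
    -- `(i₀, 0)` by `k`.
    have hπ := hE.swap k (i₀, 0)
    refine (Subgroup.mul_mem_cancel_right H hπ).1 ?_
    convert mul_mem hπ hT0 using 1
    have hfix : ∀ j ∈ tail i N, Equiv.swap k (i₀, 0) j = j := fun j hj =>
      Equiv.swap_apply_of_ne_of_ne (by rintro rfl; exact hk hj) (by rintro rfl; exact hi hj.1.symm)
    refine mulAut_ext fun j => ?_
    simp only [T0]
    rw [MulAut.mul_apply, MulAut.mul_apply, permAut_of]
    by_cases hj : j ∈ tail i N
    · rw [hfix j hj, twistAut_of_mem hj, twistAut_of_mem hj, map_mul, map_mul, map_inv, permAut_of,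
        permAut_of, hfix j hj, Equiv.swap_apply_right]
    · rw [twistAut_of_notMem hj, permAut_of, twistAut_of_notMem]
      intro h
      have := hfix _ h
      rw [Equiv.swap_apply_self] at this
      exact hj (this ▸ h)
  · convert one_mem H
    refine mulAut_ext fun j => ?_
    by_cases hj : j ∈ tail i N
    · rw [twistAut_of_mem hj]; simp
    · rw [twistAut_of_notMem hj]; rfl
  · intro g h hg hh h1 h2
    convert mul_mem h2 h1 using 1
    refine mulAut_ext fun j => ?_
    rw [MulAut.mul_apply]
    by_cases hj : j ∈ tail i N
    · rw [twistAut_of_mem hj, twistAut_of_mem hj, map_mul, map_mul, map_inv, twistAut_of_mem hj,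
        twistAut_avoiding hg]
      group
    · rw [twistAut_of_notMem hj, twistAut_of_notMem hj, twistAut_of_notMem hj]
  · intro g hg h1
    convert inv_mem h1 using 1
    rw [eq_inv_iff_mul_eq_one]
    refine mulAut_ext fun j => ?_
    rw [MulAut.mul_apply]
    by_cases hj : j ∈ tail i N
    · rw [twistAut_of_mem hj, map_mul, map_mul, map_inv, twistAut_of_mem hj,
        twistAut_avoiding hg]
      simp [mul_assoc]
    · rw [twistAut_of_notMem hj, twistAut_of_notMem hj]; rfl

/-- Composition with the shift for the ray `i`, or with its inverse, changes the translation there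
by one and otherwise affects only the ray `i₀`, which is not counted in the sum. -/
theorem IsRigid.exists_translation_free (hH : ∀ φ, IsGenerator i₀ φ → φ ∈ H) (n : ℕ) :
    ∀ (φ : MulAut (FreeGroup (Fin r × ℕ))) (N k : Fin r → ℕ) (g : Fin r → FreeGroup (Fin r × ℕ)),
      IsRigid φ 1 N k g → g i₀ = 1 →
      ∑ i ∈ Finset.univ.erase i₀, ((N i : ℤ) - k i).natAbs ≤ n →
      ∃ (ψ : MulAut (FreeGroup (Fin r × ℕ))) (N' k' : Fin r → ℕ)
        (g' : Fin r → FreeGroup (Fin r × ℕ)), (ψ ∈ H → φ ∈ H) ∧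
        IsRigid ψ 1 N' k' g' ∧ g' i₀ = 1 ∧ ∀ i ≠ i₀, N' i = k' i := by
  induction n with
  | zero =>
    intro φ N k g h hg hn
    refine ⟨φ, N, k, g, id, h, hg, fun i hi => ?_⟩
    have := Finset.sum_eq_zero_iff.1 (Nat.le_zero.1 hn) i (by simp [hi])
    omega
  | succ n ih =>
    intro φ N k g h hg hn
    by_cases hall : ∀ i ≠ i₀, N i = k i
    · exact ⟨φ, N, k, g, id, h, hg, hall⟩
    push Not at hall
    obtain ⟨i, hi, hne⟩ := hall
    have hsum : ∀ N' k' : Fin r → ℕ, (∀ a, a ≠ i₀ → a ≠ i → (N' a : ℤ) - k' a = N a - k a) →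
        ((N' i : ℤ) - k' i).natAbs + 1 = ((N i : ℤ) - k i).natAbs →
        ∑ i ∈ Finset.univ.erase i₀, ((N' i : ℤ) - k' i).natAbs ≤ n := by
      intro N' k' h1 h2
      have hmem : i ∈ Finset.univ.erase i₀ := by simp [hi]
      rw [← Finset.add_sum_erase _ _ hmem] at hn ⊢
      rw [Finset.sum_congr rfl fun a ha => by
        rw [h1 a (by simp at ha; exact ha.2) (by simp at ha; exact ha.1)]]
      omega
    have hs := shiftPerm_rigid hi
    rcases lt_or_gt_of_ne hne with hlt | hgt
    · have hr := (hs.mul h)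
      obtain ⟨ψ, N', k', g', h1, h2⟩ := ih _ _ _ _ hr (by simp [hg]) (hsum _ _ (fun a ha ha' => by
        simp [ha, ha'] ) (by simp [hi]; omega))
      exact ⟨ψ, N', k', g', fun hψ =>
        (Subgroup.mul_mem_cancel_left H (hH _ (.shift i hi))).1 (h1 hψ), h2⟩
    · have hs' : IsRigid (permAut (shiftPerm i₀ i hi))⁻¹ 1 (Pi.single i₀ 1) (Pi.single i 1) 1 := by
        intro a m
        apply (permAut (shiftPerm i₀ i hi)).injective
        rw [MulAut.apply_inv_self]
        simpa using (hs a m).symm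
      have hr := hs'.mul h
      obtain ⟨ψ, N', k', g', h1, h2⟩ := ih _ _ _ _ hr (by simp [hg]) (hsum _ _ (fun a ha ha' => by
        simp [ha, ha'] ) (by simp [hi]; omega))
      exact ⟨ψ, N', k', g', fun hψ =>
        (Subgroup.mul_mem_cancel_left H (inv_mem (hH _ (.shift i hi)))).1 (h1 hψ), h2⟩

/-- The union of the tails of all rays. -/
def tails (r M : ℕ) : Set (Fin r × ℕ) := {j | M ≤ j.2}

theorem mem_tails {M : ℕ} {j : Fin r × ℕ} : j ∈ tails r M ↔ M ≤ j.2 := Iff.rfl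

theorem tails_anti {M M' : ℕ} (h : M ≤ M') : tails r M' ⊆ tails r M := fun _ hj =>
  h.trans (mem_tails.1 hj)

theorem tail_subset_tails (i : Fin r) (M : ℕ) : tail i M ⊆ tails r M := fun _ hj => hj.2

theorem exists_bound_letters (s : Finset (FreeGroup (Fin r × ℕ))) :
    ∃ M, ∀ g ∈ s, g ∈ avoiding (tails r M) := by
  refine ⟨(s.biUnion fun g => (g.toWord.map fun x => x.1.2).toFinset).sup id + 1, fun g hg =>
    mem_avoiding_of_toWord fun x hx h => ?_⟩
  have : x.1.2 ∈ s.biUnion fun g => (g.toWord.map fun x => x.1.2).toFinset :=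
    Finset.mem_biUnion.2 ⟨g, hg, List.mem_toFinset.2 (List.mem_map.2 ⟨x, hx, rfl⟩)⟩
  have h1 := Finset.le_sup (f := id) this
  have h2 := mem_tails.1 h
  simp only [id] at h1
  omega

/-- The rays are treated one at a time: no `g i` involves a tail letter, so every conjugation fixes
the conjugators of the other rays. The ray `i₀`, for which no conjugation is at hand, needs none. -/
theorem tails_conj_mem (hH : ∀ φ, IsGenerator i₀ φ → φ ∈ H) (hr : 2 ≤ r) (M : ℕ)
    (g : Fin r → FreeGroup (Fin r × ℕ)) (hgM : ∀ i, g i ∈ avoiding (tails r M))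
    (hg : g i₀ = 1) :
    twistAut (tails r M) (fun j => g j.1) (fun j => (g j.1)⁻¹) (fun _ => hgM _)
      (fun _ => inv_mem (hgM _)) ∈ H := by
  let θ : Finset (Fin r) → MulAut (FreeGroup (Fin r × ℕ)) := fun s =>
    twistAut (tails r M) (fun j => if j.1 ∈ s then g j.1 else 1)
      (fun j => if j.1 ∈ s then (g j.1)⁻¹ else 1)
      (fun j => by split_ifs; exacts [hgM _, one_mem _])
      (fun j => by split_ifs; exacts [inv_mem (hgM _), one_mem _])
  have hθ : ∀ s, θ s ∈ H := by
    intro s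
    induction s using Finset.induction_on with
    | empty =>
      convert one_mem H
      refine mulAut_ext fun j => ?_
      by_cases hj : j ∈ tails r M
      · simp only [θ]; rw [twistAut_of_mem hj]; simp
      · exact twistAut_of_notMem hj
    | insert i s hi ih =>
      by_cases hii : i = i₀
      · convert ih using 1
        refine mulAut_ext fun j => ?_
        simp only [θ]
        by_cases hj : j ∈ tails r M
        · rw [twistAut_of_mem hj, twistAut_of_mem hj]
          by_cases hji : j.1 = i
          · simp [hji, hii, hg]
          · simp [hji]
        · rw [twistAut_of_notMem hj, twistAut_of_notMem hj]
      · have hsub : tail i M ⊆ (tails r M) := fun j hj => hj.2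
        have hgt : ∀ a, g a ∈ avoiding (tail i M) := fun a => avoiding_anti hsub (hgM a)
        convert mul_mem (tail_conj_mem hH hr hii M (g i) (hgt i)) ih using 1
        refine mulAut_ext fun j => ?_
        rw [MulAut.mul_apply]
        simp only [θ]
        by_cases hj : j ∈ tails r M
        · rw [twistAut_of_mem hj, twistAut_of_mem hj]
          by_cases hji : j.1 = i
          · subst hji
            rw [if_neg hi, if_neg hi, one_mul, mul_one, twistAut_of_mem (show j ∈ tail j.1 M from ⟨rfl, hj⟩)]
            simp
          · have hjt : twistAut (tail i M) (fun _ => g i) (fun _ => (g i)⁻¹) (fun _ => hgt i)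
                (fun _ => inv_mem (hgt i)) (of j) = of j := twistAut_of_notMem fun h => hji h.1
            have hga : twistAut (tail i M) (fun _ => g i) (fun _ => (g i)⁻¹) (fun _ => hgt i)
                (fun _ => inv_mem (hgt i)) (g j.1) = g j.1 := twistAut_avoiding (hgt _)
            by_cases hjs : j.1 ∈ s
            · simp [hjs, hjt, hga]
            · simp [hjs, hji, hjt]
        · rw [twistAut_of_notMem hj, twistAut_of_notMem hj, twistAut_of_notMem fun h => hj (tail_subset_tails i M h)]
  convert hθ Finset.univ using 1
  simp [θ]

theorem normalizedRigid_le (hH : ∀ φ, IsGenerator i₀ φ → φ ∈ H) (hr : 2 ≤ r) :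
    normalizedRigid i₀ ≤ H := by
  rintro φ ⟨N, k, g, h, hg⟩
  have hE := containsElementary_of_generators hH hr
  obtain ⟨φ', N, k, g, h1, h, hg, hN⟩ := IsRigid.exists_translation_free hH _ φ N k g h hg le_rfl
  refine h1 ?_
  have hNk : N = k := by
    -- Since the total translation vanishes, the absence of translation on the other rays forces it
    -- on `i₀`.
    have h1 : N i₀ + ∑ i ∈ Finset.univ.erase i₀, N i = ∑ i, N i :=
      Finset.add_sum_erase _ _ (Finset.mem_univ i₀)
    have h2 : k i₀ + ∑ i ∈ Finset.univ.erase i₀, k i = ∑ i, k i :=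
      Finset.add_sum_erase _ _ (Finset.mem_univ i₀)
    have h3 : ∑ i ∈ Finset.univ.erase i₀, N i = ∑ i ∈ Finset.univ.erase i₀, k i :=
      Finset.sum_congr rfl fun i hi => hN i (Finset.ne_of_mem_erase hi)
    have h4 := h.sum_eq
    funext i
    by_cases hi : i = i₀
    · subst hi; omega
    · exact hN i hi
  subst hNk
  obtain ⟨M₀, hM₀⟩ := exists_bound_letters (Finset.univ.image g)
  -- Beyond `M` all rays are rigid, and no conjugator involves a letter that far out.
  let M := M₀ + ∑ i, N i
  have hM : ∀ i, N i ≤ M := fun i =>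
    (Finset.single_le_sum (fun _ _ => Nat.zero_le _) (Finset.mem_univ i)).trans
      (Nat.le_add_left _ _)
  have hgM : ∀ i, g i ∈ avoiding (tails r M) := fun i =>
    avoiding_anti (tails_anti (Nat.le_add_right _ _)) (hM₀ _ (by simp))
  have htail : ∀ i n, M ≤ n → φ' (of (i, n)) = g i * of (i, n) * (g i)⁻¹ := fun i n hn => by
    obtain ⟨m, rfl⟩ := Nat.exists_eq_add_of_le ((hM i).trans hn)
    exact h i m
  let θ := twistAut (tails r M) (fun j => g j.1) (fun j => (g j.1)⁻¹) (fun j => hgM _)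
    fun j => inv_mem (hgM _)
  have : Nonempty (Fin r) := ⟨i₀⟩
  -- Dividing by the conjugation of the tails leaves an automorphism that fixes all letters from `M`
  -- on, to which Nielsen's theorem applies.
  refine (Subgroup.mul_mem_cancel_left H (inv_mem (tails_conj_mem hH hr M g hgM hg))).1
    (hE.mem_of_finitary _ (Finset.univ ×ˢ Finset.range M) fun j hj => ?_)
  have hj : M ≤ j.2 := by simpa using hj
  rw [MulAut.mul_apply]
  apply θ.injective
  rw [MulAut.apply_inv_self]
  have h5 : θ (of j) = g j.1 * of j * (g j.1)⁻¹ := twistAut_of_mem (mem_tails.2 hj)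
  rw [h5]
  exact htail j.1 j.2 hj

theorem normalizedRigid_eq_closure (i₀ : Fin r) (hr : 2 ≤ r) :
    normalizedRigid i₀ = Subgroup.closure {φ | IsGenerator i₀ φ} :=
  le_antisymm (normalizedRigid_le (fun _ h => Subgroup.subset_closure h) hr)
    ((Subgroup.closure_le _).2 fun _ h => IsGenerator.mem_normalizedRigid h)

theorem normalizedRigid_fg (i₀ : Fin r) (hr : 2 ≤ r) : Group.FG (normalizedRigid i₀) := by
  rw [Group.fg_iff_subgroup_fg, normalizedRigid_eq_closure i₀ hr]
  exact (Subgroup.fg_iff _).2 ⟨_, rfl, finite_generators i₀⟩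

end FiniteGeneration

/-! ### The word problem for normalized rigid automorphisms -/

section WordProblemInRigid

open FreeGroup (of)

/-- Free reduction is a right fold whose step only compares the new letter with the head of the
reduced word. -/
theorem primrec_reduce {α : Type*} [Primcodable α] [DecidableEq α] :
    Primrec (FreeGroup.reduce (α := α)) := by
  have hstep : Primrec fun p : ((α × Bool) × List (α × Bool)) × (α × Bool) × List (α × Bool) =>
      if p.1.1.1 = p.2.1.1 ∧ p.1.1.2 = not p.2.1.2 then p.2.2 else p.1.1 :: p.2.1 :: p.2.2 := by
    refine Primrec.ite (PrimrecPred.and ?_ ?_) ?_ ?_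
    · exact Primrec.eq.comp (Primrec.fst.comp (Primrec.fst.comp Primrec.fst))
        (Primrec.fst.comp (Primrec.fst.comp Primrec.snd))
    · exact Primrec.eq.comp (Primrec.snd.comp (Primrec.fst.comp Primrec.fst))
        (Primrec.not.comp (Primrec.snd.comp (Primrec.fst.comp Primrec.snd)))
    · exact Primrec.snd.comp Primrec.snd
    · exact Primrec.list_cons.comp (Primrec.fst.comp Primrec.fst)
        (Primrec.list_cons.comp (Primrec.fst.comp Primrec.snd) (Primrec.snd.comp Primrec.snd))
  have hcons : Primrec₂ fun (_ : List (α × Bool)) (p : (α × Bool) × List (α × Bool)) =>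
      (List.casesOn p.2 [p.1] fun hd tl =>
        if p.1.1 = hd.1 ∧ p.1.2 = not hd.2 then tl else p.1 :: hd :: tl : List (α × Bool)) :=
    (Primrec.list_casesOn (Primrec.snd.comp Primrec.snd)
      (Primrec.list_cons.comp (Primrec.fst.comp Primrec.snd) (Primrec.const []))
      (hstep.comp (Primrec.pair (Primrec.snd.comp Primrec.fst) Primrec.snd)).to₂).to₂
  refine (Primrec.list_foldr Primrec.id (Primrec.const []) hcons).of_eq fun L => ?_
  induction L with
  | nil => rfl
  | cons x L ih =>
    rw [FreeGroup.reduce.cons, ← ih]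
    rfl

theorem primrec_invRev {α : Type*} [Primcodable α] : Primrec (FreeGroup.invRev (α := α)) :=
  Primrec.list_reverse.comp (Primrec.list_map Primrec.id
    ((Primrec.pair (Primrec.fst.comp Primrec.snd)
      (Primrec.not.comp (Primrec.snd.comp Primrec.snd))).to₂))

/-- The word which is obtained from `l` by substituting the words `t j` for the letters `j`. -/
def substitute {α : Type*} (t : α → List (α × Bool)) (l : List (α × Bool)) : List (α × Bool) :=
  l.flatMap fun x => if x.2 = true then t x.1 else FreeGroup.invRev (t x.1)

theorem mk_substitute {α : Type*} {φ : MulAut (FreeGroup α)} {t : α → List (α × Bool)}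
    (h : ∀ j, FreeGroup.mk (t j) = φ (of j)) (l : List (α × Bool)) :
    FreeGroup.mk (substitute t l) = φ (FreeGroup.mk l) := by
  induction l with
  | nil => exact (map_one φ).symm
  | cons x l ih =>
    have h1 : FreeGroup.mk (x :: l) = FreeGroup.mk [x] * FreeGroup.mk l := by
      rw [FreeGroup.mul_mk]; rfl
    have h2 : substitute t (x :: l) =
      (if x.2 = true then t x.1 else FreeGroup.invRev (t x.1)) ++ substitute t l := rfl
    rw [h1, h2, map_mul, ← FreeGroup.mul_mk, ih]
    congr 1
    obtain ⟨j, b⟩ := x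
    cases b
    · have : FreeGroup.mk [(j, false)] = (of j)⁻¹ := rfl
      simp [this, ← h, FreeGroup.inv_mk]
    · exact h j

theorem primrec_substitute {α β : Type*} [Primcodable α] [Primcodable β]
    {t : β → α → List (α × Bool)} (h : Primrec₂ t) :
    Primrec₂ fun b l => substitute (t b) l := by
  refine Primrec.list_flatMap Primrec.snd ?_
  have h1 : Primrec fun p : (β × List (α × Bool)) × α × Bool => t p.1.1 p.2.1 :=
    h.comp (Primrec.fst.comp Primrec.fst) (Primrec.fst.comp Primrec.snd)
  exact Primrec.ite (Primrec.eq.comp (Primrec.snd.comp Primrec.snd) (Primrec.const true)) h1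
    (primrec_invRev.comp h1)

/-- If `g` begins with another letter, then `x_i` followed by the word of `g` is reduced. It has the
length of the word of `g` followed by `x_i` and represents the same element, so the two words
coincide, contradicting their first letters. -/
theorem notMem_head_of_commute {α : Type*} [DecidableEq α] {g : FreeGroup α} {i : α}
    (hc : g * of i = of i * g) {x : α × Bool} {L : List (α × Bool)} (hL : g.toWord = x :: L) :
    x.1 = i := by
  by_contra hne
  have hred : FreeGroup.IsReduced ((i, true) :: x :: L) := by
    rw [FreeGroup.isReduced_cons_cons]
    refine ⟨fun h => absurd h.symm hne, ?_⟩
    rw [← hL]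
    exact FreeGroup.isReduced_toWord
  have h1 : FreeGroup.mk ((x :: L) ++ [(i, true)]) = FreeGroup.mk ((i, true) :: x :: L) := by
    have e1 : FreeGroup.mk ((x :: L) ++ [(i, true)]) = g * of i := by
      rw [← FreeGroup.mul_mk, ← hL, FreeGroup.mk_toWord]; rfl
    have e2 : FreeGroup.mk ((i, true) :: x :: L) = of i * g := by
      conv_rhs => rw [← FreeGroup.mk_toWord (x := g), hL]
      exact (FreeGroup.mul_mk (L₁ := [(i, true)])).symm
    rw [e1, e2, hc]
  have h2 : FreeGroup.Red ((x :: L) ++ [(i, true)]) ((i, true) :: x :: L) := by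
    rw [← hred.reduce_eq, ← FreeGroup.reduce.sound h1]
    exact FreeGroup.reduce.red
  have h3 := h2.sublist.eq_of_length (by simp)
  simp only [List.cons_append, List.cons.injEq] at h3
  exact hne (by rw [← h3.1])

/-- An element which commutes with two different letters is trivial. -/
theorem eq_one_of_commute_pair {α : Type*} {g : FreeGroup α} {i j : α} (hij : i ≠ j)
    (hi : g * of i = of i * g) (hj : g * of j = of j * g) : g = 1 := by
  classical
  rcases h : g.toWord with _ | ⟨x, L⟩
  · exact FreeGroup.toWord_eq_nil_iff.1 h
  · exact absurd ((notMem_head_of_commute hi h).symm.trans (notMem_head_of_commute hj h)) hij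

variable {r : ℕ} {i₀ : Fin r}

/-- A rigid automorphism which fixes two consecutive letters on the tail of each ray fixes the tails. -/
theorem IsRigid.eq_one_of_fixed {φ : MulAut (FreeGroup (Fin r × ℕ))} {N k : Fin r → ℕ}
    {g : Fin r → FreeGroup (Fin r × ℕ)} (h : IsRigid φ 1 N k g)
    (hfix : ∀ i n, n < N i + 2 → φ (of (i, n)) = of (i, n)) : φ = 1 := by
  refine mulAut_ext fun ⟨i, n⟩ => ?_
  by_cases hn : n < N i + 2
  · exact hfix i n hn
  have h0 := (h i 0).symm.trans (hfix i (N i + 0) (by omega))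
  have h1 := (h i 1).symm.trans (hfix i (N i + 1) (by omega))
  have hk : k i = N i := by
    have := eq_of_conj_of_eq (h0.trans (by group : _ = 1 * of (i, N i + 0) * 1⁻¹))
    simpa using this
  rw [hk] at h0 h1
  -- Two fixed letters on the tail show that the conjugator commutes with two distinct letters.
  have hg : g i = 1 :=
    eq_one_of_commute_pair (i := (i, N i + 0)) (j := (i, N i + 1)) (by simp)
      (mul_inv_eq_iff_eq_mul.1 h0) (mul_inv_eq_iff_eq_mul.1 h1)
  obtain ⟨m, rfl⟩ := Nat.exists_eq_add_of_le (show N i ≤ n by omega)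
  rw [h i m, hk, hg]
  simp

/-- The automorphism which a signed generator stands for. -/
def evalLetter {G : Type*} [Group G] {n : ℕ} (s : Fin n → G) (a : Fin n × Bool) : G :=
  if a.2 then s a.1 else (s a.1)⁻¹

/-- There are finitely many signed generators and rays, so one constant `C` serves as the start of
all tails. -/
theorem exists_uniform_rigid {n : ℕ} {ψ : Fin n → MulAut (FreeGroup (Fin r × ℕ))}
    (hψ : ∀ k, ψ k ∈ normalizedRigid i₀) : ∃ (C : ℕ) (K : Fin n × Bool → Fin r → ℕ)
      (g : Fin n × Bool → Fin r → FreeGroup (Fin r × ℕ)),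
      ∀ a, IsRigid (evalLetter ψ a) 1 (fun _ => C) (K a) (g a) := by
  have h : ∀ a, ∃ N k g, IsRigid (evalLetter ψ a) 1 N k g := fun a => by
    have : evalLetter ψ a ∈ normalizedRigid i₀ := by
      unfold evalLetter
      split
      · exact hψ _
      · exact inv_mem (hψ _)
    obtain ⟨N, k, g, h, -⟩ := this
    exact ⟨N, k, g, h⟩
  choose N k g h using h
  let C := Finset.univ.sup fun p : (Fin n × Bool) × Fin r => N p.1 p.2
  have hC : ∀ a i, N a i ≤ C := fun a i =>
    Finset.le_sup (f := fun p : (Fin n × Bool) × Fin r => N p.1 p.2) (Finset.mem_univ (a, i))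
  refine ⟨C, fun a i => k a i + (C - N a i), g, fun a => ?_⟩
  have := (h a).shift fun i => C - N a i
  simpa only [Nat.add_sub_cancel' (hC a _)] using this

/-- Each further generator delays the start of the tails by at most `C`. This linear bound makes the
test in the algorithm finite. -/
theorem evalWord_rigid {n : ℕ} {ψ : Fin n → MulAut (FreeGroup (Fin r × ℕ))} {C : ℕ}
    {K : Fin n × Bool → Fin r → ℕ} {g : Fin n × Bool → Fin r → FreeGroup (Fin r × ℕ)}
    (h : ∀ a, IsRigid (evalLetter ψ a) 1 (fun _ => C) (K a) (g a)) (w : List (Fin n × Bool)) :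
    ∃ N k g, IsRigid (evalWord ψ w) 1 N k g ∧ ∀ i, N i ≤ C * w.length := by
  induction w with
  | nil => exact ⟨_, _, _, IsRigid.one, fun i => by simp⟩
  | cons a w ih =>
    obtain ⟨N, k, g', h', hN⟩ := ih
    refine ⟨_, _, _, (h a).mul h', fun i => ?_⟩
    have := hN i
    simp only [List.length_cons, mul_add, mul_one]
    omega

/-- The image words of the letters under the automorphism of a signed generator. -/
def imageTable {n : ℕ} (C : ℕ) (T : Fin n × Bool → Fin r → List (List ((Fin r × ℕ) × Bool)))
    (G G' : Fin n × Bool → Fin r → List ((Fin r × ℕ) × Bool)) (K : Fin n × Bool → Fin r → ℕ)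
    (a : Fin n × Bool) (j : Fin r × ℕ) : List ((Fin r × ℕ) × Bool) :=
  if j.2 < C then (T a j.1).getD j.2 []
  else G a j.1 ++ [((j.1, K a j.1 + (j.2 - C)), true)] ++ G' a j.1

theorem primrec_imageTable {n : ℕ} (C : ℕ)
    (T : Fin n × Bool → Fin r → List (List ((Fin r × ℕ) × Bool)))
    (G G' : Fin n × Bool → Fin r → List ((Fin r × ℕ) × Bool)) (K : Fin n × Bool → Fin r → ℕ) :
    Primrec₂ (imageTable C T G G' K) := by
  have hfin : ∀ {β : Type} [Primcodable β] (f : Fin n × Bool → Fin r → β),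
      Primrec fun p : (Fin n × Bool) × (Fin r × ℕ) => f p.1 p.2.1 := fun f =>
    (Primrec.dom_finite fun q : (Fin n × Bool) × Fin r => f q.1 q.2).comp
      (Primrec.pair Primrec.fst (Primrec.fst.comp Primrec.snd))
  have hm : Primrec fun p : (Fin n × Bool) × (Fin r × ℕ) => p.2.2 :=
    Primrec.snd.comp Primrec.snd
  refine Primrec.ite (Primrec.nat_lt.comp hm (Primrec.const C))
    ((Primrec.list_getD []).comp (hfin T) hm) ?_
  refine Primrec.list_append.comp (Primrec.list_append.comp (hfin G) ?_) (hfin G')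
  refine Primrec.list_cons.comp (Primrec.pair (Primrec.pair (Primrec.fst.comp Primrec.snd) ?_)
    (Primrec.const true)) (Primrec.const [])
  exact Primrec.nat_add.comp (hfin K) (Primrec.nat_sub.comp hm (Primrec.const C))

/-- A generator is finite data: the images of the letters below `C`, and for every ray a conjugator
and a translation. -/
theorem exists_imageTable {n : ℕ} {ψ : Fin n → MulAut (FreeGroup (Fin r × ℕ))} {C : ℕ}
    {K : Fin n × Bool → Fin r → ℕ} {g : Fin n × Bool → Fin r → FreeGroup (Fin r × ℕ)}
    (h : ∀ a, IsRigid (evalLetter ψ a) 1 (fun _ => C) (K a) (g a)) :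
    ∃ t : Fin n × Bool → Fin r × ℕ → List ((Fin r × ℕ) × Bool), Primrec₂ t ∧
      ∀ a j, FreeGroup.mk (t a j) = evalLetter ψ a (of j) := by
  refine ⟨_, primrec_imageTable C
    (fun a i => (List.range C).map fun m => (evalLetter ψ a (of (i, m))).toWord)
    (fun a i => (g a i).toWord) (fun a i => (g a i)⁻¹.toWord) K, fun a ⟨i, m⟩ => ?_⟩
  unfold imageTable
  by_cases hm : m < C
  · simpa [hm] using FreeGroup.mk_toWord
  · obtain ⟨m', rfl⟩ := Nat.exists_eq_add_of_le (not_lt.1 hm)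
    rw [if_neg (by simp), h a i m', ← FreeGroup.mul_mk, ← FreeGroup.mul_mk,
      FreeGroup.mk_toWord, FreeGroup.mk_toWord, Nat.add_sub_cancel_left]
    rfl

theorem mk_foldr_substitute {n : ℕ} {α : Type*} {ψ : Fin n → MulAut (FreeGroup α)}
    {t : Fin n × Bool → α → List (α × Bool)}
    (h : ∀ a j, FreeGroup.mk (t a j) = evalLetter ψ a (of j)) (w : List (Fin n × Bool)) (j : α) :
    FreeGroup.mk (w.foldr (fun a l => substitute (t a) l) [(j, true)]) = evalWord ψ w (of j) := by
  induction w with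
  | nil => rfl
  | cons a w ih =>
    rw [List.foldr_cons, mk_substitute (h a), ih]
    rfl

/-- The word problem for normalized rigid automorphisms. -/
theorem computablePred_evalWord {n : ℕ} {ψ : Fin n → MulAut (FreeGroup (Fin r × ℕ))}
    (hψ : ∀ k, ψ k ∈ normalizedRigid i₀) :
    ComputablePred fun w : List (Fin n × Bool) => evalWord ψ w = 1 := by
  obtain ⟨C, K, g, h⟩ := exists_uniform_rigid hψ
  obtain ⟨t, ht, htψ⟩ := exists_imageTable h
  let letters : ℕ → List (Fin r × ℕ) := fun b =>
    (List.finRange r).flatMap fun i => (List.range b).map fun m => (i, m)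
  have hmem : ∀ b j, j ∈ letters b ↔ j.2 < b := by
    rintro b ⟨i, m⟩
    simp [letters]
  have hletters : Primrec letters := by
    refine Primrec.list_flatMap (Primrec.const _) ?_
    refine Primrec.list_map (Primrec.list_range.comp Primrec.fst) ?_
    exact (Primrec.pair (Primrec.snd.comp Primrec.fst) Primrec.snd).to₂
  let R : Fin r × ℕ → List (Fin n × Bool) → Prop := fun j w =>
    FreeGroup.reduce (w.foldr (fun a l => substitute (t a) l) [(j, true)]) = [(j, true)]
  have hR : PrimrecRel R := by
    have h1 : Primrec fun p : (Fin r × ℕ) × List (Fin n × Bool) => [(p.1, true)] :=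
      Primrec.list_cons.comp (Primrec.pair Primrec.fst (Primrec.const true)) (Primrec.const [])
    have h2 : Primrec₂ fun (_ : (Fin r × ℕ) × List (Fin n × Bool))
        (q : (Fin n × Bool) × List ((Fin r × ℕ) × Bool)) => substitute (t q.1) q.2 :=
      ((primrec_substitute ht).comp (Primrec.fst.comp Primrec.snd)
        (Primrec.snd.comp Primrec.snd)).to₂
    have h3 : Primrec fun p : (Fin r × ℕ) × List (Fin n × Bool) =>
        p.2.foldr (fun a l => substitute (t a) l) [(p.1, true)] :=
      Primrec.list_foldr Primrec.snd h1 h2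
    exact Primrec.eq.comp (primrec_reduce.comp h3) h1
  have hRiff : ∀ j w, R j w ↔ evalWord ψ w (of j) = of j := by
    intro j w
    rw [← mk_foldr_substitute htψ]
    constructor
    · intro hj
      exact (FreeGroup.reduce.exact (hj.trans (by simp)))
    · intro hj
      exact (FreeGroup.reduce.sound hj).trans (by simp)
  -- The tails start at index at most `C * w.length`, and `IsRigid.eq_one_of_fixed` needs two
  -- letters on each of them, whence `+ 2`.
  have hp : PrimrecPred fun w : List (Fin n × Bool) => ∀ j ∈ letters (C * w.length + 2), R j w :=
    (PrimrecRel.forall_mem_list hR).comp (hletters.comp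
      (Primrec.succ.comp (Primrec.succ.comp
        (Primrec.nat_mul.comp (Primrec.const C) Primrec.list_length)))) Primrec.id
  have hp' : PrimrecPred fun w : List (Fin n × Bool) => evalWord ψ w = 1 := by
    refine hp.of_eq fun w => ⟨fun hw => ?_, fun hw j _ => (hRiff j w).2 (by rw [hw]; rfl)⟩
    obtain ⟨N, k, g', h', hN⟩ := evalWord_rigid h w
    refine h'.eq_one_of_fixed fun i m hm => (hRiff _ w).1 (hw _ ((hmem _ _).2 ?_))
    have := hN i
    change m < C * w.length + 2
    omega
  obtain ⟨hd, hp'⟩ := hp'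
  exact ⟨hd, hp'.to_comp⟩

end WordProblemInRigid

/-! ### Coordinates on the graph and gluing of maps -/

section Parametrization

variable {r : ℕ}

theorem single_eq_single {i i' : Fin r} {t t' : ℝ} (ht : t ≠ 0)
    (h : (Pi.single i t : Fin r → ℝ) = Pi.single i' t') : i = i' ∧ t = t' := by
  have h1 := congrFun h i
  by_cases hi : i = i'
  · subst hi
    simpa using h1
  · rw [Pi.single_eq_same, Pi.single_eq_of_ne hi] at h1
    exact absurd h1 ht

/-- The parametrization of the half-line `i`. -/
def ray (i : Fin r) (t : ℝ) : Gam r :=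
  ⟨(Pi.single i (max t 0), 0), Or.inl ⟨i, _, le_max_right _ _, rfl, rfl⟩⟩

/-- The parametrization of the circle `j` by `ℝ/ℤ`. -/
noncomputable def circ (j : Fin r × ℕ) (s : ℝ) : Gam r :=
  ⟨(Pi.single j.1 ((j.2 : ℝ) + 1), 1 - Complex.exp ((2 * Real.pi * s : ℝ) * Complex.I)),
    Or.inr ⟨j.1, j.2, rfl, by
      simp only [sub_sub_cancel_left, norm_neg]; exact Complex.norm_exp_ofReal_mul_I _⟩⟩

theorem continuous_ray (i : Fin r) : Continuous (ray i) := by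
  refine Continuous.subtype_mk (Continuous.prodMk ?_ continuous_const) _
  exact (continuous_single i).comp (by fun_prop)

theorem continuous_circ (j : Fin r × ℕ) : Continuous (circ j) := by
  refine Continuous.subtype_mk (Continuous.prodMk continuous_const ?_) _
  fun_prop

theorem ray_fst {i : Fin r} {t : ℝ} (ht : 0 ≤ t) : (ray i t).1.1 = Pi.single i t := by
  simp [ray, ht]

theorem ray_snd (i : Fin r) (t : ℝ) : (ray i t).1.2 = 0 := rfl

theorem circ_fst (j : Fin r × ℕ) (s : ℝ) : (circ j s).1.1 = Pi.single j.1 ((j.2 : ℝ) + 1) := rfl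

theorem circ_snd (j : Fin r × ℕ) (s : ℝ) :
    (circ j s).1.2 = 1 - Complex.exp ((2 * Real.pi * s : ℝ) * Complex.I) := rfl

theorem ray_zero (i i' : Fin r) : ray i 0 = ray i' 0 := by
  apply Subtype.ext
  simp [ray]

theorem exp_eq_one_iff_int (s : ℝ) :
    Complex.exp ((2 * Real.pi * s : ℝ) * Complex.I) = 1 ↔ ∃ n : ℤ, s = n := by
  rw [Complex.exp_eq_one_iff]
  refine exists_congr fun n => ?_
  constructor
  · intro h
    have h2 : ((s : ℂ) - n) * (2 * Real.pi * Complex.I) = 0 := by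
      push_cast at h
      linear_combination h
    have h3 := (mul_eq_zero.1 h2).resolve_right Complex.two_pi_I_ne_zero
    exact_mod_cast sub_eq_zero.1 h3
  · rintro rfl
    push_cast
    ring

theorem circ_int (j : Fin r × ℕ) (n : ℤ) : circ j n = ray j.1 (j.2 + 1) := by
  apply Subtype.ext
  refine Prod.ext ?_ ?_
  · rw [ray_fst (by positivity), circ_fst]
  · rw [circ_snd, ray_snd, (exp_eq_one_iff_int _).2 ⟨n, rfl⟩, sub_self]

theorem circ_zero (j : Fin r × ℕ) : circ j 0 = ray j.1 (j.2 + 1) := by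
  simpa using circ_int j 0

theorem circ_one (j : Fin r × ℕ) : circ j 1 = ray j.1 (j.2 + 1) := by
  simpa using circ_int j 1

theorem circ_add_int (j : Fin r × ℕ) (s : ℝ) (n : ℤ) : circ j (s + n) = circ j s := by
  apply Subtype.ext
  refine Prod.ext rfl ?_
  have : ((2 * Real.pi * (s + n) : ℝ) * Complex.I) =
      ((2 * Real.pi * s : ℝ) * Complex.I) + ((2 * Real.pi * (n : ℝ) : ℝ) * Complex.I) := by
    push_cast; ring
  rw [circ_snd, circ_snd, this, Complex.exp_add, (exp_eq_one_iff_int _).2 ⟨n, rfl⟩, mul_one]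

theorem circ_eq_circ {j j' : Fin r × ℕ} {s s' : ℝ} (h : circ j s = circ j' s') :
    j = j' ∧ ∃ n : ℤ, s = s' + n := by
  have h1 := congrArg (fun p : Gam r => p.1.1) h
  have h2 := congrArg (fun p : Gam r => p.1.2) h
  obtain ⟨h3, h4⟩ := single_eq_single (by positivity) h1
  refine ⟨Prod.ext h3 (by simpa using h4), ?_⟩
  simp only [circ_snd, sub_right_inj] at h2
  have h5 : Complex.exp ((2 * Real.pi * (s - s') : ℝ) * Complex.I) = 1 := by
    have : ((2 * Real.pi * (s - s') : ℝ) * Complex.I) =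
      ((2 * Real.pi * s : ℝ) * Complex.I) - ((2 * Real.pi * s' : ℝ) * Complex.I) := by
      push_cast; ring
    rw [this, Complex.exp_sub, h2, div_self (Complex.exp_ne_zero _)]
  obtain ⟨n, hn⟩ := (exp_eq_one_iff_int _).1 h5
  exact ⟨n, by linarith⟩

theorem circ_eq_ray {j : Fin r × ℕ} {s : ℝ} {i : Fin r} {t : ℝ} (ht : 0 ≤ t)
    (h : circ j s = ray i t) : i = j.1 ∧ t = j.2 + 1 ∧ ∃ n : ℤ, s = n := by
  have h1 := congrArg (fun p : Gam r => p.1.1) h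
  have h2 := congrArg (fun p : Gam r => p.1.2) h
  simp only [ray_fst ht] at h1
  obtain ⟨h3, h4⟩ := single_eq_single (by positivity) h1
  refine ⟨h3.symm, h4.symm, (exp_eq_one_iff_int _).1 ?_⟩
  simp only [circ_snd, ray_snd] at h2
  exact (sub_eq_zero.1 h2).symm

theorem ray_eq_ray {i i' : Fin r} {t t' : ℝ} (ht : 0 ≤ t) (ht' : 0 ≤ t')
    (h : ray i t = ray i' t') : t = t' ∧ (t = 0 ∨ i = i') := by
  have h1 := congrArg (fun p : Gam r => p.1.1) h
  simp only [ray_fst ht, ray_fst ht'] at h1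
  by_cases h0 : t = 0
  · subst h0
    by_cases h0' : t' = 0
    · exact ⟨h0'.symm, Or.inl rfl⟩
    · exact ⟨(single_eq_single h0' h1.symm).2.symm, Or.inl rfl⟩
  · exact ⟨(single_eq_single h0 h1).2, Or.inr (single_eq_single h0 h1).1⟩

theorem gam_cases (p : Gam r) :
    (∃ i t, 0 ≤ t ∧ p = ray i t) ∨ ∃ j, ∃ s ∈ Ico (0 : ℝ) 1, p = circ j s := by
  obtain ⟨⟨x, z⟩, ⟨i, t, ht, h1, h2⟩ | ⟨i, n, h1, h2⟩⟩ := p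
  · refine Or.inl ⟨i, t, ht, Subtype.ext (Prod.ext ?_ ?_)⟩
    · rw [ray_fst ht]; exact h1
    · exact h2
  · refine Or.inr ⟨(i, n), Int.fract ((1 - z).arg / (2 * Real.pi)),
      ⟨Int.fract_nonneg _, Int.fract_lt_one _⟩, ?_⟩
    have h3 : circ (i, n) (Int.fract ((1 - z).arg / (2 * Real.pi))) =
        circ (i, n) ((1 - z).arg / (2 * Real.pi)) := by
      conv_rhs => rw [← Int.fract_add_floor ((1 - z).arg / (2 * Real.pi)), circ_add_int]
    rw [h3]
    refine Subtype.ext (Prod.ext h1 ?_)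
    have h4 : ‖1 - z‖ = 1 := by rw [norm_sub_rev]; exact h2
    have h5 := Complex.norm_mul_exp_arg_mul_I (1 - z)
    rw [h4, Complex.ofReal_one, one_mul] at h5
    have h6 : 2 * Real.pi * ((1 - z).arg / (2 * Real.pi)) = (1 - z).arg := by
      field_simp
    rw [circ_snd, h6, h5]
    simp

/-- The distance to the core vertex along the half-lines. -/
def height (p : Gam r) : ℝ := ‖p.1.1‖

theorem continuous_height : Continuous (height (r := r)) := by unfold height; fun_prop

theorem height_ray {i : Fin r} {t : ℝ} (ht : 0 ≤ t) : height (ray i t) = t := by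
  rw [height, ray_fst ht, Pi.norm_single, Real.norm_of_nonneg ht]

theorem height_circ (j : Fin r × ℕ) (s : ℝ) : height (circ j s) = j.2 + 1 := by
  rw [height, circ_fst, Pi.norm_single, Real.norm_of_nonneg (by positivity)]

/-- The half-lines' unit segments and the circles. -/
noncomputable def edge : (Fin r × ℕ) ⊕ (Fin r × ℕ) → C(unitInterval, Gam r)
  | .inl j => ⟨fun s => ray j.1 (j.2 + s), (continuous_ray j.1).comp (by fun_prop)⟩
  | .inr j => ⟨fun s => circ j s, (continuous_circ j).comp (by fun_prop)⟩

theorem edge_inl (j : Fin r × ℕ) (s : unitInterval) : edge (.inl j) s = ray j.1 (j.2 + s) := rfl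

theorem edge_inr (j : Fin r × ℕ) (s : unitInterval) : edge (.inr j) s = circ j s := rfl

/-- The index of an edge without the type of the edge. -/
def edgeIndex : (Fin r × ℕ) ⊕ (Fin r × ℕ) → Fin r × ℕ := Sum.elim id id

theorem le_height_edge (k : (Fin r × ℕ) ⊕ (Fin r × ℕ)) (s : unitInterval) :
    ((edgeIndex k).2 : ℝ) ≤ height (edge k s) := by
  have := s.2.1
  rcases k with j | j
  · rw [edge_inl, height_ray (by positivity)]
    simp [edgeIndex, this]
  · rw [edge_inr, height_circ]
    simp [edgeIndex]

theorem height_edge_le (k : (Fin r × ℕ) ⊕ (Fin r × ℕ)) (s : unitInterval) :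
    height (edge k s) ≤ (edgeIndex k).2 + 1 := by
  have := s.2.1
  rcases k with j | j
  · rw [edge_inl, height_ray (by positivity)]
    simp [edgeIndex, s.2.2]
  · rw [edge_inr, height_circ]
    simp [edgeIndex]

theorem finite_edgeIndex_lt (M : ℕ) : {k : (Fin r × ℕ) ⊕ (Fin r × ℕ) | (edgeIndex k).2 < M}.Finite := by
  have h : {j : Fin r × ℕ | j.2 < M}.Finite :=
    (Set.finite_univ.prod (Set.finite_Iio M)).subset fun j hj => ⟨trivial, hj⟩
  refine ((h.image Sum.inl).union (h.image Sum.inr)).subset ?_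
  rintro (j | j) hj
  · exact Or.inl ⟨j, hj, rfl⟩
  · exact Or.inr ⟨j, hj, rfl⟩

theorem exists_edge (p : Gam r) : ∃ k s, edge k s = p := by
  rcases gam_cases p with ⟨i, t, ht, rfl⟩ | ⟨j, s, hs, rfl⟩
  · refine ⟨.inl (i, ⌊t⌋₊), ⟨t - ⌊t⌋₊, ?_⟩, ?_⟩
    · exact ⟨by linarith [Nat.floor_le ht], by linarith [Nat.lt_floor_add_one t]⟩
    · rw [edge_inl]; simp
  · exact ⟨.inr j, ⟨s, hs.1, hs.2.le⟩, rfl⟩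

/-- The map from the disjoint union of the edges. -/
noncomputable def edgeMap (r : ℕ) :
    C((Σ _ : (Fin r × ℕ) ⊕ (Fin r × ℕ), unitInterval), Gam r) :=
  ⟨fun x => edge x.1 x.2, continuous_sigma fun k => (edge k).continuous⟩

/-- Below any height there are finitely many edges, so the images of closed sets are locally finite
unions of compact sets. -/
theorem isQuotientMap_edgeMap : Topology.IsQuotientMap (edgeMap r) := by
  refine IsClosedMap.isQuotientMap (fun A hA => ?_) ?_ ?_
  · have : edgeMap r '' A = ⋃ k, edge k '' ((fun s => ⟨k, s⟩) ⁻¹' A) := by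
      ext p
      simp only [mem_image, mem_iUnion, mem_preimage, Sigma.exists]
      rfl
    rw [this]
    refine LocallyFinite.isClosed_iUnion (fun p => ?_) fun k => ?_
    · obtain ⟨M, hM⟩ := exists_nat_gt (height p)
      refine ⟨{q | height q < M}, (isOpen_lt continuous_height continuous_const).mem_nhds hM, ?_⟩
      refine (finite_edgeIndex_lt M).subset ?_
      rintro k ⟨_, ⟨s, -, rfl⟩, hs⟩
      exact_mod_cast (le_height_edge k s).trans_lt hs
    · exact ((hA.preimage continuous_sigmaMk).isCompact.image (edge k).continuous).isClosed
  · exact (edgeMap r).continuous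
  · intro p
    obtain ⟨k, s, h⟩ := exists_edge p
    exact ⟨⟨k, s⟩, h⟩

/-- Continuous maps from `Γ` are glued from compatible maps on the edges. -/
theorem exists_glue {Y : Type*} [TopologicalSpace Y] (v : Fin r → ℕ → Y)
    (e c : Fin r × ℕ → C(unitInterval, Y)) (hv : ∀ i i', v i 0 = v i' 0)
    (he0 : ∀ j, e j 0 = v j.1 j.2) (he1 : ∀ j, e j 1 = v j.1 (j.2 + 1))
    (hc0 : ∀ j, c j 0 = v j.1 (j.2 + 1)) (hc1 : ∀ j, c j 1 = v j.1 (j.2 + 1)) :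
    ∃ F : C(Gam r, Y), (∀ (j : Fin r × ℕ) (s : unitInterval), F (ray j.1 (j.2 + s)) = e j s) ∧
      ∀ (j : Fin r × ℕ) (s : unitInterval), F (circ j s) = c j s := by
  let G : C(Σ _ : (Fin r × ℕ) ⊕ (Fin r × ℕ), unitInterval, Y) :=
    ⟨fun x => Sum.elim e c x.1 x.2, continuous_sigma fun k => (Sum.elim e c k).continuous⟩
  have hint : ∀ (s : unitInterval) (n : ℤ), (s : ℝ) = n → s = 0 ∨ s = 1 := by
    intro s n h
    have h0 := s.2.1
    have h1 := s.2.2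
    rw [h] at h0 h1
    have h0' : 0 ≤ n := by exact_mod_cast h0
    have h1' : n ≤ 1 := by exact_mod_cast h1
    obtain rfl | rfl : n = 0 ∨ n = 1 := by omega
    · exact Or.inl (Subtype.ext (by simpa using h))
    · exact Or.inr (Subtype.ext (by simpa using h))
  have hseg : ∀ (j : Fin r × ℕ) (s : unitInterval) (n : ℕ), (j.2 : ℝ) + s = n →
      e j s = v j.1 n := by
    intro j s n h
    rcases hint s (n - j.2) (by push_cast; linarith) with rfl | rfl
    · have : j.2 = n := by simpa using h
      rw [he0, this]
    · have : j.2 + 1 = n := by exact_mod_cast (by simpa using h : (j.2 : ℝ) + 1 = n)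
      rw [he1, this]
  have hcirc : ∀ (j : Fin r × ℕ) (s : unitInterval) (n : ℤ), (s : ℝ) = n →
      c j s = v j.1 (j.2 + 1) := by
    intro j s n h
    rcases hint s n h with rfl | rfl
    · exact hc0 j
    · exact hc1 j
  have hmix : ∀ (j j' : Fin r × ℕ) (s s' : unitInterval),
      edge (.inr j) s = edge (.inl j') s' → c j s = e j' s' := by
    intro j j' s s' h
    rw [edge_inr, edge_inl] at h
    have := s'.2.1
    obtain ⟨h1, h2, n, h3⟩ := circ_eq_ray (by positivity) h
    rw [hcirc j s n h3, hseg j' s' (j.2 + 1) (by exact_mod_cast h2), h1]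
  have hG : Function.FactorsThrough G (edgeMap r) := by
    rintro ⟨j | j, s⟩ ⟨j' | j', s'⟩ h
    · change e j s = e j' s'
      replace h : ray j.1 (j.2 + s) = ray j'.1 (j'.2 + s') := h
      have hs := s.2.1
      have hs' := s'.2.1
      obtain ⟨h1, h2⟩ := ray_eq_ray (by positivity) (by positivity) h
      -- Different segments meet only at integer parameters, where both maps take the vertex value
      -- `v`; otherwise the floor of the parameter determines the segment.
      by_cases hn : ∃ n : ℕ, (j.2 : ℝ) + s = n
      · obtain ⟨n, hn⟩ := hn
        rw [hseg j s n hn, hseg j' s' n (by rw [← h1, hn])]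
        rcases h2 with h2 | h2
        · have : n = 0 := by rw [h2] at hn; exact_mod_cast hn.symm
          rw [this]
          exact hv _ _
        · rw [h2]
      · have h0 : ¬ (j.2 : ℝ) + s = 0 := fun h => hn ⟨0, by simpa using h⟩
        have h3 := h2.resolve_left h0
        have hlt : ∀ {j : Fin r × ℕ} {s : unitInterval}, (¬ ∃ n : ℕ, (j.2 : ℝ) + s = n) →
            ⌊(j.2 : ℝ) + s⌋₊ = j.2 := by
          intro j s hn
          have hs := s.2.1
          rw [Nat.floor_eq_iff (by positivity)]
          refine ⟨by linarith, ?_⟩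
          have : (s : ℝ) ≠ 1 := fun h => hn ⟨j.2 + 1, by rw [h]; push_cast; rfl⟩
          linarith [lt_of_le_of_ne s.2.2 this]
        have h4 : j.2 = j'.2 := by rw [← hlt hn, h1, hlt (by rwa [← h1])]
        obtain rfl : j = j' := Prod.ext h3 h4
        have : s = s' := Subtype.ext (by linarith)
        rw [this]
    · exact (hmix j' j s' s h.symm).symm
    · exact hmix j j' s s' h
    · change c j s = c j' s'
      replace h : circ j s = circ j' s' := h
      obtain ⟨rfl, n, hn⟩ := circ_eq_circ h
      have h1 : (n : ℝ) ≤ 1 := by linarith [s.2.2, s'.2.1]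
      have h2 : -1 ≤ (n : ℝ) := by linarith [s.2.1, s'.2.2]
      have h1' : n ≤ 1 := by exact_mod_cast h1
      have h2' : -1 ≤ n := by exact_mod_cast h2
      obtain rfl | rfl | rfl : n = 0 ∨ n = 1 ∨ n = -1 := by omega
      · have : s = s' := Subtype.ext (by simpa using hn)
        rw [this]
      · push_cast at hn
        rw [hcirc j s 1 (by push_cast; linarith [s.2.2, s'.2.1]),
          hcirc j s' 0 (by push_cast; linarith [s.2.2, s'.2.1])]
      · push_cast at hn
        rw [hcirc j s 0 (by push_cast; linarith [s.2.1, s'.2.2]),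
          hcirc j s' 1 (by push_cast; linarith [s.2.1, s'.2.2])]
  refine ⟨isQuotientMap_edgeMap.lift G hG, fun j s => ?_, fun j s => ?_⟩
  · exact DFunLike.congr_fun (isQuotientMap_edgeMap.lift_comp G hG) ⟨.inl j, s⟩
  · exact DFunLike.congr_fun (isQuotientMap_edgeMap.lift_comp G hG) ⟨.inr j, s⟩

end Parametrization

/-! ### Functors from the fundamental groupoid to a group -/

section PathHoms

open unitInterval Path.Homotopic

/-- A functor from the fundamental groupoid of `X` to the group `G`. -/
structure PathHom (X : Type*) [TopologicalSpace X] (G : Type*) [Group G] where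
  toFun : ∀ {x y : X}, Path x y → G
  map_homotopic : ∀ {x y : X} {p q : Path x y}, p.Homotopic q → toFun p = toFun q
  map_trans : ∀ {x y z : X} (p : Path x y) (q : Path y z), toFun (p.trans q) = toFun p * toFun q

namespace PathHom

variable {X Y : Type*} [TopologicalSpace X] [TopologicalSpace Y] {G : Type*} [Group G]
  (Φ : PathHom X G)

theorem map_refl (x : X) : Φ.toFun (Path.refl x) = 1 := by
  have h := Φ.map_trans (Path.refl x) (Path.refl x)
  rw [Path.refl_trans_refl] at h
  exact left_eq_mul.1 h

theorem map_symm {x y : X} (p : Path x y) : Φ.toFun p.symm = (Φ.toFun p)⁻¹ := by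
  rw [eq_inv_iff_mul_eq_one, ← Φ.map_trans, ← Φ.map_refl y]
  exact Φ.map_homotopic ⟨(Path.Homotopy.reflSymmTrans p).symm⟩

theorem congr {x y x' y' : X} {p : Path x y} {q : Path x' y'} (h : ∀ t, p t = q t) :
    Φ.toFun p = Φ.toFun q := by
  obtain rfl : x = x' := by simpa using h 0
  obtain rfl : y = y' := by simpa using h 1
  obtain rfl : p = q := Path.ext (funext h)
  rfl

theorem map_cast {x y x' y' : X} (p : Path x y) (hx : x' = x) (hy : y' = y) :
    Φ.toFun (p.cast hx hy) = Φ.toFun p := Φ.congr fun _ => rfl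

/-- The pull-back under a continuous map. -/
def comap (f : C(Y, X)) : PathHom Y G where
  toFun p := Φ.toFun (p.map f.continuous)
  map_homotopic h := Φ.map_homotopic (h.map f)
  map_trans p q := by rw [Path.map_trans, Φ.map_trans]

theorem comap_apply (f : C(Y, X)) {x y : Y} (p : Path x y) :
    (Φ.comap f).toFun p = Φ.toFun (p.map f.continuous) := rfl

/-- The value on the restriction to `[a, b]` of a continuous map. -/
noncomputable def arc {γ : ℝ → X} (hγ : Continuous γ) (a b : ℝ) : G :=
  Φ.toFun ((Path.segment a b).map hγ)

variable {γ : ℝ → X} (hγ : Continuous γ)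

/-- The line is simply connected, so this holds for any order of `a`, `b`, `c`, and backtracking
cancels. -/
theorem arc_mul (a b c : ℝ) : Φ.arc hγ a b * Φ.arc hγ b c = Φ.arc hγ a c := by
  rw [arc, arc, ← Φ.map_trans, ← Path.map_trans]
  exact Φ.map_homotopic ((SimplyConnectedSpace.paths_homotopic _ _).map ⟨γ, hγ⟩)

theorem arc_self (a : ℝ) : Φ.arc hγ a a = 1 := by
  have := Φ.arc_mul hγ a a a
  exact mul_eq_left.1 this

theorem arc_symm (a b : ℝ) : Φ.arc hγ b a = (Φ.arc hγ a b)⁻¹ := by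
  rw [eq_inv_iff_mul_eq_one, arc_mul, arc_self]

end PathHom

variable {X : Type*} [TopologicalSpace X]

/-- Two paths in a simply connected subset are homotopic. -/
theorem homotopic_of_mem {U : Set X} [SimplyConnectedSpace U] {x y : X} {p q : Path x y}
    (hp : ∀ t, p t ∈ U) (hq : ∀ t, q t ∈ U) : p.Homotopic q := by
  have hx : x ∈ U := by simpa using hp 0
  have hy : y ∈ U := by simpa using hp 1
  let p' : Path (⟨x, hx⟩ : U) ⟨y, hy⟩ :=
    { toFun := fun t => ⟨p t, hp t⟩, source' := by simp, target' := by simp }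
  let q' : Path (⟨x, hx⟩ : U) ⟨y, hy⟩ :=
    { toFun := fun t => ⟨q t, hq t⟩, source' := by simp, target' := by simp }
  exact (SimplyConnectedSpace.paths_homotopic p' q').map ⟨Subtype.val, continuous_subtype_val⟩

theorem segment_mem_uIcc (a b : ℝ) (t : I) : Path.segment a b t ∈ uIcc a b := by
  rw [← segment_eq_uIcc, ← Path.range_segment]
  exact mem_range_self t

/-- A property of paths which is invariant under homotopy and concatenation follows from the case of
small paths. -/
theorem path_induction {ι : Type*} {U : ι → Set X} (hU : ∀ i, IsOpen (U i))
    (hcov : ∀ x, ∃ i, x ∈ U i) {P : ∀ {x y : X}, Path x y → Prop}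
    (hhom : ∀ {x y : X} {p q : Path x y}, p.Homotopic q → P p → P q)
    (htrans : ∀ {x y z : X} {p : Path x y} {q : Path y z}, P p → P q → P (p.trans q))
    (hsmall : ∀ i {x y : X} (p : Path x y), (∀ t, p t ∈ U i) → P p) {x y : X} (p : Path x y) :
    P p := by
  -- By compactness, the path is cut into finitely many pieces that each stay in one `U i`.
  obtain ⟨t, ht0, hmono, ⟨n, hn⟩, hsub⟩ := exists_monotone_Icc_subset_open_cover_unitInterval
    (c := fun i => p ⁻¹' U i) (fun i => (hU i).preimage p.continuous)
    (fun s _ => mem_iUnion.2 (hcov (p s)))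
  have hP : ∀ k, P ((Path.segment (0 : ℝ) (t k)).map p.continuous_extend) := by
    intro k
    induction k with
    | zero =>
      obtain ⟨i, hi⟩ := hcov (p.extend 0)
      refine hsmall i _ fun s => ?_
      rw [ht0]
      simpa using hi
    | succ k ih =>
      have h1 : P ((Path.segment (t k : ℝ) (t (k + 1))).map p.continuous_extend) := by
        obtain ⟨i, hi⟩ := hsub k
        refine hsmall i _ fun s => ?_
        have h2 := segment_mem_uIcc (t k : ℝ) (t (k + 1)) s
        rw [uIcc_of_le (show (t k : ℝ) ≤ t (k + 1) from hmono (Nat.le_succ k))] at h2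
        have h3 : Path.segment (t k : ℝ) (t (k + 1)) s ∈ I :=
          ⟨(t k).2.1.trans h2.1, h2.2.trans (t (k + 1)).2.2⟩
        rw [Path.map_coe, Function.comp_apply, Path.extend_apply _ h3]
        exact hi (a := ⟨_, h3⟩) h2
      refine hhom ?_ (htrans ih h1)
      rw [← Path.map_trans]
      exact (SimplyConnectedSpace.paths_homotopic _ _).map p.extend
  have h1 := hP n
  rw [hn n le_rfl] at h1
  have hx : p.extend 0 = x := by simp
  have hy : p.extend 1 = y := by simp
  have key : ∀ {x' y' : X} (hx : x' = x) (hy : y' = y) (q : Path x' y'), (∀ s, q s = p s) → P q →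
      P p := by
    rintro x' y' rfl rfl q hq h
    rwa [← show q = p from Path.ext (funext hq)]
  exact key hx hy _ (fun s => by simp [AffineMap.lineMap_apply]) h1

/-- The functor to the fundamental group which is given by paths from the base point. -/
noncomputable def loopHom {x₀ : X} (τ : ∀ x, Path x₀ x) :
    PathHom X (FundamentalGroup X x₀)ᵐᵒᵖ where
  -- The opposite group appears because the product of the fundamental group composes loops in the
  -- reverse order.
  toFun {x y} p := MulOpposite.op (FundamentalGroup.fromPath
    ((Path.Homotopic.Quotient.mk (τ x)).trans ((Path.Homotopic.Quotient.mk p).trans (Path.Homotopic.Quotient.mk (τ y)).symm)))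
  map_homotopic h := by rw [Path.Homotopic.Quotient.eq.2 h]
  map_trans {x y z} p q := by
    rw [← MulOpposite.op_mul, FundamentalGroup.mul_def]
    congr 1
    have h : ((Path.Homotopic.Quotient.mk (τ y)).symm.trans ((Path.Homotopic.Quotient.mk (τ y)).trans
        ((Path.Homotopic.Quotient.mk q).trans (Path.Homotopic.Quotient.mk (τ z)).symm))) =
        (Path.Homotopic.Quotient.mk q).trans (Path.Homotopic.Quotient.mk (τ z)).symm := by
      rw [← Path.Homotopic.Quotient.trans_assoc, Path.Homotopic.Quotient.symm_trans, Path.Homotopic.Quotient.refl_trans]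
    rw [Path.Homotopic.Quotient.mk_trans]
    simp only [Path.Homotopic.Quotient.trans_assoc]
    rw [h]

theorem homotopic_of_loopHom_eq {x₀ : X} {τ : ∀ x, Path x₀ x} {x y : X} {p q : Path x y}
    (h : (loopHom τ).toFun p = (loopHom τ).toFun q) : p.Homotopic q := by
  have h1 : (Path.Homotopic.Quotient.mk (τ x)).trans ((Path.Homotopic.Quotient.mk p).trans (Path.Homotopic.Quotient.mk (τ y)).symm) =
      (Path.Homotopic.Quotient.mk (τ x)).trans ((Path.Homotopic.Quotient.mk q).trans (Path.Homotopic.Quotient.mk (τ y)).symm) :=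
    MulOpposite.op_injective h
  have h2 := congrArg (fun c => (Path.Homotopic.Quotient.mk (τ x)).symm.trans (c.trans (Path.Homotopic.Quotient.mk (τ y)))) h1
  simp only [Path.Homotopic.Quotient.trans_assoc, Path.Homotopic.Quotient.symm_trans, Path.Homotopic.Quotient.trans_refl] at h2
  simp only [← Path.Homotopic.Quotient.trans_assoc, Path.Homotopic.Quotient.symm_trans, Path.Homotopic.Quotient.refl_trans] at h2
  exact Path.Homotopic.Quotient.eq.1 h2

end PathHoms

/-! ### Two kinds of contractible open sets that cover the graph -/

section Charts

open unitInterval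

variable {r : ℕ}

/-- The complement of the points opposite to the half-lines on the circles. -/
def plainSet (r : ℕ) : Set (Gam r) := {p | p.1.2 ≠ 2}

/-- The circle `j` without the point on the half-line. -/
def arcSet (j : Fin r × ℕ) : Set (Gam r) := {p | p.1.2 ≠ 0 ∧ |p.1.1 j.1 - (j.2 + 1)| < 1 / 2}

theorem isOpen_plainSet : IsOpen (plainSet r) :=
  isOpen_ne_fun (f := fun p : Gam r => p.1.2) (by fun_prop) continuous_const

theorem isOpen_arcSet (j : Fin r × ℕ) : IsOpen (arcSet j) :=
  (isOpen_ne_fun (f := fun p : Gam r => p.1.2) (by fun_prop) continuous_const).inter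
    (isOpen_lt (f := fun p : Gam r => |p.1.1 j.1 - (j.2 + 1)|) (by fun_prop) continuous_const)

theorem ray_mem_plainSet (i : Fin r) (t : ℝ) : ray i t ∈ plainSet r := by
  change (0 : ℂ) ≠ 2
  norm_num

theorem exp_add_half (s : ℝ) : Complex.exp ((2 * Real.pi * (s + 1 / 2) : ℝ) * Complex.I) =
    - Complex.exp ((2 * Real.pi * s : ℝ) * Complex.I) := by
  have : ((2 * Real.pi * (s + 1 / 2) : ℝ) * Complex.I) =
      ((2 * Real.pi * s : ℝ) * Complex.I) + Real.pi * Complex.I := by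
    push_cast; ring
  rw [this, Complex.exp_add, Complex.exp_pi_mul_I, mul_neg_one]

theorem circ_snd_eq_two_iff (j : Fin r × ℕ) (s : ℝ) :
    (circ j s).1.2 = 2 ↔ ∃ n : ℤ, s + 1 / 2 = n := by
  rw [← exp_eq_one_iff_int, exp_add_half, circ_snd]
  constructor
  · intro h
    linear_combination h
  · intro h
    linear_combination h

theorem circ_snd_eq_zero_iff (j : Fin r × ℕ) (s : ℝ) : (circ j s).1.2 = 0 ↔ ∃ n : ℤ, s = n := by
  rw [← exp_eq_one_iff_int, circ_snd, sub_eq_zero, eq_comm]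

theorem not_int_of_mem_Ioo {s : ℝ} {n : ℤ} (h : s ∈ Ioo (n : ℝ) (n + 1)) : ¬ ∃ m : ℤ, s = m := by
  rintro ⟨m, rfl⟩
  have h1 : n < m := by exact_mod_cast h.1
  have h2 : m < n + 1 := by exact_mod_cast h.2
  omega

theorem circ_mem_plainSet (j : Fin r × ℕ) {s : ℝ} (h : s ∈ Ioo (-1 / 2 : ℝ) (1 / 2)) :
    circ j s ∈ plainSet r := fun h0 =>
  not_int_of_mem_Ioo (n := 0) ⟨by push_cast; linarith [h.1], by push_cast; linarith [h.2]⟩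
    ((circ_snd_eq_two_iff j s).1 h0)

theorem circ_mem_plainSet' (j : Fin r × ℕ) {s : ℝ} (h : s ∈ Ioo (1 / 2 : ℝ) (3 / 2)) :
    circ j s ∈ plainSet r := fun h0 =>
  not_int_of_mem_Ioo (n := 1) ⟨by push_cast; linarith [h.1], by push_cast; linarith [h.2]⟩
    ((circ_snd_eq_two_iff j s).1 h0)

theorem circ_mem_arcSet (j : Fin r × ℕ) {s : ℝ} (h : s ∈ Ioo (0 : ℝ) 1) : circ j s ∈ arcSet j := by
  refine ⟨fun h0 => not_int_of_mem_Ioo (n := 0) ?_ ((circ_snd_eq_zero_iff j s).1 h0), ?_⟩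
  · simpa using h
  · simp [circ_fst]

theorem exists_eq_circ_of_mem_arcSet {j : Fin r × ℕ} {p : Gam r} (hp : p ∈ arcSet j) :
    ∃ s ∈ Ioo (0 : ℝ) 1, p = circ j s := by
  obtain ⟨h0, h1⟩ := hp
  rcases gam_cases p with ⟨i, t, -, rfl⟩ | ⟨j', s, hs, rfl⟩
  · exact absurd (ray_snd i t) h0
  · have hj : j' = j := by
      by_cases hi : j'.1 = j.1
      · rw [circ_fst, hi, Pi.single_eq_same, abs_lt] at h1
        refine Prod.ext hi ?_
        have h2 : (j'.2 : ℝ) < j.2 + 1 := by linarith [h1.2]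
        have h3 : (j.2 : ℝ) < j'.2 + 1 := by linarith [h1.1]
        have h2' : j'.2 < j.2 + 1 := by exact_mod_cast h2
        have h3' : j.2 < j'.2 + 1 := by exact_mod_cast h3
        omega
      · rw [circ_fst, Pi.single_eq_of_ne (Ne.symm hi), abs_lt] at h1
        have : (0 : ℝ) ≤ j.2 := by positivity
        linarith [h1.1]
    subst hj
    refine ⟨s, ⟨lt_of_le_of_ne hs.1 fun h => ?_, hs.2⟩, rfl⟩
    exact h0 ((circ_snd_eq_zero_iff _ _).2 ⟨0, by simpa using h.symm⟩)

theorem eq_of_mem_arcSet {j k : Fin r × ℕ} {p : Gam r} (hj : p ∈ arcSet j) (hk : p ∈ arcSet k) :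
    j = k := by
  obtain ⟨s, -, rfl⟩ := exists_eq_circ_of_mem_arcSet hj
  obtain ⟨s', -, h⟩ := exists_eq_circ_of_mem_arcSet hk
  exact (circ_eq_circ h).1

theorem exists_eq_circ_half {p : Gam r} (hp : p ∉ plainSet r) : ∃ j, p = circ j (1 / 2) := by
  have hp : p.1.2 = 2 := not_not.1 hp
  rcases gam_cases p with ⟨i, t, -, rfl⟩ | ⟨j, s, hs, rfl⟩
  · exact absurd hp (ray_mem_plainSet i t)
  · obtain ⟨n, hn⟩ := (circ_snd_eq_two_iff j s).1 hp
    have h1 : (0 : ℝ) < n := by linarith [hs.1]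
    have h2 : (n : ℝ) < 2 := by linarith [hs.2]
    have h1' : 0 < n := by exact_mod_cast h1
    have h2' : n < 2 := by exact_mod_cast h2
    obtain rfl : n = 1 := by omega
    exact ⟨j, by congr 1; push_cast at hn; linarith⟩

theorem arg_exp_of_mem {θ : ℝ} (h : θ ∈ Ioo (-Real.pi) Real.pi) :
    (Complex.exp (θ * Complex.I)).arg = θ := by
  rw [Complex.arg_exp_mul_I, toIocMod_eq_self]
  exact ⟨h.1, by linarith [h.2, Real.pi_pos]⟩

/-- The coordinate on the circles which is continuous away from the half-lines. -/
noncomputable def farCoord (p : Gam r) : ℝ := (p.1.2 - 1).arg / (2 * Real.pi) + 1 / 2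

theorem circ_snd_sub_one (j : Fin r × ℕ) (s : ℝ) : (circ j s).1.2 - 1 =
    Complex.exp ((2 * Real.pi * (s - 1 / 2) : ℝ) * Complex.I) := by
  have := exp_add_half (s - 1 / 2)
  rw [sub_add_cancel] at this
  rw [circ_snd, this]
  ring

theorem farCoord_circ (j : Fin r × ℕ) {s : ℝ} (h : s ∈ Ioo (0 : ℝ) 1) :
    farCoord (circ j s) = s := by
  have hpi := Real.pi_pos
  rw [farCoord, circ_snd_sub_one, arg_exp_of_mem ⟨by nlinarith [h.1], by nlinarith [h.2]⟩]
  field_simp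
  ring

theorem mem_slitPlane_of_norm {z : ℂ} (h : ‖z‖ = 1) (h1 : z ≠ -1) : z ∈ Complex.slitPlane := by
  rw [Complex.mem_slitPlane_iff_not_le_zero]
  intro hle
  apply h1
  obtain ⟨h2, h3⟩ := Complex.le_def.1 hle
  have h5 : z = (z.re : ℂ) := Complex.ext rfl (by simpa using h3)
  rw [h5, Complex.norm_real, Real.norm_eq_abs, abs_of_nonpos (by simpa using h2)] at h
  rw [h5]
  have : z.re = -1 := by linarith
  rw [this]
  simp

theorem continuousOn_farCoord (j : Fin r × ℕ) : ContinuousOn farCoord (arcSet j) := by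
  intro p hp
  refine ContinuousAt.continuousWithinAt ?_
  refine ContinuousAt.add (ContinuousAt.div_const ?_ _) continuousAt_const
  refine ContinuousAt.comp (f := fun p : Gam r => p.1.2 - 1) (Complex.continuousAt_arg ?_)
    (by fun_prop)
  obtain ⟨s, hs, rfl⟩ := exists_eq_circ_of_mem_arcSet hp
  refine mem_slitPlane_of_norm ?_ fun h => hp.1 (by linear_combination h)
  rw [circ_snd_sub_one]
  exact Complex.norm_exp_ofReal_mul_I _

/-- The coordinate `farCoord` identifies the set with an open interval, which is contracted linearly
to `1 / 2`. -/
instance contractibleSpace_arcSet (j : Fin r × ℕ) : ContractibleSpace (arcSet j) := by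
  rw [contractible_iff_id_nullhomotopic]
  have hmem : ∀ q : I × arcSet j,
      (1 - (q.1 : ℝ)) * farCoord q.2.1 + q.1 * (1 / 2) ∈ Ioo (0 : ℝ) 1 := by
    rintro ⟨t, p, hp⟩
    obtain ⟨s, hs, rfl⟩ := exists_eq_circ_of_mem_arcSet hp
    simp only [farCoord_circ j hs]
    have h0 := t.2.1
    have h1 := t.2.2
    constructor <;> nlinarith [hs.1, hs.2]
  refine ⟨⟨circ j (1 / 2), circ_mem_arcSet j (by norm_num)⟩, ⟨{
    toFun := fun q => ⟨_, circ_mem_arcSet j (hmem q)⟩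
    continuous_toFun := ?_
    map_zero_left := ?_
    map_one_left := ?_ }⟩⟩
  · refine Continuous.subtype_mk ((continuous_circ j).comp ?_) _
    have : Continuous fun q : I × arcSet j => farCoord q.2.1 :=
      (continuousOn_iff_continuous_domRestrict.1 (continuousOn_farCoord j)).comp continuous_snd
    fun_prop
  · rintro ⟨p, hp⟩
    obtain ⟨s, hs, rfl⟩ := exists_eq_circ_of_mem_arcSet hp
    simp [farCoord_circ j hs]
  · rintro ⟨p, hp⟩
    simp

/-- The coordinate on the circles which is continuous near the half-lines. -/
noncomputable def nearCoord (p : Gam r) : ℝ := (1 - p.1.2).arg / (2 * Real.pi)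

theorem norm_one_sub (p : Gam r) : ‖1 - p.1.2‖ = 1 := by
  obtain ⟨⟨x, z⟩, ⟨i, t, ht, h1, h2⟩ | ⟨i, n, h1, h2⟩⟩ := p
  · change z = 0 at h2
    subst h2
    simp
  · rw [norm_sub_rev]
    exact h2

theorem exp_nearCoord (p : Gam r) :
    1 - Complex.exp ((2 * Real.pi * nearCoord p : ℝ) * Complex.I) = p.1.2 := by
  have h5 := Complex.norm_mul_exp_arg_mul_I (1 - p.1.2)
  rw [norm_one_sub, Complex.ofReal_one, one_mul] at h5
  have h6 : 2 * Real.pi * nearCoord p = (1 - p.1.2).arg := by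
    rw [nearCoord]
    field_simp
  rw [h6, h5]
  ring

theorem nearCoord_mem {p : Gam r} (hp : p ∈ plainSet r) :
    nearCoord p ∈ Ioo (-1 / 2 : ℝ) (1 / 2) := by
  have hpi := Real.pi_pos
  have h1 := Complex.neg_pi_lt_arg (1 - p.1.2)
  have h2 : (1 - p.1.2).arg < Real.pi := by
    refine lt_of_le_of_ne (Complex.arg_le_pi _) fun h => hp ?_
    have h3 := exp_nearCoord p
    rw [nearCoord, h] at h3
    have h4 : 2 * Real.pi * (Real.pi / (2 * Real.pi)) = Real.pi := by field_simp
    rw [h4, Complex.exp_pi_mul_I] at h3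
    rw [← h3]
    norm_num
  rw [nearCoord]
  constructor
  · rw [lt_div_iff₀ (by positivity)]; linarith
  · rw [div_lt_iff₀ (by positivity)]; linarith

theorem continuousOn_nearCoord : ContinuousOn nearCoord (plainSet r) := by
  intro p hp
  refine ContinuousAt.continuousWithinAt ?_
  refine ContinuousAt.div_const ?_ _
  refine ContinuousAt.comp (f := fun p : Gam r => 1 - p.1.2) (Complex.continuousAt_arg ?_)
    (by fun_prop)
  refine mem_slitPlane_of_norm (norm_one_sub p) fun h => hp (by linear_combination -h)

/-- Slide along the circles towards the half-lines. -/
noncomputable def slide (a : ℝ) (p : Gam r) : Gam r :=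
  ⟨(p.1.1, 1 - Complex.exp ((2 * Real.pi * (a * nearCoord p) : ℝ) * Complex.I)), by
    obtain ⟨⟨x, z⟩, ⟨i, t, ht, h1, h2⟩ | ⟨i, n, h1, h2⟩⟩ := p
    · refine Or.inl ⟨i, t, ht, h1, ?_⟩
      change z = 0 at h2
      subst h2
      simp [nearCoord]
    · refine Or.inr ⟨i, n, h1, ?_⟩
      simp only [sub_sub_cancel_left, norm_neg]
      exact Complex.norm_exp_ofReal_mul_I _⟩

/-- Scale the half-lines. -/
noncomputable def shrink (a : I) (p : Gam r) : Gam r :=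
  ⟨((a : ℝ) • p.1.1, 0), by
    have ha := a.2.1
    obtain ⟨⟨x, z⟩, ⟨i, t, ht, h1, h2⟩ | ⟨i, n, h1, h2⟩⟩ := p
    · refine Or.inl ⟨i, a * t, by positivity, ?_, rfl⟩
      change x = _ at h1
      simp [h1, ← Pi.single_smul']
    · refine Or.inl ⟨i, a * (n + 1), by positivity, ?_, rfl⟩
      change x = _ at h1
      simp [h1, ← Pi.single_smul']⟩

theorem slide_mem {a : ℝ} (ha : a ∈ I) {p : Gam r} (hp : p ∈ plainSet r) :
    slide a p ∈ plainSet r := by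
  intro h
  have h1 := nearCoord_mem hp
  have h2 : a * nearCoord p ∈ Ioo (-1 / 2 : ℝ) (1 / 2) := by
    constructor <;> nlinarith [h1.1, h1.2, ha.1, ha.2]
  refine not_int_of_mem_Ioo (n := 0) (s := a * nearCoord p + 1 / 2)
    ⟨by push_cast; linarith [h2.1], by push_cast; linarith [h2.2]⟩ ?_
  rw [← exp_eq_one_iff_int, exp_add_half]
  change 1 - Complex.exp _ = 2 at h
  linear_combination h

theorem shrink_mem (a : I) (p : Gam r) : shrink a p ∈ plainSet r := by
  change (0 : ℂ) ≠ 2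
  norm_num

/-- The cut circles are slid onto the half-lines, and these are then scaled down to the core vertex.
-/
theorem contractibleSpace_plainSet (i₀ : Fin r) : ContractibleSpace (plainSet r) := by
  rw [contractible_iff_id_nullhomotopic]
  have hc : Continuous fun p : plainSet r => nearCoord p.1 :=
    continuousOn_iff_continuous_domRestrict.1 continuousOn_nearCoord
  let b : plainSet r := ⟨ray i₀ 0, ray_mem_plainSet i₀ 0⟩
  let S : C(plainSet r, plainSet r) := ⟨fun p => ⟨shrink 1 p.1, shrink_mem 1 p.1⟩, by
    refine Continuous.subtype_mk (Continuous.subtype_mk (Continuous.prodMk ?_ continuous_const) _) _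
    fun_prop⟩
  have h1 : (ContinuousMap.id (plainSet r)).Homotopic S := ⟨{
    toFun := fun q => ⟨slide (1 - q.1) q.2.1, slide_mem (unitInterval.symm q.1).2 q.2.2⟩
    continuous_toFun := by
      refine Continuous.subtype_mk (Continuous.subtype_mk (Continuous.prodMk (by fun_prop) ?_) _) _
      have : Continuous fun q : I × plainSet r => nearCoord q.2.1 := hc.comp continuous_snd
      fun_prop
    map_zero_left := fun p => by
      refine Subtype.ext (Subtype.ext (Prod.ext rfl ?_))
      simpa [slide] using exp_nearCoord p.1
    map_one_left := fun p => by
      refine Subtype.ext (Subtype.ext (Prod.ext ?_ ?_))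
      · simp [slide, S, shrink]
      · simp [slide, S, shrink] }⟩
  have h2 : S.Homotopic (ContinuousMap.const _ b) := ⟨{
    toFun := fun q => ⟨shrink (unitInterval.symm q.1) q.2.1, shrink_mem _ _⟩
    continuous_toFun := by
      refine Continuous.subtype_mk (Continuous.subtype_mk (Continuous.prodMk ?_ continuous_const) _) _
      fun_prop
    map_zero_left := fun p => by simp only [unitInterval.symm_zero]; rfl
    map_one_left := fun p => by
      refine Subtype.ext (Subtype.ext (Prod.ext ?_ ?_))
      · simp [b, shrink, ray]
      · simp [b, shrink, ray] }⟩
  exact ⟨b, h1.trans h2⟩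

end Charts

/-! ### The universal cover and the word of a path -/

section Covering

open unitInterval
open FreeGroup (of lift lift_apply_of)

variable {r : ℕ}

/-- The fibre of the universal cover, a discrete copy of the free group. -/
def Sheet (r : ℕ) : Type := FreeGroup (Fin r × ℕ)

instance : Group (Sheet r) := inferInstanceAs (Group (FreeGroup (Fin r × ℕ)))

instance : TopologicalSpace (Sheet r) := ⊥

instance : DiscreteTopology (Sheet r) := ⟨rfl⟩

/-- The domains of the charts. -/
def chart : Option (Fin r × ℕ) → Set (Gam r)
  | none => plainSet r
  | some j => arcSet j

theorem isOpen_chart : ∀ k : Option (Fin r × ℕ), IsOpen (chart k)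
  | none => isOpen_plainSet
  | some j => isOpen_arcSet j

open Classical in
/-- The transition functions, relative to a reference trivialization that is discontinuous at the
half-lines. -/
noncomputable def transition : Option (Fin r × ℕ) → Gam r → Sheet r
  | none, _ => 1
  | some j, p => if p.1.2.im < 0 then (of j : FreeGroup (Fin r × ℕ))⁻¹ else (1 : FreeGroup (Fin r × ℕ))

theorem transition_of_neg {j : Fin r × ℕ} {p : Gam r} (h : p.1.2.im < 0) :
    transition (some j) p = (of j : FreeGroup (Fin r × ℕ))⁻¹ := if_pos h

theorem transition_of_nonneg {j : Fin r × ℕ} {p : Gam r} (h : ¬ p.1.2.im < 0) :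
    transition (some j) p = (1 : FreeGroup (Fin r × ℕ)) := if_neg h

theorem continuousOn_transition {k l : Option (Fin r × ℕ)} (hkl : k ≠ l) :
    ContinuousOn (transition k) (chart k ∩ chart l) := by
  rcases k with _ | j
  · exact continuousOn_const
  rintro p ⟨hp, hp'⟩
  -- The real points of a circle are `0` and `2`, each missing from one of the two charts. Their
  -- overlap is thus two open half circles, with a constant transition on each.
  have hne : p.1.2.im ≠ 0 := by
    rcases l with _ | j'
    · intro him
      obtain ⟨s, hs, rfl⟩ := exists_eq_circ_of_mem_arcSet hp
      have h1 : ‖(circ j s).1.2 - 1‖ = 1 := by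
        rw [circ_snd_sub_one]; exact Complex.norm_exp_ofReal_mul_I _
      set z := (circ j s).1.2 with hz
      have hzr : z = (z.re : ℂ) := Complex.ext rfl (by simpa using him)
      rw [hzr, ← Complex.ofReal_one, ← Complex.ofReal_sub, Complex.norm_real, Real.norm_eq_abs] at h1
      rcases (abs_eq zero_le_one).1 h1 with h2 | h2
      · have h3 : z.re = 2 := by linarith
        exact hp' (show z = 2 by rw [hzr, h3]; norm_num)
      · have h3 : z.re = 0 := by linarith
        exact hp.1 (show z = 0 by rw [hzr, h3]; norm_num)
    · exact absurd (congrArg some (eq_of_mem_arcSet hp hp')) hkl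
  refine ContinuousAt.continuousWithinAt ?_
  have hc : Continuous fun q : Gam r => q.1.2.im := by fun_prop
  rcases lt_or_gt_of_ne hne with h | h
  · refine (continuousAt_const (y := transition (some j) p)).congr ?_
    filter_upwards [(isOpen_lt hc continuous_const).mem_nhds h] with q hq
    rw [transition_of_neg h, transition_of_neg hq]
  · refine (continuousAt_const (y := transition (some j) p)).congr ?_
    filter_upwards [(isOpen_lt continuous_const hc).mem_nhds h] with q hq
    rw [transition_of_nonneg (not_lt.2 (le_of_lt h)), transition_of_nonneg (not_lt.2 (le_of_lt hq))]

theorem exists_mem_chart (p : Gam r) : ∃ k, p ∈ chart k ∧ transition k p = 1 := by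
  by_cases h : p ∈ plainSet r
  · exact ⟨none, h, rfl⟩
  · obtain ⟨j, rfl⟩ := exists_eq_circ_half h
    refine ⟨some j, circ_mem_arcSet j (by norm_num), transition_of_nonneg ?_⟩
    have : (circ j (1 / 2)).1.2 = 2 := not_not.1 h
    rw [this]
    norm_num

/-- The universal cover of `Γ`. -/
noncomputable def coverCore (r : ℕ) : FiberBundleCore (Option (Fin r × ℕ)) (Gam r) (Sheet r) where
  baseSet := chart
  isOpen_baseSet := isOpen_chart
  indexAt p := (exists_mem_chart p).choose
  mem_baseSet_at p := (exists_mem_chart p).choose_spec.1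
  -- The changes are right multiplications, so that left multiplications act on the cover as deck
  -- transformations.
  coordChange k l p v := v * transition k p * (transition l p)⁻¹
  coordChange_self k p _ v := mul_inv_cancel_right _ _
  continuousOn_coordChange k l := by
    by_cases hkl : k = l
    · subst hkl
      simp only [mul_inv_cancel_right]
      exact continuousOn_snd
    · have h1 := continuousOn_transition hkl
      have h2 := continuousOn_transition (Ne.symm hkl)
      rw [inter_comm] at h2
      have h3 : Continuous fun q : Sheet r × Sheet r × Sheet r => q.1 * q.2.1 * q.2.2⁻¹ :=
        continuous_of_discreteTopology
      have h4 : MapsTo (Prod.fst : Gam r × Sheet r → Gam r) ((chart k ∩ chart l) ×ˢ univ)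
        (chart k ∩ chart l) := fun q hq => hq.1
      exact h3.comp_continuousOn (continuousOn_snd.prodMk
        ((h1.comp continuousOn_fst h4).prodMk (h2.comp continuousOn_fst h4)))
  coordChange_comp k l m p _ v := by group

theorem transition_indexAt (p : Gam r) : transition ((coverCore r).indexAt p) p = 1 :=
  (exists_mem_chart p).choose_spec.2

theorem isCoveringMap_cover (r : ℕ) : IsCoveringMap (coverCore r).proj :=
  FiberBundle.isCoveringMap (F := Sheet r) (E := (coverCore r).Fiber)

/-- The sheet at which the lift of a path that starts at the sheet `v` ends. -/
noncomputable def sheetEnd {x y : Gam r} (p : Path x y) (v : Sheet r) : Sheet r :=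
  ((isCoveringMap_cover r).monodromy (.mk p) ⟨⟨x, v⟩, rfl⟩).1.snd

theorem eq_mk_snd {y : Gam r} (e : (coverCore r).proj ⁻¹' {y}) : e = ⟨⟨y, e.1.snd⟩, rfl⟩ := by
  obtain ⟨⟨y', w⟩, rfl⟩ := e
  rfl

theorem sheetEnd_trans {x y z : Gam r} (p : Path x y) (q : Path y z) (v : Sheet r) :
    sheetEnd (p.trans q) v = sheetEnd q (sheetEnd p v) := by
  unfold sheetEnd
  rw [Path.Homotopic.Quotient.mk_trans, IsCoveringMap.monodromy_trans_apply]
  conv_lhs => rw [eq_mk_snd ((isCoveringMap_cover r).monodromy (.mk p) ⟨⟨x, v⟩, rfl⟩)]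

theorem sheetEnd_homotopic {x y : Gam r} {p q : Path x y} (h : p.Homotopic q) (v : Sheet r) :
    sheetEnd p v = sheetEnd q v := by
  unfold sheetEnd
  rw [Path.Homotopic.Quotient.eq.2 h]

/-- Inside one chart the lift is constant in the trivialization of that chart. Fibre coordinates
refer to the chart chosen at each point, whose transition is `1` there, so only the transitions of
`k` at the two ends appear. -/
theorem sheetEnd_of_mem {k : Option (Fin r × ℕ)} {x y : Gam r} {p : Path x y}
    (hp : ∀ t, p t ∈ chart k) (v : Sheet r) :
    sheetEnd p v = v * (transition k x)⁻¹ * transition k y := by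
  let w : Sheet r := v * (transition k x)⁻¹
  let lft : I → (coverCore r).TotalSpace := fun t =>
    ((coverCore r).localTriv k).toOpenPartialHomeomorph.symm (p t, w)
  have hval : ∀ t, lft t = ⟨p t, w * transition k (p t)⟩ := fun t => by
    have := (coverCore r).localTriv_symm_apply k (p t, w)
    refine this.trans ?_
    congr 1
    change w * transition k (p t) * (transition ((coverCore r).indexAt (p t)) (p t))⁻¹ = _
    rw [transition_indexAt, inv_one, mul_one]
  have hcont : Continuous lft := by
    refine ((coverCore r).localTriv k).toOpenPartialHomeomorph.continuousOn_symm.comp_continuous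
      (by fun_prop) fun t => ?_
    exact ((coverCore r).mem_localTriv_target k (p t, w)).2 (hp t)
  have h0 : (⟨x, v⟩ : (coverCore r).TotalSpace) = lft 0 := by
    rw [hval, p.source]
    simp [w]
  have hlift := ((isCoveringMap_cover r).eq_liftPath_iff (γ := p.toContinuousMap)
    (e := ⟨x, v⟩) (γ_0 := p.source) (Γ := lft)).2 ⟨hcont, by
      funext t
      simp [hval], h0.symm⟩
  change ((isCoveringMap_cover r).liftPath p.toContinuousMap ⟨x, v⟩ p.source 1).snd = _
  rw [← hlift, hval, p.target]

/-- This equivariance under deck transformations makes the word multiplicative; it is visible on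
paths inside a chart. -/
theorem sheetEnd_mul {x y : Gam r} (p : Path x y) (g v : Sheet r) :
    sheetEnd p (g * v) = g * sheetEnd p v := by
  revert g v
  refine path_induction (P := fun {x y} p => ∀ g v, sheetEnd p (g * v) = g * sheetEnd p v)
    isOpen_chart (fun x => (exists_mem_chart x).imp fun k h => h.1) ?_ ?_ ?_ p
  · intro x y p q h hp g v
    rw [← sheetEnd_homotopic h, ← sheetEnd_homotopic h, hp]
  · intro x y z p q hp hq g v
    rw [sheetEnd_trans, sheetEnd_trans, hp, hq]
  · intro k x y p hp g v
    rw [sheetEnd_of_mem hp, sheetEnd_of_mem hp]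
    simp only [mul_assoc]

/-- The word of a path: the signed sequence of the circles around which it runs. -/
noncomputable def word (r : ℕ) : PathHom (Gam r) (FreeGroup (Fin r × ℕ)) where
  toFun p := sheetEnd p (1 : Sheet r)
  map_homotopic h := sheetEnd_homotopic h 1
  map_trans p q := by
    rw [sheetEnd_trans]
    conv_lhs => rw [← mul_one (sheetEnd p 1), sheetEnd_mul]
    rfl

theorem word_of_mem {k : Option (Fin r × ℕ)} {x y : Gam r} {p : Path x y}
    (hp : ∀ t, p t ∈ chart k) : (word r).toFun p = (transition k x)⁻¹ * transition k y := by
  refine (sheetEnd_of_mem hp 1).trans ?_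
  rw [one_mul]

theorem word_of_mem_plainSet {x y : Gam r} {p : Path x y} (hp : ∀ t, p t ∈ plainSet r) :
    (word r).toFun p = 1 := by
  rw [word_of_mem (k := none) hp]
  exact inv_mul_cancel _

theorem word_arc_of_mem {k : Option (Fin r × ℕ)} {γ : ℝ → Gam r} (hγ : Continuous γ) {a b : ℝ}
    (h : ∀ t ∈ uIcc a b, γ t ∈ chart k) :
    (word r).arc hγ a b = (transition k (γ a))⁻¹ * transition k (γ b) :=
  word_of_mem fun t => h _ (segment_mem_uIcc a b t)

theorem word_ray (i : Fin r) (a b : ℝ) : (word r).arc (continuous_ray i) a b = 1 := by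
  rw [word_arc_of_mem (k := none) _ fun t _ => ray_mem_plainSet i t]
  exact inv_mul_cancel _

theorem word_circ_plain (j : Fin r × ℕ) {a b : ℝ} (h : uIcc a b ⊆ Ioo (-1 / 2 : ℝ) (1 / 2)) :
    (word r).arc (continuous_circ j) a b = 1 := by
  rw [word_arc_of_mem (k := none) _ fun t ht => circ_mem_plainSet j (h ht)]
  exact inv_mul_cancel _

theorem word_circ_plain' (j : Fin r × ℕ) {a b : ℝ} (h : uIcc a b ⊆ Ioo (1 / 2 : ℝ) (3 / 2)) :
    (word r).arc (continuous_circ j) a b = 1 := by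
  rw [word_arc_of_mem (k := none) _ fun t ht => circ_mem_plainSet' j (h ht)]
  exact inv_mul_cancel _

theorem circ_im (j : Fin r × ℕ) (s : ℝ) : (circ j s).1.2.im = - Real.sin (2 * Real.pi * s) := by
  rw [circ_snd, Complex.sub_im, Complex.exp_ofReal_mul_I_im]
  simp

theorem transition_quarter (j : Fin r × ℕ) :
    transition (some j) (circ j (1 / 4)) = (of j : FreeGroup (Fin r × ℕ))⁻¹ := by
  refine transition_of_neg ?_
  rw [circ_im, show 2 * Real.pi * (1 / 4) = Real.pi / 2 by ring, Real.sin_pi_div_two]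
  norm_num

theorem transition_half (j : Fin r × ℕ) :
    transition (some j) (circ j (1 / 2)) = (1 : FreeGroup (Fin r × ℕ)) := by
  refine transition_of_nonneg ?_
  rw [circ_im, show 2 * Real.pi * (1 / 2) = Real.pi by ring, Real.sin_pi]
  norm_num

theorem transition_three_quarters (j : Fin r × ℕ) :
    transition (some j) (circ j (3 / 4)) = (1 : FreeGroup (Fin r × ℕ)) := by
  refine transition_of_nonneg ?_
  rw [circ_im, show 2 * Real.pi * (3 / 4) = Real.pi / 2 + Real.pi by ring, Real.sin_add_pi,
    Real.sin_pi_div_two]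
  norm_num

theorem uIcc_subset_Ioo {a b c d : ℝ} (ha : a ∈ Ioo c d) (hb : b ∈ Ioo c d) :
    uIcc a b ⊆ Ioo c d := fun t ht => by
  rw [mem_uIcc] at ht
  rcases ht with ht | ht
  · exact ⟨ha.1.trans_le ht.1, ht.2.trans_lt hb.2⟩
  · exact ⟨hb.1.trans_le ht.1, ht.2.trans_lt ha.2⟩

theorem word_circ_arcSet (j : Fin r × ℕ) {a b : ℝ} (ha : a ∈ Ioo (0 : ℝ) 1)
    (hb : b ∈ Ioo (0 : ℝ) 1) : (word r).arc (continuous_circ j) a b =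
      (transition (some j) (circ j a))⁻¹ * transition (some j) (circ j b) :=
  word_arc_of_mem (k := some j) _ fun _ ht => circ_mem_arcSet j (uIcc_subset_Ioo ha hb ht)

/-- Only the middle half contributes: between the parameters `1 / 4` and `3 / 4` the imaginary part
turns from negative to positive, and the transition jumps from `x_j⁻¹` to `1`. -/
theorem word_circ (j : Fin r × ℕ) : (word r).arc (continuous_circ j) 0 1 = of j := by
  have h1 : (word r).arc (continuous_circ j) 0 (1 / 4) = 1 :=
    word_circ_plain j (uIcc_subset_Ioo (by norm_num) (by norm_num))
  have h2 : (word r).arc (continuous_circ j) (1 / 4) (3 / 4) = of j := by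
    rw [word_circ_arcSet j (by norm_num) (by norm_num), transition_quarter,
      transition_three_quarters]
    exact (mul_one _).trans (inv_inv _)
  have h3 : (word r).arc (continuous_circ j) (3 / 4) 1 = 1 :=
    word_circ_plain' j (uIcc_subset_Ioo (by norm_num) (by norm_num))
  rw [← (word r).arc_mul _ 0 (1 / 4) 1, ← (word r).arc_mul _ (1 / 4) (3 / 4) 1, h1, h2, h3,
    one_mul, mul_one]

theorem word_circ_three_quarters_half (j : Fin r × ℕ) :
    (word r).arc (continuous_circ j) (3 / 4) (1 / 2) = 1 := by
  rw [word_circ_arcSet j (by norm_num) (by norm_num), transition_half,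
    transition_three_quarters]
  exact inv_mul_cancel _

end Covering

/-! ### The word determines a path up to homotopy -/

section Factorization

open unitInterval
open FreeGroup (of lift lift_apply_of)

variable {r : ℕ}

/-- Functors from the fundamental groupoid of `Γ` to a group factor through the words of paths. -/
theorem PathHom.exists_factor (i₀ : Fin r) {G : Type*} [Group G] (Φ : PathHom (Gam r) G) :
    ∃ (φ : FreeGroup (Fin r × ℕ) →* G) (a : Gam r → G), ∀ {x y : Gam r} (p : Path x y),
      Φ.toFun p = (a x)⁻¹ * φ ((word r).toFun p) * a y := by
  classical
  have : Nonempty (Fin r) := ⟨i₀⟩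
  have := contractibleSpace_plainSet i₀
  let τ : ∀ x : plainSet r, Path (ray i₀ 0) x.1 := fun x =>
    (PathConnectedSpace.somePath (⟨ray i₀ 0, ray_mem_plainSet i₀ 0⟩ : plainSet r) x).map
      continuous_subtype_val
  have hτ : ∀ x t, τ x t ∈ plainSet r := fun x t => Subtype.prop _
  -- On `plainSet`, the potential is the value on a path from the core vertex inside this set; the
  -- choice is immaterial by contractibility.
  let a₀ : Gam r → G := fun x => if h : x ∈ plainSet r then Φ.toFun (τ ⟨x, h⟩) else 1
  have hplain : ∀ {x y : Gam r} (p : Path x y), (∀ t, p t ∈ plainSet r) →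
      Φ.toFun p = (a₀ x)⁻¹ * a₀ y := by
    intro x y p hp
    have hx : x ∈ plainSet r := by simpa using hp 0
    have hy : y ∈ plainSet r := by simpa using hp 1
    simp only [a₀, dif_pos hx, dif_pos hy]
    rw [eq_inv_mul_iff_mul_eq, ← Φ.map_trans]
    refine Φ.map_homotopic (homotopic_of_mem (U := plainSet r) (fun t => ?_) (hτ ⟨y, hy⟩))
    rw [Path.trans_apply]
    split
    · exact hτ _ _
    · exact hp _
  let A : Fin r × ℕ → ℝ → ℝ → G := fun j => Φ.arc (continuous_circ j)
  choose! cut hcut using fun x (hx : x ∉ plainSet r) => exists_eq_circ_half hx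
  -- A point opposite to the half-line is reached from the parameter `3 / 4`, along an arc whose
  -- word is trivial.
  let a : Gam r → G := fun x =>
    if x ∈ plainSet r then a₀ x else a₀ (circ (cut x) (3 / 4)) * A (cut x) (3 / 4) (1 / 2)
  have ha : ∀ x ∈ plainSet r, a x = a₀ x := fun x hx => if_pos hx
  have hhalf : ∀ j : Fin r × ℕ, circ j (1 / 2) ∉ plainSet r := fun j h =>
    h ((circ_snd_eq_two_iff j _).2 ⟨1, by norm_num⟩)
  have ha' : ∀ j : Fin r × ℕ, a (circ j (1 / 2)) = a₀ (circ j (3 / 4)) * A j (3 / 4) (1 / 2) := by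
    intro j
    have h1 : cut (circ j (1 / 2)) = j := (circ_eq_circ (hcut _ (hhalf j))).1.symm
    change (if _ then _ else _) = _
    rw [if_neg (hhalf j), h1]
  let φ : FreeGroup (Fin r × ℕ) →* G :=
    lift fun j => a (ray j.1 (j.2 + 1)) * A j 0 1 * (a (ray j.1 (j.2 + 1)))⁻¹
  have hφ : ∀ j, φ (of j) = a (ray j.1 (j.2 + 1)) * A j 0 1 * (a (ray j.1 (j.2 + 1)))⁻¹ :=
    fun j => lift_apply_of
  have hgoodplain : ∀ {x y : Gam r} (p : Path x y), (∀ t, p t ∈ plainSet r) →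
      Φ.toFun p = (a x)⁻¹ * φ ((word r).toFun p) * a y := by
    intro x y p hp
    rw [word_of_mem_plainSet hp, map_one, mul_one, ha x (by simpa using hp 0),
      ha y (by simpa using hp 1), hplain p hp]
  -- the arcs on the circles
  let Good : Fin r × ℕ → ℝ → ℝ → Prop := fun j s s' => A j s s' =
    (a (circ j s))⁻¹ * φ ((word r).arc (continuous_circ j) s s') * a (circ j s')
  have gtrans : ∀ {j s s' s''}, Good j s s' → Good j s' s'' → Good j s s'' := by
    intro j s s' s'' h h'
    change A j s s'' = _
    rw [show A j s s'' = A j s s' * A j s' s'' from (Φ.arc_mul _ _ _ _).symm, h, h',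
      ← (word r).arc_mul _ s s' s'', map_mul]
    group
  have gsymm : ∀ {j s s'}, Good j s s' → Good j s' s := by
    intro j s s' h
    change A j s' s = _
    rw [show A j s' s = (A j s s')⁻¹ from Φ.arc_symm _ _ _, h, (word r).arc_symm _ s s', map_inv]
    group
  have gnear : ∀ {j s s'}, s ∈ Ioo (-1 / 2 : ℝ) (1 / 2) → s' ∈ Ioo (-1 / 2 : ℝ) (1 / 2) →
      Good j s s' := fun {j s s'} hs hs' =>
    hgoodplain _ fun t => circ_mem_plainSet j (uIcc_subset_Ioo hs hs' (segment_mem_uIcc s s' t))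
  have gnear' : ∀ {j s s'}, s ∈ Ioo (1 / 2 : ℝ) (3 / 2) → s' ∈ Ioo (1 / 2 : ℝ) (3 / 2) →
      Good j s s' := fun {j s s'} hs hs' =>
    hgoodplain _ fun t => circ_mem_plainSet' j (uIcc_subset_Ioo hs hs' (segment_mem_uIcc s s' t))
  have gback : ∀ j, Good j (3 / 4) (1 / 2) := fun j => by
    change A j (3 / 4) (1 / 2) = _
    rw [word_circ_three_quarters_half, map_one, mul_one, ha',
      ha _ (circ_mem_plainSet' j (by norm_num))]
    group
  have gloop : ∀ j, Good j 0 1 := fun j => by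
    change A j 0 1 = _
    rw [word_circ, hφ, circ_zero, circ_one]
    group
  -- The arc from `1 / 4` to `1 / 2` is replaced by the detour through `0`, `1` and `3 / 4`, where
  -- the loop from `0` to `1` defines `φ`.
  have gfront : ∀ j, Good j (1 / 4) (1 / 2) := fun j =>
    gtrans (gtrans (gtrans (gnear (by norm_num) (by norm_num)) (gloop j))
      (gnear' (by norm_num) (by norm_num) : Good j 1 (3 / 4))) (gback j)
  have gto : ∀ {j s}, s ∈ Ioo (0 : ℝ) 1 → Good j s (1 / 2) := by
    intro j s hs
    rcases lt_trichotomy s (1 / 2) with h | rfl | h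
    · exact gtrans (gnear ⟨by linarith [hs.1], h⟩ (by norm_num)) (gfront j)
    · exact gtrans (gsymm (gback j)) (gback j)
    · exact gtrans (gnear' ⟨h, by linarith [hs.2]⟩ (by norm_num)) (gback j)
  refine ⟨φ, a, fun {x y} p => ?_⟩
  refine path_induction
    (P := fun {x y} p => Φ.toFun p = (a x)⁻¹ * φ ((word r).toFun p) * a y)
    isOpen_chart (fun x => (exists_mem_chart x).imp fun k h => h.1) ?_ ?_ ?_ p
  · intro x y p q h hp
    rw [← Φ.map_homotopic h, hp, (word r).map_homotopic h]
  · intro x y z p q hp hq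
    rw [Φ.map_trans, hp, hq, (word r).map_trans, map_mul]
    group
  · rintro (_ | j) x y p hp
    · exact hgoodplain p hp
    · have hx : x ∈ arcSet j := p.source ▸ (hp 0 : p 0 ∈ arcSet j)
      have hy : y ∈ arcSet j := p.target ▸ (hp 1 : p 1 ∈ arcSet j)
      obtain ⟨s, hs, rfl⟩ := exists_eq_circ_of_mem_arcSet hx
      obtain ⟨s', hs', rfl⟩ := exists_eq_circ_of_mem_arcSet hy
      have hhom : p.Homotopic ((Path.segment s s').map (continuous_circ j)) :=
        homotopic_of_mem (U := arcSet j) hp fun t =>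
          circ_mem_arcSet j (uIcc_subset_Ioo hs hs' (segment_mem_uIcc s s' t))
      rw [Φ.map_homotopic hhom, (word r).map_homotopic hhom]
      exact gtrans (gto hs) (gsymm (gto hs'))

theorem nonempty_path (i₀ : Fin r) (x : Gam r) : Nonempty (Path (ray i₀ 0) x) := by
  have hray : ∀ i t, Joined (ray i₀ 0) (ray i t) := fun i t => by
    rw [ray_zero i₀ i]
    exact ⟨(Path.segment 0 t).map (continuous_ray i)⟩
  rcases gam_cases x with ⟨i, t, -, rfl⟩ | ⟨j, s, -, rfl⟩
  · exact hray i t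
  · refine (hray j.1 (j.2 + 1)).trans ?_
    rw [← circ_zero]
    exact ⟨(Path.segment 0 s).map (continuous_circ j)⟩

/-- Paths with the same end points and the same word are homotopic. -/
theorem homotopic_of_word_eq {x y : Gam r} {p q : Path x y}
    (h : (word r).toFun p = (word r).toFun q) : p.Homotopic q := by
  have hr : Nonempty (Fin r) := by
    obtain ⟨i, -⟩ | ⟨i, -⟩ := x.2 <;> exact ⟨i⟩
  obtain ⟨i₀⟩ := hr
  let τ : ∀ x, Path (ray i₀ 0) x := fun x => (nonempty_path i₀ x).some
  -- The functor `loopHom` separates homotopy classes of paths, and yet it factors through words.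
  obtain ⟨φ, a, hφ⟩ := (loopHom τ).exists_factor i₀
  exact homotopic_of_loopHom_eq (by rw [hφ p, hφ q, h])

/-- Every word is the word of a path between two given points. -/
theorem exists_path_word (x y : Gam r) (w : FreeGroup (Fin r × ℕ)) :
    ∃ p : Path x y, (word r).toFun p = w := by
  have hr : Nonempty (Fin r) := by
    obtain ⟨i, -⟩ | ⟨i, -⟩ := x.2 <;> exact ⟨i⟩
  obtain ⟨i₀⟩ := hr
  obtain ⟨px⟩ := nonempty_path i₀ x
  obtain ⟨py⟩ := nonempty_path i₀ y
  have hloop : ∀ w : FreeGroup (Fin r × ℕ),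
      ∃ p : Path (ray i₀ 0) (ray i₀ 0), (word r).toFun p = w := by
    intro w
    induction w using FreeGroup.induction_on with
    | C1 => exact ⟨Path.refl _, (word r).map_refl _⟩
    | of j =>
      let c : Path (ray j.1 (j.2 + 1)) (ray j.1 (j.2 + 1)) :=
        ((Path.segment 0 1).map (continuous_circ j)).cast (circ_zero j).symm (circ_one j).symm
      let q : Path (ray i₀ 0) (ray j.1 (j.2 + 1)) :=
        ((Path.segment 0 (j.2 + 1 : ℝ)).map (continuous_ray j.1)).cast (ray_zero i₀ j.1) rfl
      refine ⟨(q.trans c).trans q.symm, ?_⟩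
      have hq : (word r).toFun q = 1 := (((word r).map_cast _ _ _).trans (word_ray j.1 0 (j.2 + 1)))
      have hc : (word r).toFun c = of j := (((word r).map_cast _ _ _).trans (word_circ j))
      rw [(word r).map_trans, (word r).map_trans, (word r).map_symm, hq, hc]
      simp
    | inv_of j ih =>
      obtain ⟨p, hp⟩ := ih
      exact ⟨p.symm, by rw [(word r).map_symm, hp]⟩
    | mul v w ihv ihw =>
      obtain ⟨p, hp⟩ := ihv
      obtain ⟨q, hq⟩ := ihw
      exact ⟨p.trans q, by rw [(word r).map_trans, hp, hq]⟩
  obtain ⟨p, hp⟩ := hloop ((word r).toFun px * w * ((word r).toFun py)⁻¹)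
  refine ⟨(px.symm.trans p).trans py, ?_⟩
  rw [(word r).map_trans, (word r).map_trans, (word r).map_symm, hp]
  group

end Factorization

/-! ### Induced homomorphisms, and homotopies from words -/

section Realization

open unitInterval
open FreeGroup (of lift lift_apply_of)

variable {r : ℕ}

/-- The homotopy along `p` extends to the simply connected plane, in which the two ways around the
unit square are homotopic. -/
theorem PathHom.square {X : Type*} [TopologicalSpace X] {G : Type*} [Group G] (Φ : PathHom X G)
    {f f' : C(X, X)} (H : ContinuousMap.Homotopy f f') {x y : X} (p : Path x y) :
    Φ.toFun (p.map f.continuous) * Φ.toFun (H.evalAt y) =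
      Φ.toFun (H.evalAt x) * Φ.toFun (p.map f'.continuous) := by
  let S : C(ℝ × ℝ, X) := ⟨fun q => H (projIcc 0 1 zero_le_one q.1, p.extend q.2), by
    have := p.continuous_extend
    fun_prop⟩
  let bot : Path ((0 : ℝ), (0 : ℝ)) (0, 1) := Path.segment _ _
  let top : Path ((1 : ℝ), (0 : ℝ)) (1, 1) := Path.segment _ _
  let left : Path ((0 : ℝ), (0 : ℝ)) (1, 0) := Path.segment _ _
  let right : Path ((0 : ℝ), (1 : ℝ)) (1, 1) := Path.segment _ _
  have h : (Φ.comap S).toFun (bot.trans right) = (Φ.comap S).toFun (left.trans top) :=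
    (Φ.comap S).map_homotopic (SimplyConnectedSpace.paths_homotopic _ _)
  have hb : (Φ.comap S).toFun bot = Φ.toFun (p.map f.continuous) := Φ.congr fun t => by
    simp [S, bot, AffineMap.lineMap_apply]
  have ht : (Φ.comap S).toFun top = Φ.toFun (p.map f'.continuous) := Φ.congr fun t => by
    simp [S, top, AffineMap.lineMap_apply]
  have hl : (Φ.comap S).toFun left = Φ.toFun (H.evalAt x) := Φ.congr fun t => by
    simp [S, left, AffineMap.lineMap_apply, ContinuousMap.Homotopy.evalAt]
  have hr : (Φ.comap S).toFun right = Φ.toFun (H.evalAt y) := Φ.congr fun t => by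
    simp [S, right, AffineMap.lineMap_apply, ContinuousMap.Homotopy.evalAt]
  rw [PathHom.map_trans, PathHom.map_trans, hb, ht, hl, hr] at h
  exact h

/-- The map `f` induces `φ`, up to conjugation, on the fundamental group. -/
def Realizes (f : C(Gam r, Gam r)) (φ : FreeGroup (Fin r × ℕ) →* FreeGroup (Fin r × ℕ)) : Prop :=
  ∃ a : Gam r → FreeGroup (Fin r × ℕ), ∀ {x y : Gam r} (p : Path x y),
    (word r).toFun (p.map f.continuous) = (a x)⁻¹ * φ ((word r).toFun p) * a y

theorem exists_realizes (i₀ : Fin r) (f : C(Gam r, Gam r)) : ∃ φ, Realizes f φ := by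
  obtain ⟨φ, a, h⟩ := ((word r).comap f).exists_factor i₀
  exact ⟨φ, a, h⟩

theorem realizes_id : Realizes (ContinuousMap.id (Gam r)) (MonoidHom.id _) :=
  ⟨fun _ => 1, fun p => by
    simp only [inv_one, one_mul, mul_one, MonoidHom.id_apply]
    exact (word r).congr fun t => rfl⟩

variable {f f' : C(Gam r, Gam r)} {φ φ' : FreeGroup (Fin r × ℕ) →* FreeGroup (Fin r × ℕ)}

theorem Realizes.comp (h : Realizes f φ) (h' : Realizes f' φ') :
    Realizes (f.comp f') (φ.comp φ') := by
  obtain ⟨a, ha⟩ := h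
  obtain ⟨a', ha'⟩ := h'
  refine ⟨fun x => φ (a' x) * a (f' x), fun {x y} p => ?_⟩
  have h1 : (word r).toFun (p.map (f.comp f').continuous) =
      (word r).toFun ((p.map f'.continuous).map f.continuous) := (word r).congr fun t => rfl
  rw [h1, ha, ha', map_mul, map_mul, map_inv, MonoidHom.comp_apply]
  group

theorem Realizes.homotopic (h : Realizes f φ) (hf : f.Homotopic f') : Realizes f' φ := by
  obtain ⟨a, ha⟩ := h
  obtain ⟨H⟩ := hf
  refine ⟨fun x => a x * (word r).toFun (H.evalAt x), fun {x y} p => ?_⟩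
  have h1 := (word r).square H p
  rw [ha p] at h1
  rw [← inv_mul_eq_iff_eq_mul] at h1
  rw [← h1]
  group

theorem Realizes.conj (h : Realizes f φ) (u : FreeGroup (Fin r × ℕ)) :
    Realizes f ((MulAut.conj u).toMonoidHom.comp φ) := by
  obtain ⟨a, ha⟩ := h
  refine ⟨fun x => u * a x, fun {x y} p => ?_⟩
  rw [ha p]
  simp only [MonoidHom.comp_apply, MulEquiv.toMonoidHom_eq_coe, MonoidHom.coe_coe,
    MulAut.conj_apply]
  group

/-- Every word is the word of a loop at the core vertex, and both homomorphisms compute the word of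
its image under `f`, up to conjugators that depend only on the vertex. -/
theorem Realizes.unique (i₀ : Fin r) (h : Realizes f φ) (h' : Realizes f φ') :
    ∃ u, ∀ w, φ' w = u * φ w * u⁻¹ := by
  obtain ⟨a, ha⟩ := h
  obtain ⟨a', ha'⟩ := h'
  refine ⟨a' (ray i₀ 0) * (a (ray i₀ 0))⁻¹, fun w => ?_⟩
  obtain ⟨p, hp⟩ := exists_path_word (ray i₀ 0) (ray i₀ 0) w
  have h1 := (ha p).symm.trans (ha' p)
  rw [hp] at h1
  have h2 : φ' w = a' (ray i₀ 0) * ((a' (ray i₀ 0))⁻¹ * φ' w * a' (ray i₀ 0)) *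
    (a' (ray i₀ 0))⁻¹ := by group
  rw [h2, ← h1]
  group

/-- A square with prescribed sides, where the vertical sides are run through in the first half of the
time, can be filled in if the words agree. -/
theorem exists_square {x₀ x₁ y₀ y₁ : Gam r} (e : Path x₀ x₁) (e' : Path y₀ y₁) (p : Path x₀ y₀)
    (q : Path x₁ y₁)
    (h : (word r).toFun e * (word r).toFun q = (word r).toFun p * (word r).toFun e') :
    ∃ S : ContinuousMap.Homotopy e.toContinuousMap e'.toContinuousMap,
      (∀ τ : I, S (τ, 0) = p.extend (2 * τ)) ∧ (∀ τ : I, S (τ, 1) = q.extend (2 * τ)) := by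
  -- The curve runs through the reverse of `p`, then `e`, then `q`, over the intervals `[-1, 0]`,
  -- `[0, 1]` and `[1, 2]`.
  let Q : ℝ → Gam r := fun u =>
    if u ≤ 0 then p.extend (-u) else if u ≤ 1 then e.extend u else q.extend (u - 1)
  have hQ : Continuous Q := by
    have h1 := p.continuous_extend
    have h2 := q.continuous_extend
    refine Continuous.if_le (by fun_prop) (Continuous.if_le e.continuous_extend (by fun_prop)
      continuous_id continuous_const ?_) continuous_id continuous_const ?_
    · rintro u rfl
      simp
    · rintro u rfl
      simp
  have hQ0 : ∀ u ≤ 0, Q u = p.extend (-u) := fun u hu => if_pos hu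
  have hQ1 : ∀ u, 0 ≤ u → u ≤ 1 → Q u = e.extend u := fun u h0 h1 => by
    by_cases hu : u ≤ 0
    · obtain rfl : u = 0 := le_antisymm hu h0
      simp [Q]
    · simp only [Q]
      rw [if_neg hu, if_pos h1]
  have hQ2 : ∀ u, 1 ≤ u → Q u = q.extend (u - 1) := fun u h1 => by
    by_cases hu : u ≤ 1
    · obtain rfl : u = 1 := le_antisymm hu h1
      simp [Q]
    · simp only [Q]
      rw [if_neg (by linarith), if_neg hu]
  let e'' : Path y₀ y₁ :=
    { toFun := fun s => Q (-1 + s * 3)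
      continuous_toFun := hQ.comp (by fun_prop)
      source' := by simp [hQ0]
      target' := by
        rw [hQ2 _ (by norm_num)]
        norm_num }
  have hword : (word r).toFun e'' = (word r).toFun e' := by
    have h1 : (word r).arc hQ (-1) 0 = ((word r).toFun p)⁻¹ := by
      rw [← (word r).map_symm]
      refine (word r).congr fun t => ?_
      simp only [Path.map_coe, Function.comp_apply, Path.segment_apply, AffineMap.lineMap_apply]
      rw [hQ0 _ (by have := t.2.2; simp; linarith), ← Path.extend_extends' p.symm,
        Path.extend_symm_apply]
      congr 1
      simp
      ring
    have h2 : (word r).arc hQ 0 1 = (word r).toFun e := by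
      refine (word r).congr fun t => ?_
      simp only [Path.map_coe, Function.comp_apply, Path.segment_apply, AffineMap.lineMap_apply]
      rw [hQ1 _ (by simpa using t.2.1) (by simpa using t.2.2)]
      simp
    have h3 : (word r).arc hQ 1 2 = (word r).toFun q := by
      refine (word r).congr fun t => ?_
      simp only [Path.map_coe, Function.comp_apply, Path.segment_apply, AffineMap.lineMap_apply]
      rw [hQ2 _ (by have := t.2.1; simp; linarith)]
      norm_num
    have h4 : (word r).toFun e'' = (word r).arc hQ (-1) 2 := by
      refine (word r).congr fun t => ?_
      simp only [Path.map_coe, Function.comp_apply, Path.segment_apply, AffineMap.lineMap_apply]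
      change Q _ = Q _
      congr 1
      simp
      ring
    rw [h4, ← (word r).arc_mul hQ (-1) 0 2, ← (word r).arc_mul hQ 0 1 2, h1, h2, h3, h]
    group
  obtain ⟨K⟩ := homotopic_of_word_eq hword
  -- Widening the window from `[0, 1]` to `[-1, 2]` moves the end points along `p` and `q`; the
  -- homotopy `K` used afterwards keeps them fixed.
  let S₁ : ContinuousMap.Homotopy e.toContinuousMap e''.toContinuousMap :=
    { toFun := fun z => Q (-(z.1 : ℝ) + z.2 * (1 + 2 * z.1))
      continuous_toFun := hQ.comp (by fun_prop)
      map_zero_left := fun s => by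
        rw [hQ1 _ (by simpa using s.2.1) (by simpa using s.2.2)]
        simp
      map_one_left := fun s => by
        change Q _ = Q _
        congr 1
        push_cast
        ring }
  refine ⟨S₁.trans K.toHomotopy, fun τ => ?_, fun τ => ?_⟩
  · rw [ContinuousMap.Homotopy.trans_apply]
    split
    · change Q (-(2 * τ : ℝ) + 0 * _) = _
      rw [hQ0 _ (by have := τ.2.1; linarith)]
      congr 1
      ring
    · rename_i hτ
      refine (K.source _).trans ?_
      rw [Path.extend_of_one_le]
      simp only at hτ
      linarith
  · rw [ContinuousMap.Homotopy.trans_apply]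
    split
    · change Q (-(2 * τ : ℝ) + 1 * (1 + 2 * (2 * τ))) = _
      rw [hQ2 _ (by have := τ.2.1; linarith)]
      congr 1
      ring
    · rename_i hτ
      refine (K.target _).trans ?_
      rw [Path.extend_of_one_le]
      simp only at hτ
      linarith

/-- Two maps are homotopic if there are paths between the images of the points whose words intertwine
the induced functors. The homotopy is constant on the edges where possible. -/
theorem exists_homotopy {f f' : C(Gam r, Gam r)} (v : ∀ x, Path (f x) (f' x))
    (hv : ∀ {x y : Gam r} (p : Path x y), (word r).toFun (p.map f.continuous) *
      (word r).toFun (v y) = (word r).toFun (v x) * (word r).toFun (p.map f'.continuous)) :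
    ∃ H : ContinuousMap.Homotopy f f', ∀ k, (∀ s, f (edge k s) = f' (edge k s)) →
      (∀ t, v (edge k 0) t = f (edge k 0)) → (∀ t, v (edge k 1) t = f (edge k 1)) →
      ∀ τ s, H (τ, edge k s) = f (edge k s) := by
  classical
  let V : Gam r → C(I, Gam r) := fun x => ⟨fun τ => (v x).extend (2 * τ), by
    have := (v x).continuous_extend
    fun_prop⟩
  have hS : ∀ k, ∃ S : ContinuousMap.Homotopy (f.comp (edge k)) (f'.comp (edge k)),
      (∀ τ : I, S (τ, 0) = V (edge k 0) τ) ∧ (∀ τ : I, S (τ, 1) = V (edge k 1) τ) ∧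
      ((∀ s, f (edge k s) = f' (edge k s)) →
      (∀ t, v (edge k 0) t = f (edge k 0)) → (∀ t, v (edge k 1) t = f (edge k 1)) →
      ∀ τ s, S (τ, s) = f (edge k s)) := by
    intro k
    by_cases hk : (∀ s, f (edge k s) = f' (edge k s)) ∧
      (∀ t, v (edge k 0) t = f (edge k 0)) ∧ (∀ t, v (edge k 1) t = f (edge k 1))
    · refine ⟨(ContinuousMap.Homotopy.refl (f.comp (edge k))).cast rfl
        (ContinuousMap.ext hk.1), ?_, ?_, fun _ _ _ _ _ => rfl⟩
      · exact fun τ => (hk.2.1 _).symm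
      · exact fun τ => (hk.2.2 _).symm
    · let p : Path (edge k 0) (edge k 1) := ⟨edge k, rfl, rfl⟩
      obtain ⟨S, h0, h1⟩ := exists_square (p.map f.continuous) (p.map f'.continuous)
        (v (edge k 0)) (v (edge k 1)) (hv p)
      exact ⟨S.cast rfl rfl, h0, h1, fun h2 h3 h4 => absurd ⟨h2, h3, h4⟩ hk⟩
  choose S hS0 hS1 hSc using hS
  -- A homotopy is a map into the path space, so it can be glued from the edges like any other map.
  let E : ∀ k, C(I, C(I, Gam r)) := fun k =>
    ContinuousMap.curry ((S k).toContinuousMap.comp ContinuousMap.prodSwap)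
  have hE : ∀ k s τ, E k s τ = S k (τ, s) := fun k s τ => rfl
  have hE0 : ∀ k, E k 0 = V (edge k 0) := fun k => ContinuousMap.ext fun τ => hS0 k τ
  have hE1 : ∀ k, E k 1 = V (edge k 1) := fun k => ContinuousMap.ext fun τ => hS1 k τ
  obtain ⟨F, hF1, hF2⟩ := exists_glue (fun i n => V (ray i n)) (fun j => E (.inl j))
    (fun j => E (.inr j)) (fun i i' => congrArg V (by simpa using ray_zero i i'))
    (fun j => (hE0 _).trans (congrArg V (by simp [edge_inl])))
    (fun j => (hE1 _).trans (congrArg V (by simp [edge_inl])))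
    (fun j => (hE0 _).trans (congrArg V (by simp [edge_inr, circ_zero])))
    (fun j => (hE1 _).trans (congrArg V (by simp [edge_inr, circ_one])))
  have hF : ∀ k s, F (edge k s) = E k s := by
    rintro (j | j) s
    · exact hF1 j s
    · exact hF2 j s
  refine ⟨{
    toFun := fun q => F q.2 q.1
    continuous_toFun := by fun_prop
    map_zero_left := fun x => ?_
    map_one_left := fun x => ?_ }, fun k h1 h2 h3 τ s => ?_⟩
  · obtain ⟨k, s, rfl⟩ := exists_edge x
    rw [hF, hE]
    exact (S k).apply_zero s
  · obtain ⟨k, s, rfl⟩ := exists_edge x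
    rw [hF, hE]
    exact (S k).apply_one s
  · change F (edge k s) τ = _
    rw [hF, hE]
    exact hSc k h1 h2 h3 τ s

end Realization

/-! ### Maps that translate the tails, and proper homotopy -/

section TailRigid

open FreeGroup (of lift lift_apply_of)

variable {r : ℕ}

theorem isCompact_height_le (M : ℝ) : IsCompact {p : Gam r | height p ≤ M} := by
  obtain ⟨n, hn⟩ := exists_nat_gt M
  have h : IsCompact (⋃ k ∈ {k : (Fin r × ℕ) ⊕ (Fin r × ℕ) | (edgeIndex k).2 < n},
      range (edge k)) :=
    (finite_edgeIndex_lt n).isCompact_biUnion fun k _ => isCompact_range (edge k).continuous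
  refine h.of_isClosed_subset (isClosed_le continuous_height continuous_const) fun p hp => ?_
  obtain ⟨k, s, rfl⟩ := exists_edge p
  refine mem_biUnion (x := k) ?_ (mem_range_self s)
  have h1 := (le_height_edge k s).trans_lt (lt_of_le_of_lt hp hn)
  exact_mod_cast h1

instance : WeaklyLocallyCompactSpace (Gam r) where
  exists_compact_mem_nhds p := ⟨{q | height q ≤ height p + 1}, isCompact_height_le _,
    Filter.mem_of_superset ((isOpen_lt continuous_height continuous_const).mem_nhds
      (show height p < height p + 1 by linarith)) fun q (hq : height q < _) => hq.le⟩

theorem exists_height_le {C : Set (Gam r)} (hC : IsCompact C) : ∃ M : ℕ, ∀ p ∈ C, height p ≤ M := by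
  obtain ⟨M, hM⟩ := (hC.image continuous_height).bddAbove
  obtain ⟨n, hn⟩ := exists_nat_ge M
  exact ⟨n, fun p hp => (hM (mem_image_of_mem _ hp)).trans hn⟩

/-- The map translates the tail of the half-line `i` to that of the half-line `σ i`, starting with the
piece `N i`, which is sent to the piece `k i`. -/
structure TailRigid (f : C(Gam r, Gam r)) (σ : Fin r → Fin r) (N k : Fin r → ℕ) : Prop where
  map_ray : ∀ i t, (N i : ℝ) + 1 / 2 ≤ t → f (ray i t) = ray (σ i) (t - N i + k i)
  map_circ : ∀ i m s, f (circ (i, N i + m) s) = circ (σ i, k i + m) s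

variable {f f' : C(Gam r, Gam r)} {σ σ' : Fin r → Fin r} {N k N' k' : Fin r → ℕ}

theorem TailRigid.shift (h : TailRigid f σ N k) (M : Fin r → ℕ) :
    TailRigid f σ (fun i => N i + M i) (fun i => k i + M i) where
  map_ray i t ht := by
    push_cast at ht ⊢
    have : (0 : ℝ) ≤ M i := by positivity
    rw [h.map_ray i t (by linarith)]
    congr 1
    ring
  map_circ i m s := by
    simp only [add_assoc]
    exact h.map_circ i _ s

theorem TailRigid.id : TailRigid (ContinuousMap.id (Gam r)) _root_.id 0 0 where
  map_ray i t _ := by simp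
  map_circ i m s := by simp

theorem TailRigid.comp (h : TailRigid f σ N k) (h' : TailRigid f' σ' N' k') :
    TailRigid (f.comp f') (σ ∘ σ') (fun i => N' i + (N (σ' i) - k' i))
      (fun i => k (σ' i) + (k' i - N (σ' i))) where
  map_ray i t ht := by
    have e : ((k' i + (N (σ' i) - k' i) : ℕ) : ℝ) = (N (σ' i) + (k' i - N (σ' i)) : ℕ) := by
      congr 1
      omega
    push_cast at e ht ⊢
    have h0 : (0 : ℝ) ≤ ((N (σ' i) - k' i : ℕ) : ℝ) := by positivity
    have h1 : (0 : ℝ) ≤ ((k' i - N (σ' i) : ℕ) : ℝ) := by positivity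
    rw [ContinuousMap.comp_apply, h'.map_ray i t (by linarith), h.map_ray _ _ (by linarith),
      Function.comp_apply]
    congr 1
    linarith
  map_circ i m s := by
    have e : k' i + (N (σ' i) - k' i + m) = N (σ' i) + (k' i - N (σ' i) + m) := by omega
    rw [ContinuousMap.comp_apply, add_assoc, h'.map_circ, e, h.map_circ, add_assoc]
    rfl

theorem TailRigid.le_height (h : TailRigid f σ N k) (M : ℕ) (hM : ∀ i, N i ≤ M) {p : Gam r}
    (hp : (M : ℝ) + 1 ≤ height p) : height p - M ≤ height (f p) := by
  rcases gam_cases p with ⟨i, t, ht, rfl⟩ | ⟨⟨i, n⟩, s, -, rfl⟩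
  · have h1 : (N i : ℝ) ≤ M := by exact_mod_cast hM i
    have h2 : (0 : ℝ) ≤ k i := by positivity
    rw [height_ray ht] at hp ⊢
    rw [h.map_ray i t (by linarith), height_ray (by linarith)]
    linarith
  · have h1 := hM i
    rw [height_circ] at hp ⊢
    have h2 : M ≤ n := by
      have : (M : ℝ) + 1 ≤ n + 1 := hp
      have : (M : ℝ) ≤ n := by linarith
      exact_mod_cast this
    obtain ⟨m, rfl⟩ := Nat.exists_eq_add_of_le (h1.trans h2)
    rw [h.map_circ, height_circ]
    have h3 : (N i : ℝ) ≤ M := by exact_mod_cast h1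
    have h2 : (0 : ℝ) ≤ k i := by positivity
    push_cast
    linarith

theorem exists_le_all (N : Fin r → ℕ) : ∃ M, ∀ i, N i ≤ M :=
  ⟨Finset.univ.sup N, fun i => Finset.le_sup (Finset.mem_univ i)⟩

theorem TailRigid.exists_preimage_bound (h : TailRigid f σ N k) {C : Set (Gam r)}
    (hC : IsCompact C) : ∃ M : ℝ, ∀ p, f p ∈ C → height p ≤ M := by
  obtain ⟨M, hM⟩ := exists_le_all N
  obtain ⟨K, hK⟩ := exists_height_le hC
  refine ⟨K + M + 1, fun p hp => ?_⟩
  by_contra! hlt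
  have h0 : (0 : ℝ) ≤ K := by positivity
  have h1 := h.le_height M hM (p := p) (by linarith)
  linarith [hK _ hp]

theorem TailRigid.isProperMap (h : TailRigid f σ N k) : IsProperMap f := by
  refine isProperMap_iff_isCompact_preimage.2 ⟨f.continuous, fun C hC => ?_⟩
  obtain ⟨M, hM⟩ := h.exists_preimage_bound hC
  exact (isCompact_height_le M).of_isClosed_subset (hC.isClosed.preimage f.continuous) hM

/-- Where the homotopy is stationary, properness is that of `f`; the remaining part of the graph has
bounded height, hence compact closure. -/
theorem TailRigid.isProperMap_homotopy (h : TailRigid f σ N k) (H : ContinuousMap.Homotopy f f')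
    {M : ℝ} (hM : ∀ p, M ≤ height p → ∀ τ, H (τ, p) = f p) : IsProperMap H := by
  refine isProperMap_iff_isCompact_preimage.2 ⟨H.continuous, fun C hC => ?_⟩
  obtain ⟨K, hK⟩ := h.exists_preimage_bound hC
  refine (isCompact_univ.prod (isCompact_height_le (max M K))).of_isClosed_subset
    (hC.isClosed.preimage H.continuous) ?_
  rintro ⟨τ, p⟩ hp
  refine ⟨trivial, ?_⟩
  by_contra hlt
  replace hlt : max M K < height p := not_le.1 hlt
  have h1 := hM p ((le_max_left _ _).trans hlt.le) τ
  have h2 : f p ∈ C := by rw [← h1]; exact hp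
  exact absurd (hK p h2) (not_le.2 ((le_max_right _ _).trans_lt hlt))

variable {φ : FreeGroup (Fin r × ℕ) →* FreeGroup (Fin r × ℕ)}
  {a : Gam r → FreeGroup (Fin r × ℕ)}

/-- Tail rays and their images have trivial words, so `a` takes one value at all tail vertices of a
ray; this value is the conjugator for all its circles. -/
theorem TailRigid.conj_eq (h : TailRigid f σ N k)
    (ha : ∀ {x y : Gam r} (p : Path x y), (word r).toFun (p.map f.continuous) =
      (a x)⁻¹ * φ ((word r).toFun p) * a y) (i : Fin r) (m : ℕ) :
    φ (of (i, N i + m)) = a (ray i (N i + 1)) * of (σ i, k i + m) * (a (ray i (N i + 1)))⁻¹ := by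
  have h1 : a (ray i (N i + 1)) = a (ray i (N i + m + 1)) := by
    have h2 := ha ((Path.segment (N i + 1 : ℝ) (N i + m + 1)).map (continuous_ray i))
    have h3 : (word r).toFun ((Path.segment (N i + 1 : ℝ) (N i + m + 1)).map (continuous_ray i)) =
      1 := word_ray i _ _
    rw [h3, map_one, mul_one] at h2
    have h4 : (word r).toFun (((Path.segment (N i + 1 : ℝ) (N i + m + 1)).map
        (continuous_ray i)).map f.continuous) =
        (word r).arc (continuous_ray (σ i)) (k i + 1) (k i + m + 1) := by
      refine (word r).congr fun t => ?_
      have ht := t.2.1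
      simp only [Path.map_coe, Function.comp_apply, Path.segment_apply, AffineMap.lineMap_apply]
      simp only [vsub_eq_sub, smul_eq_mul, vadd_eq_add]
      have hm : (0 : ℝ) ≤ m := by positivity
      have hm' : (0 : ℝ) ≤ t * m := by positivity
      rw [h.map_ray i _ (by linarith)]
      congr 1
      ring
    rw [h4, word_ray] at h2
    exact inv_mul_eq_one.1 h2.symm
  have h2 := ha ((Path.segment (0 : ℝ) 1).map (continuous_circ (i, N i + m)))
  have h3 : (word r).toFun ((Path.segment (0 : ℝ) 1).map (continuous_circ (i, N i + m))) =
    of (i, N i + m) := word_circ _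
  have h4 : (word r).toFun (((Path.segment (0 : ℝ) 1).map
      (continuous_circ (i, N i + m))).map f.continuous) = of (σ i, k i + m) := by
    refine Eq.trans ?_ (word_circ _)
    exact (word r).congr fun t => h.map_circ i m _
  rw [h3, h4, circ_zero, circ_one] at h2
  push_cast at h2
  rw [h1, h2]
  group

/-- Maps which agree on the tails and induce the same homomorphism are properly homotopic. -/
theorem TailRigid.properlyHomotopic (h : TailRigid f σ N k) (h' : TailRigid f' σ N k)
    (hf : Realizes f φ) (hf' : Realizes f' φ) : ProperlyHomotopic f f' := by
  classical
  obtain ⟨a, ha⟩ := hf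
  obtain ⟨a', ha'⟩ := hf'
  -- This is the word which the track of `x` under a homotopy must have. At tail vertices it
  -- commutes with two letters, hence is trivial, and the track can be constant.
  let u : Gam r → FreeGroup (Fin r × ℕ) := fun x => (a x)⁻¹ * a' x
  have hu : ∀ i (m : ℕ), u (ray i (N i + m + 1)) = 1 := by
    intro i m
    have hs := h.shift fun _ => m
    have hs' := h'.shift fun _ => m
    have key : ∀ l, u (ray i (N i + m + 1)) * of (σ i, k i + m + l) =
        of (σ i, k i + m + l) * u (ray i (N i + m + 1)) := by
      intro l
      have h1 := (hs.conj_eq ha i l).symm.trans (hs'.conj_eq ha' i l)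
      push_cast at h1
      simp only [u]
      rw [mul_inv_eq_iff_eq_mul] at h1
      have h2 : (a (ray i (N i + m + 1)))⁻¹ * a' (ray i (N i + m + 1)) * of (σ i, k i + m + l) =
        (a (ray i (N i + m + 1)))⁻¹ * (a' (ray i (N i + m + 1)) * of (σ i, k i + m + l) *
          (a' (ray i (N i + m + 1)))⁻¹ * a (ray i (N i + m + 1))) *
          ((a (ray i (N i + m + 1)))⁻¹ * a' (ray i (N i + m + 1))) := by group
      rw [h2, ← h1]
      group
    exact eq_one_of_commute_pair (i := (σ i, k i + m + 0)) (j := (σ i, k i + m + 1)) (by simp)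
      (key 0) (key 1)
  have hex : ∀ x, ∃ v : Path (f x) (f' x), (word r).toFun v = u x ∧
      (f x = f' x → u x = 1 → ∀ t, v t = f x) := by
    intro x
    by_cases hx : f x = f' x ∧ u x = 1
    · refine ⟨(Path.refl (f x)).cast rfl hx.1.symm, ?_, fun _ _ t => rfl⟩
      rw [(word r).map_cast, (word r).map_refl, hx.2]
    · obtain ⟨v, hv⟩ := exists_path_word (f x) (f' x) (u x)
      exact ⟨v, hv, fun h1 h2 => absurd ⟨h1, h2⟩ hx⟩
  choose v hv hvc using hex
  obtain ⟨H, hH⟩ := exists_homotopy v (fun {x y} p => by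
    rw [ha, ha', hv, hv]
    simp only [u]
    group)
  obtain ⟨M, hM⟩ := exists_le_all N
  have hray : ∀ i (n : ℕ), M < n → f (ray i n) = f' (ray i n) ∧ u (ray i n) = 1 := by
    intro i n hn
    have hNn : N i + 1 ≤ n := by have := hM i; omega
    obtain ⟨m, rfl⟩ := Nat.exists_eq_add_of_le hNn
    push_cast
    constructor
    · have : (0 : ℝ) ≤ m := by positivity
      rw [h.map_ray _ _ (by linarith), h'.map_ray _ _ (by linarith)]
    · rw [show (N i : ℝ) + 1 + m = N i + m + 1 by ring]
      exact hu i m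
  have hconst : ∀ i (n : ℕ), M < n → ∀ t, v (ray i n) t = f (ray i n) := fun i n hn =>
    hvc _ (hray i n hn).1 (hray i n hn).2
  refine ⟨H, h.isProperMap_homotopy H (M := M + 3) fun p hp τ => ?_⟩
  obtain ⟨k, s, rfl⟩ := exists_edge p
  have hk : M < (edgeIndex k).2 := by
    have h1 : (M : ℝ) + 3 ≤ (edgeIndex k).2 + 1 := le_trans hp (height_edge_le k s)
    have h2 : (M : ℝ) < (edgeIndex k).2 := by linarith
    exact_mod_cast h2
  rcases k with ⟨i, n⟩ | ⟨i, n⟩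
  · have hn : M < n := hk
    have hNn : N i ≤ n := (hM i).trans hn.le
    refine hH _ (fun s => ?_) (fun t => ?_) (fun t => ?_) τ s
    · have h1 : (N i : ℝ) + 1 ≤ n := by exact_mod_cast lt_of_le_of_lt (hM i) hn
      have := s.2.1
      rw [edge_inl, h.map_ray _ _ (by simp only; linarith), h'.map_ray _ _ (by simp only; linarith)]
    · have e : edge (.inl (i, n)) 0 = ray i n := by simp [edge_inl]
      rw [e]
      exact hconst i n hn t
    · have e : edge (.inl (i, n)) 1 = ray i (n + 1 : ℕ) := by simp [edge_inl]
      rw [e]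
      exact hconst i (n + 1) (by omega) t
  · have hn : M < n := hk
    have hNn : N i ≤ n := (hM i).trans hn.le
    obtain ⟨m, rfl⟩ := Nat.exists_eq_add_of_le hNn
    refine hH _ (fun s => ?_) (fun t => ?_) (fun t => ?_) τ s
    · rw [edge_inr, h.map_circ, h'.map_circ]
    · have e : edge (.inr (i, N i + m)) 0 = ray i (N i + m + 1 : ℕ) := by
        simp [edge_inr, circ_zero]
      rw [e]
      exact hconst i _ (by omega) t
    · have e : edge (.inr (i, N i + m)) 1 = ray i (N i + m + 1 : ℕ) := by
        simp [edge_inr, circ_one]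
      rw [e]
      exact hconst i _ (by omega) t

/-- A tail-rigid map which induces an automorphism. -/
structure Represents (f : C(Gam r, Gam r)) (ψ : MulAut (FreeGroup (Fin r × ℕ))) (σ : Fin r → Fin r)
    (N k : Fin r → ℕ) : Prop where
  tailRigid : TailRigid f σ N k
  realizes : Realizes f ψ.toMonoidHom

variable {ψ ψ' : MulAut (FreeGroup (Fin r × ℕ))}

theorem Represents.exists_conj (h : Represents f ψ σ N k) :
    ∃ g : Fin r → FreeGroup (Fin r × ℕ), ∀ i m,
      ψ (of (i, N i + m)) = g i * of (σ i, k i + m) * (g i)⁻¹ := by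
  obtain ⟨a, ha⟩ := h.realizes
  exact ⟨_, fun i m => h.tailRigid.conj_eq ha i m⟩

theorem Represents.comp (h : Represents f ψ σ N k) (h' : Represents f' ψ' σ' N' k') :
    Represents (f.comp f') (ψ * ψ') (σ ∘ σ') (fun i => N' i + (N (σ' i) - k' i))
      (fun i => k (σ' i) + (k' i - N (σ' i))) :=
  ⟨h.tailRigid.comp h'.tailRigid, h.realizes.comp h'.realizes⟩

theorem Represents.id : Represents (ContinuousMap.id (Gam r)) 1 _root_.id 0 0 :=
  ⟨TailRigid.id, realizes_id⟩

theorem Represents.conj (h : Represents f ψ σ N k) (u : FreeGroup (Fin r × ℕ)) :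
    Represents f (MulAut.conj u * ψ) σ N k :=
  ⟨h.tailRigid, h.realizes.conj u⟩

theorem Represents.shift (h : Represents f ψ σ N k) (M : Fin r → ℕ) :
    Represents f ψ σ (fun i => N i + M i) (fun i => k i + M i) :=
  ⟨h.tailRigid.shift M, h.realizes⟩

/-- If two rays had the same image, suitable letters on them would have conjugate images under the
automorphism, so they would themselves be conjugate and hence equal. -/
theorem Represents.injective (h : Represents f ψ σ N k) : Function.Injective σ := by
  intro i i' hi
  obtain ⟨g, hg⟩ := h.exists_conj
  have h1 := hg i (k i')
  have h2 := hg i' (k i)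
  rw [← hi, add_comm (k i') (k i)] at h2
  have h3 : of (σ i, k i + k i') = (g i)⁻¹ * ψ (of (i, N i + k i')) * g i := by rw [h1]; group
  rw [h3] at h2
  have h4 := congrArg ψ.symm h2
  simp only [map_mul, map_inv, MulEquiv.symm_apply_apply] at h4
  have h5 : (1 : FreeGroup (Fin r × ℕ)) * of (i', N i' + k i) * 1⁻¹ =
      (ψ.symm (g i') * (ψ.symm (g i))⁻¹) * of (i, N i + k i') *
      (ψ.symm (g i') * (ψ.symm (g i))⁻¹)⁻¹ := by
    rw [one_mul, inv_one, mul_one, h4]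
    group
  exact (congrArg Prod.fst (eq_of_conj_of_eq h5)).symm

/-- Tail-rigid maps which represent the same automorphism are properly homotopic. -/
theorem Represents.properlyHomotopic (h : Represents f ψ σ N k) (h' : Represents f' ψ σ' N' k') :
    ProperlyHomotopic f f' := by
  -- Both tails are moved to a common start; the image of the first letter there determines the
  -- target ray and index, so `σ` and the translations agree.
  have h1 := h.shift N'
  have h2 := h'.shift N
  obtain ⟨g, hg⟩ := h1.exists_conj
  obtain ⟨g', hg'⟩ := h2.exists_conj
  have key : ∀ i, (σ i, k i + N' i) = (σ' i, k' i + N i) := fun i => by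
    have e1 := hg i 0
    have e2 := hg' i 0
    rw [add_comm (N' i) (N i)] at e2
    exact eq_of_conj_of_eq (e1.symm.trans e2)
  obtain rfl : σ = σ' := funext fun i => congrArg Prod.fst (key i)
  have e3 : (fun i => k' i + N i) = fun i => k i + N' i :=
    funext fun i => (congrArg Prod.snd (key i)).symm
  have e4 : (fun i => N' i + N i) = fun i => N i + N' i := funext fun i => add_comm _ _
  have h3 := h2.tailRigid
  rw [e3, e4] at h3
  exact h1.tailRigid.properlyHomotopic h3 h1.realizes h2.realizes

end TailRigid

/-! ### Balls as suited subgraphs -/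

section Balls

variable {r : ℕ}

/-- The union of the core and the pieces `(i, n)` with `n < N i`. -/
def ball (N : Fin r → ℕ) : Set (Gam r) := {p | ∀ i, p.1.1 i ≤ N i + 1 / 2}

theorem isClosed_ball (N : Fin r → ℕ) : IsClosed (ball N) := by
  have : ball N = ⋂ i, {p : Gam r | p.1.1 i ≤ N i + 1 / 2} := by
    ext p
    simp [ball]
  rw [this]
  exact isClosed_iInter fun i => isClosed_le (by fun_prop) continuous_const

theorem mem_ball_of_single {N : Fin r → ℕ} {p : Gam r} {i : Fin r} {t : ℝ}
    (hp : p.1.1 = Pi.single i t) : p ∈ ball N ↔ t ≤ N i + 1 / 2 := by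
  constructor
  · intro h
    simpa [hp] using h i
  · intro h i'
    rw [hp]
    by_cases hi : i' = i
    · subst hi
      simpa using h
    · rw [Pi.single_eq_of_ne hi]
      positivity

theorem ray_mem_ball {N : Fin r → ℕ} {i : Fin r} {t : ℝ} (ht : 0 ≤ t) :
    ray i t ∈ ball N ↔ t ≤ N i + 1 / 2 := mem_ball_of_single (ray_fst ht)

theorem circ_mem_ball {N : Fin r → ℕ} {i : Fin r} {n : ℕ} {s : ℝ} :
    circ (i, n) s ∈ ball N ↔ n < N i := by
  rw [mem_ball_of_single (circ_fst _ _)]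
  constructor
  · intro h
    have : (n : ℝ) < N i := by simp only at h; linarith
    exact_mod_cast this
  · intro h
    have : (n : ℝ) + 1 ≤ N i := by exact_mod_cast h
    simp only
    linarith

theorem exists_single (p : Gam r) : ∃ i t, 0 ≤ t ∧ p.1.1 = Pi.single i t := by
  rcases gam_cases p with ⟨i, t, ht, rfl⟩ | ⟨j, s, -, rfl⟩
  · exact ⟨i, t, ht, ray_fst ht⟩
  · exact ⟨j.1, _, by positivity, circ_fst j s⟩

theorem connectedSpace_gam (i₀ : Fin r) : ConnectedSpace (Gam r) := by
  have : PathConnectedSpace (Gam r) :=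
    { nonempty := ⟨ray i₀ 0⟩
      joined := fun x y => (show Joined (ray i₀ 0) x from nonempty_path i₀ x).symm.trans
        (nonempty_path i₀ y) }
  infer_instance

/-- Everything beyond a boundary point of the ball collapses to that point. The retraction serves to
push homotopies of the whole graph into balls. -/
theorem exists_ret (N : Fin r → ℕ) : ∃ R : C(Gam r, Gam r),
    (∀ i t, 0 ≤ t → R (ray i t) = ray i (min t (N i + 1 / 2))) ∧
    (∀ i n s, n < N i → R (circ (i, n) s) = circ (i, n) s) ∧
    ∀ i n s, N i ≤ n → R (circ (i, n) s) = ray i (N i + 1 / 2) := by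
  have hmin : ∀ (i : Fin r) (n : ℕ), n < N i → min ((n : ℝ) + 1) (N i + 1 / 2) = n + 1 := by
    intro i n h
    have : (n : ℝ) + 1 ≤ N i := by exact_mod_cast h
    exact min_eq_left (by linarith)
  have hmin' : ∀ (i : Fin r) (n : ℕ), N i ≤ n →
      min ((n : ℝ) + 1) (N i + 1 / 2) = N i + 1 / 2 := by
    intro i n h
    have : (N i : ℝ) ≤ n := by exact_mod_cast h
    exact min_eq_right (by linarith)
  let e : Fin r × ℕ → C(unitInterval, Gam r) := fun j =>
    ⟨fun s => ray j.1 (min (j.2 + s) (N j.1 + 1 / 2)), (continuous_ray j.1).comp (by fun_prop)⟩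
  let c : Fin r × ℕ → C(unitInterval, Gam r) := fun j =>
    if j.2 < N j.1 then ⟨fun s => circ j s, (continuous_circ j).comp (by fun_prop)⟩
    else ContinuousMap.const _ (ray j.1 (N j.1 + 1 / 2))
  have hc : ∀ i n s, n < N i → c (i, n) s = circ (i, n) s := fun i n s h => by
    simp only [c]
    rw [if_pos h]
    rfl
  have hc' : ∀ i n s, N i ≤ n → c (i, n) s = ray i (N i + 1 / 2) := fun i n s h => by
    simp only [c]
    rw [if_neg (not_lt.2 h)]
    rfl
  obtain ⟨R, h1, h2⟩ := exists_glue (fun i n => ray i (min n (N i + 1 / 2))) e c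
    (fun i i' => by
      have : ∀ i : Fin r, min ((0 : ℕ) : ℝ) (N i + 1 / 2) = 0 := fun i =>
        (min_eq_left (by push_cast; positivity)).trans Nat.cast_zero
      simp only [this]
      exact ray_zero i i')
    (fun j => by simp [e]) (fun j => by simp [e])
    (fun ⟨i, n⟩ => by
      rcases lt_or_ge n (N i) with h | h
      · rw [hc i n _ h]
        push_cast
        rw [hmin i n h]
        exact circ_zero _
      · rw [hc' i n _ h]
        push_cast
        rw [hmin' i n h])
    (fun ⟨i, n⟩ => by
      rcases lt_or_ge n (N i) with h | h
      · rw [hc i n _ h]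
        push_cast
        rw [hmin i n h]
        exact circ_one _
      · rw [hc' i n _ h]
        push_cast
        rw [hmin' i n h])
  have hfract : ∀ (j : Fin r × ℕ) (s : ℝ), circ j s = circ j (Int.fract s) := fun j s => by
    conv_lhs => rw [← Int.fract_add_floor s, circ_add_int]
  refine ⟨R, fun i t ht => ?_, fun i n s h => ?_, fun i n s h => ?_⟩
  · have := h1 (i, ⌊t⌋₊) ⟨t - ⌊t⌋₊, by linarith [Nat.floor_le ht], by
      linarith [Nat.lt_floor_add_one t]⟩
    simpa [e] using this
  · rw [hfract]
    exact (h2 (i, n) ⟨_, Int.fract_nonneg s, (Int.fract_lt_one s).le⟩).trans (hc i n _ h)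
  · rw [hfract]
    exact (h2 (i, n) ⟨_, Int.fract_nonneg s, (Int.fract_lt_one s).le⟩).trans (hc' i n _ h)

/-- The retraction to a ball. -/
noncomputable def ret (N : Fin r → ℕ) : C(Gam r, Gam r) := (exists_ret N).choose

theorem ret_ray {N : Fin r → ℕ} {i : Fin r} {t : ℝ} (ht : 0 ≤ t) :
    ret N (ray i t) = ray i (min t (N i + 1 / 2)) := (exists_ret N).choose_spec.1 i t ht

theorem ret_circ_of_lt {N : Fin r → ℕ} {i : Fin r} {n : ℕ} (h : n < N i) (s : ℝ) :
    ret N (circ (i, n) s) = circ (i, n) s := (exists_ret N).choose_spec.2.1 i n s h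

theorem ret_circ_of_le {N : Fin r → ℕ} {i : Fin r} {n : ℕ} (h : N i ≤ n) (s : ℝ) :
    ret N (circ (i, n) s) = ray i (N i + 1 / 2) := (exists_ret N).choose_spec.2.2 i n s h

theorem ret_mem (N : Fin r → ℕ) (p : Gam r) : ret N p ∈ ball N := by
  rcases gam_cases p with ⟨i, t, ht, rfl⟩ | ⟨⟨i, n⟩, s, -, rfl⟩
  · rw [ret_ray ht, ray_mem_ball (by positivity)]
    exact min_le_right _ _
  · rcases lt_or_ge n (N i) with h | h
    · rw [ret_circ_of_lt h]
      exact circ_mem_ball.2 h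
    · rw [ret_circ_of_le h, ray_mem_ball (by positivity)]

theorem ret_of_mem {N : Fin r → ℕ} {p : Gam r} (hp : p ∈ ball N) : ret N p = p := by
  rcases gam_cases p with ⟨i, t, ht, rfl⟩ | ⟨⟨i, n⟩, s, -, rfl⟩
  · rw [ret_ray ht, min_eq_left ((ray_mem_ball ht).1 hp)]
  · exact ret_circ_of_lt (circ_mem_ball.1 hp) s

theorem isConnected_ball (i₀ : Fin r) (N : Fin r → ℕ) : IsConnected (ball N) := by
  have := connectedSpace_gam i₀
  have h : range (ret N) = ball N := by
    ext p
    constructor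
    · rintro ⟨q, rfl⟩
      exact ret_mem N q
    · exact fun hp => ⟨p, ret_of_mem hp⟩
  rw [← h]
  exact isConnected_range (ret N).continuous

theorem isCompact_ball (N : Fin r → ℕ) : IsCompact (ball N) := by
  obtain ⟨M, hM⟩ := exists_le_all N
  refine (isCompact_height_le (M + 1)).of_isClosed_subset (isClosed_ball N) fun p hp => ?_
  obtain ⟨i, t, ht, h⟩ := exists_single p
  have h1 := (mem_ball_of_single h).1 hp
  have h2 : (N i : ℝ) ≤ M := by exact_mod_cast hM i
  change height p ≤ _
  rw [height, h, Pi.norm_single, Real.norm_of_nonneg ht]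
  linarith

theorem finite_ball_index (N : Fin r → ℕ) : {j : Fin r × ℕ | j.2 < N j.1}.Finite := by
  obtain ⟨M, hM⟩ := exists_le_all N
  exact (Set.finite_univ.prod (Set.finite_Iio M)).subset fun j hj => ⟨trivial, lt_of_lt_of_le hj (hM _)⟩

theorem isSuited_ball (i₀ : Fin r) (N : Fin r → ℕ) : IsSuited (ball N) := by
  refine ⟨isConnected_ball i₀ N, (finite_ball_index N).toFinset, ?_⟩
  ext p
  simp only [mem_union, mem_iUnion, Finite.mem_toFinset, exists_prop]
  constructor
  · intro hp
    obtain ⟨i, t, ht, h⟩ := exists_single p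
    have h1 := (mem_ball_of_single h).1 hp
    rcases le_or_gt t (1 / 2) with h2 | h2
    · exact Or.inl ⟨i, t, ⟨ht, h2⟩, h⟩
    · have h3 : 0 < ⌈t - 1 / 2⌉₊ := Nat.ceil_pos.2 (by linarith)
      have h4 : ⌈t - 1 / 2⌉₊ ≤ N i := Nat.ceil_le.2 (by linarith)
      obtain ⟨n, hn⟩ := Nat.exists_eq_succ_of_ne_zero h3.ne'
      refine Or.inr ⟨(i, n), by change n < N i; omega, t, ⟨?_, ?_⟩, h⟩
      · have := Nat.ceil_lt_add_one (show 0 ≤ t - 1 / 2 by linarith)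
        rw [hn] at this
        push_cast at this
        linarith
      · have := Nat.le_ceil (t - 1 / 2)
        rw [hn] at this
        push_cast at this
        linarith
  · rintro (⟨i, t, ht, h⟩ | ⟨⟨i, n⟩, hn, t, ht, h⟩)
    · rw [mem_ball_of_single h]
      have : (0 : ℝ) ≤ N i := by positivity
      linarith [ht.2]
    · rw [mem_ball_of_single h]
      have : (n : ℝ) + 1 ≤ N i := by exact_mod_cast hn
      have h2 : t ≤ n + 3 / 2 := ht.2
      linarith

theorem mem_piece_iff {j : Fin r × ℕ} {p : Gam r} : p ∈ piece j ↔
    (∃ t ∈ Icc ((j.2 : ℝ) + 1 / 2) (j.2 + 3 / 2), p = ray j.1 t) ∨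
      ∃ s ∈ Ico (0 : ℝ) 1, p = circ j s := by
  have hj : (0 : ℝ) ≤ j.2 := by positivity
  constructor
  · rintro ⟨t, ht, h⟩
    have ht0 : t ≠ 0 := by linarith [ht.1]
    rcases gam_cases p with ⟨i, t', ht', rfl⟩ | ⟨j', s, hs, rfl⟩
    · rw [ray_fst ht'] at h
      obtain ⟨rfl, rfl⟩ := single_eq_single ht0 h.symm
      exact Or.inl ⟨t, ht, rfl⟩
    · rw [circ_fst] at h
      obtain ⟨h1, rfl⟩ := single_eq_single ht0 h.symm
      refine Or.inr ⟨s, hs, ?_⟩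
      have h2 : j.2 < j'.2 + 1 := by
        have : (j.2 : ℝ) < j'.2 + 1 := by linarith [ht.1]
        exact_mod_cast this
      have h3 : j'.2 < j.2 + 1 := by
        have : (j'.2 : ℝ) < j.2 + 1 := by linarith [ht.2]
        exact_mod_cast this
      rw [show j = j' from Prod.ext h1 (by omega)]
  · rintro (⟨t, ht, rfl⟩ | ⟨s, hs, rfl⟩)
    · exact ⟨t, ht, ray_fst (by linarith [ht.1])⟩
    · exact ⟨_, ⟨by linarith, by linarith⟩, circ_fst j s⟩

/-- The inner end point of a piece also belongs to its neighbour, so a piece outside a suited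
subgraph may touch it there and lies only in the closure of the complement. -/
theorem piece_subset_closure (j : Fin r × ℕ) :
    piece j ⊆ closure {p : Gam r | ∃ t > (j.2 : ℝ) + 1 / 2, p.1.1 = Pi.single j.1 t} := by
  intro p hp
  have hj : (0 : ℝ) ≤ j.2 := by positivity
  rcases mem_piece_iff.1 hp with ⟨t, ht, rfl⟩ | ⟨s, hs, rfl⟩
  · have h1 : t ∈ closure (Ioi ((j.2 : ℝ) + 1 / 2)) := by
      rw [closure_Ioi]
      exact ht.1
    refine closure_mono ?_ (image_closure_subset_closure_image (continuous_ray j.1) ⟨t, h1, rfl⟩)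
    rintro _ ⟨t', ht', rfl⟩
    have ht'' : (j.2 : ℝ) + 1 / 2 < t' := ht'
    exact ⟨t', ht', ray_fst (by linarith)⟩
  · exact subset_closure ⟨_, by linarith, circ_fst j s⟩

theorem piece_subset_closure_compl_ball {N : Fin r → ℕ} {j : Fin r × ℕ} (h : N j.1 ≤ j.2) :
    piece j ⊆ closure (ball N)ᶜ := by
  refine (piece_subset_closure j).trans (closure_mono ?_)
  rintro p ⟨t, ht, hp⟩ hb
  have h1 := (mem_ball_of_single hp).1 hb
  have h2 : (N j.1 : ℝ) ≤ j.2 := by exact_mod_cast h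
  linarith

theorem le_of_piece_subset {N : Fin r → ℕ} {j : Fin r × ℕ} (h : piece j ⊆ closure (ball N)ᶜ) :
    N j.1 ≤ j.2 := by
  by_contra! hlt
  have h1 : circ j 0 ∈ piece j := mem_piece_iff.2 (Or.inr ⟨0, by norm_num, rfl⟩)
  obtain ⟨p, hp, hpc⟩ := mem_closure_iff.1 (h h1) {p : Gam r | ∀ i, p.1.1 i < N i + 1 / 2} (by
      have : {p : Gam r | ∀ i, p.1.1 i < N i + 1 / 2} =
          ⋂ i, {p : Gam r | p.1.1 i < N i + 1 / 2} := by
        ext p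
        simp
      rw [this]
      exact isOpen_iInter_of_finite fun i => isOpen_lt (by fun_prop) continuous_const) (by
      intro i
      rw [circ_fst]
      by_cases hi : i = j.1
      · subst hi
        have : (j.2 : ℝ) + 1 ≤ N j.1 := by exact_mod_cast hlt
        rw [Pi.single_eq_same]
        linarith
      · rw [Pi.single_eq_of_ne hi]
        positivity)
  exact hpc fun i => (hp i).le

theorem unmark_mark_ray {j j' : Fin r × ℕ} {t : ℝ} (ht : (j.2 : ℝ) + 1 / 2 ≤ t) :
    unmark j' (mark j (ray j.1 t)) = (ray j'.1 (t - j.2 + j'.2)).1 := by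
  have hj : (0 : ℝ) ≤ j.2 := by positivity
  have hj' : (0 : ℝ) ≤ j'.2 := by positivity
  refine Prod.ext ?_ rfl
  rw [ray_fst (by linarith)]
  simp only [unmark, mark, ray_fst (show 0 ≤ t by linarith), Pi.single_eq_same]
  congr 1
  ring

theorem unmark_mark_circ {j j' : Fin r × ℕ} {s : ℝ} :
    unmark j' (mark j (circ j s)) = (circ j' s).1 := by
  refine Prod.ext ?_ rfl
  simp [unmark, mark, circ_fst]

end Balls

/-! ### Maps with prescribed paths near the core and translations outside -/

section Construction

open FreeGroup (of lift lift_apply_of)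

variable {r : ℕ}

/-- The path along the half-line `i` from the core vertex. -/
noncomputable def stem (i₀ i : Fin r) (t : ℝ) : Path (ray i₀ 0) (ray i t) :=
  ((Path.segment 0 t).map (continuous_ray i)).cast (ray_zero i₀ i) rfl

theorem word_stem (i₀ i : Fin r) (t : ℝ) : (word r).toFun (stem i₀ i t) = 1 :=
  ((word r).map_cast _ _ _).trans (word_ray i 0 t)

theorem stem_apply (i₀ i : Fin r) (t : ℝ) (s : unitInterval) :
    stem i₀ i t s = ray i (s * t) := by
  simp [stem, AffineMap.lineMap_apply]

theorem stem_mem_ball {K : Fin r → ℕ} (i₀ : Fin r) {i : Fin r} {t : ℝ} (ht0 : 0 ≤ t)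
    (ht : t ≤ K i + 1 / 2) (s : unitInterval) : stem i₀ i t s ∈ ball K := by
  have h0 := s.2.1
  have h1 := s.2.2
  rw [stem_apply, ray_mem_ball (by positivity)]
  nlinarith

/-- The path around the circle `j`. -/
noncomputable def loop (j : Fin r × ℕ) :
    Path (ray j.1 ((j.2 : ℝ) + 1)) (ray j.1 ((j.2 : ℝ) + 1)) :=
  ((Path.segment 0 1).map (continuous_circ j)).cast (circ_zero j).symm (circ_one j).symm

theorem word_loop (j : Fin r × ℕ) : (word r).toFun (loop j) = of j :=
  ((word r).map_cast _ _ _).trans (word_circ j)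

theorem loop_apply (j : Fin r × ℕ) (s : unitInterval) : loop j s = circ j s := by
  simp [loop, AffineMap.lineMap_apply]

theorem trans_mem {X : Type*} [TopologicalSpace X] {x y z : X} {p : Path x y} {q : Path y z}
    {S : Set X} (hp : ∀ t, p t ∈ S) (hq : ∀ t, q t ∈ S) (t : unitInterval) : p.trans q t ∈ S := by
  rw [Path.trans_apply]
  split
  · exact hp _
  · exact hq _

theorem exists_path_in_ball (i₀ : Fin r) {K : Fin r → ℕ} {w : FreeGroup (Fin r × ℕ)}
    (hw : w ∈ avoiding {j | K j.1 ≤ j.2}) :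
    ∃ p : Path (ray i₀ 0) (ray i₀ 0), (word r).toFun p = w ∧ ∀ t, p t ∈ ball K := by
  induction hw using avoiding_induction with
  | hof j hj =>
    have hj' : j.2 < K j.1 := not_le.1 hj
    have hj'' : (j.2 : ℝ) + 1 ≤ K j.1 := by exact_mod_cast hj'
    have hs := stem_mem_ball (K := K) i₀ (i := j.1) (t := j.2 + 1) (by positivity) (by linarith)
    refine ⟨((stem i₀ j.1 (j.2 + 1)).trans (loop j)).trans (stem i₀ j.1 (j.2 + 1)).symm, ?_, ?_⟩
    · rw [(word r).map_trans, (word r).map_trans, (word r).map_symm, word_stem, word_loop]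
      simp
    · refine trans_mem (trans_mem hs fun t => ?_) fun t => hs _
      rw [loop_apply]
      exact circ_mem_ball.2 hj'
  | hone => exact ⟨Path.refl _, (word r).map_refl _, fun t => (ray_mem_ball le_rfl).2 (by positivity)⟩
  | hmul v w _ _ hv hw =>
    obtain ⟨p, hp, hp'⟩ := hv
    obtain ⟨q, hq, hq'⟩ := hw
    exact ⟨p.trans q, by rw [(word r).map_trans, hp, hq], trans_mem hp' hq'⟩
  | hinv v _ hv =>
    obtain ⟨p, hp, hp'⟩ := hv
    exact ⟨p.symm, by rw [(word r).map_symm, hp], fun t => hp' _⟩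

/-- Going out along stems and circles and back again sweeps out the ball with trivial word. Inserted
into the image of a ray, it makes the image of a ball fill a ball without changing the induced
automorphism. -/
theorem exists_cover_path (i₀ : Fin r) (K : Fin r → ℕ) :
    ∃ p : Path (ray i₀ 0) (ray i₀ 0), (word r).toFun p = 1 ∧ range p = ball K := by
  let Reach : Set (Gam r) → Prop := fun A => ∃ p : Path (ray i₀ 0) (ray i₀ 0),
    (word r).toFun p = 1 ∧ range p ⊆ ball K ∧ A ⊆ range p
  have hpath : ∀ {y} (q : Path (ray i₀ 0) y), range q ⊆ ball K → Reach (range q) := by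
    intro y q hq
    refine ⟨q.trans q.symm, ?_, ?_, ?_⟩
    · rw [(word r).map_trans, (word r).map_symm, mul_inv_cancel]
    · rw [Path.trans_range, Path.symm_range]
      exact union_subset hq hq
    · rw [Path.trans_range]
      exact subset_union_left
  have hunion : ∀ {ι : Type} {s : Set ι} (_ : s.Finite) {A : ι → Set (Gam r)},
      (∀ a ∈ s, Reach (A a)) → Reach (⋃ a ∈ s, A a) := by
    intro ι s hs A
    induction s, hs using Set.Finite.induction_on with
    | empty =>
      intro _
      refine ⟨Path.refl _, (word r).map_refl _, ?_, by simp⟩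
      rw [Path.refl_range, singleton_subset_iff]
      exact (ray_mem_ball le_rfl).2 (by positivity)
    | insert ha hs ih =>
      intro h
      obtain ⟨p, h1, h2, h3⟩ := ih fun b hb => h b (mem_insert_of_mem _ hb)
      obtain ⟨q, h4, h5, h6⟩ := h _ (mem_insert _ _)
      refine ⟨q.trans p, by rw [(word r).map_trans, h1, h4, one_mul], ?_, ?_⟩
      · rw [Path.trans_range]
        exact union_subset h5 h2
      · rw [Path.trans_range, biUnion_insert]
        exact union_subset_union h6 h3
  have hr : Reach (⋃ i ∈ (univ : Set (Fin r)), range (stem i₀ i (K i + 1 / 2))) := by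
    refine hunion Set.finite_univ fun i _ => hpath _ ?_
    rintro _ ⟨s, rfl⟩
    exact stem_mem_ball i₀ (by positivity) le_rfl s
  have hc : Reach (⋃ j ∈ {j : Fin r × ℕ | j.2 < K j.1},
      range ((stem i₀ j.1 (j.2 + 1)).trans (loop j))) := by
    refine hunion (finite_ball_index K) fun j hj => hpath _ ?_
    rintro _ ⟨s, rfl⟩
    have hj'' : (j.2 : ℝ) + 1 ≤ K j.1 := by exact_mod_cast (show j.2 < K j.1 from hj)
    refine trans_mem (stem_mem_ball i₀ (by positivity) (by linarith)) (fun t => ?_) s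
    rw [loop_apply]
    exact circ_mem_ball.2 hj
  obtain ⟨p, h1, h2, h3⟩ := hr
  obtain ⟨q, h4, h5, h6⟩ := hc
  refine ⟨p.trans q, by rw [(word r).map_trans, h1, h4, one_mul], ?_⟩
  rw [Path.trans_range]
  refine (union_subset h2 h5).antisymm fun x hx => ?_
  rcases gam_cases x with ⟨i, t, ht, rfl⟩ | ⟨⟨i, n⟩, s, hs, rfl⟩
  · refine Or.inl (h3 (mem_biUnion (mem_univ i) ?_))
    have h7 := (ray_mem_ball ht).1 hx
    have h8 : (0 : ℝ) < K i + 1 / 2 := by positivity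
    refine ⟨⟨t / (K i + 1 / 2), by positivity, (div_le_one h8).2 h7⟩, ?_⟩
    rw [stem_apply]
    congr 1
    exact div_mul_cancel₀ _ h8.ne'
  · refine Or.inr (h6 (mem_biUnion (x := (i, n)) (circ_mem_ball.1 hx) ?_))
    rw [Path.trans_range]
    exact Or.inr ⟨⟨s, hs.1, hs.2.le⟩, loop_apply _ _⟩

theorem circ_fract (j : Fin r × ℕ) (s : ℝ) : circ j s = circ j (Int.fract s) := by
  conv_lhs => rw [← Int.fract_add_floor s, circ_add_int]

/-- A map which sends the core and the first pieces to a ball by prescribed paths and translates the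
other pieces. -/
theorem exists_tail_translation (i₀ : Fin r) (σ : Fin r → Fin r) (N k : Fin r → ℕ)
    (P : ∀ i, Path (ray i₀ 0) (ray (σ i) (k i + 1 / 2)))
    (L : Fin r × ℕ → Path (ray i₀ 0) (ray i₀ 0)) :
    ∃ f : C(Gam r, Gam r), TailRigid f σ N k ∧
      (∀ i (t : ℝ), 0 ≤ t → t ≤ N i → f (ray i t) = ray i₀ 0) ∧
      (∀ i (s : unitInterval), f (ray i (N i + s)) = (P i).trans ((Path.segment (k i + 1 / 2 : ℝ)
        (k i + 1)).map (continuous_ray (σ i))) s) ∧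
      ∀ i n (s : unitInterval), n < N i → f (circ (i, n) s) = L (i, n) s := by
  let E : ∀ i, Path (ray i₀ 0) (ray (σ i) (k i + 1)) := fun i =>
    (P i).trans ((Path.segment (k i + 1 / 2 : ℝ) (k i + 1)).map (continuous_ray (σ i)))
  let v : Fin r → ℕ → Gam r := fun i n =>
    if n ≤ N i then ray i₀ 0 else ray (σ i) ((n : ℝ) - N i + k i)
  let e : Fin r × ℕ → C(unitInterval, Gam r) := fun j =>
    if j.2 < N j.1 then ContinuousMap.const _ (ray i₀ 0) else
      if j.2 = N j.1 then (E j.1).toContinuousMap else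
        ⟨fun s => ray (σ j.1) ((j.2 : ℝ) - N j.1 + k j.1 + s),
          (continuous_ray (σ j.1)).comp (by fun_prop)⟩
  let c : Fin r × ℕ → C(unitInterval, Gam r) := fun j =>
    if j.2 < N j.1 then (L j).toContinuousMap else
      ⟨fun s => circ (σ j.1, k j.1 + (j.2 - N j.1)) s, (continuous_circ _).comp (by fun_prop)⟩
  have hv : ∀ i n, n ≤ N i → v i n = ray i₀ 0 := fun i n h => if_pos h
  have hv' : ∀ i n, N i < n → v i n = ray (σ i) ((n : ℝ) - N i + k i) := fun i n h =>
    if_neg (not_le.2 h)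
  have he : ∀ i n s, n < N i → e (i, n) s = ray i₀ 0 := fun i n s h => by
    simp only [e]
    rw [if_pos h]
    rfl
  have heN : ∀ i s, e (i, N i) s = E i s := fun i s => by
    change (if N i < N i then _ else if N i = N i then _ else _ : C(unitInterval, Gam r)) s = _
    rw [if_neg (lt_irrefl _), if_pos rfl]
    rfl
  have he' : ∀ i n s, N i < n → e (i, n) s = ray (σ i) ((n : ℝ) - N i + k i + s) :=
    fun i n s h => by
    simp only [e]
    rw [if_neg (not_lt.2 h.le), if_neg h.ne']
    rfl
  have hc : ∀ i n s, n < N i → c (i, n) s = L (i, n) s := fun i n s h => by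
    simp only [c]
    rw [if_pos h]
    rfl
  have hc' : ∀ i m s, c (i, N i + m) s = circ (σ i, k i + m) s := fun i m s => by
    simp only [c]
    rw [if_neg (by simp), Nat.add_sub_cancel_left]
    rfl
  obtain ⟨f, h1, h2⟩ := exists_glue v e c
    (fun i i' => by rw [hv i 0 (Nat.zero_le _), hv i' 0 (Nat.zero_le _)])
    (fun ⟨i, n⟩ => by
      rcases lt_trichotomy n (N i) with h | rfl | h
      · rw [he i n _ h, hv i n h.le]
      · rw [heN, hv i _ le_rfl, (E i).source]
      · rw [he' i n _ h, hv' i n h]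
        simp)
    (fun ⟨i, n⟩ => by
      rcases lt_trichotomy n (N i) with h | rfl | h
      · rw [he i n _ h, hv i (n + 1) h]
      · rw [heN, hv' i _ (Nat.lt_succ_self _), (E i).target]
        congr 1
        push_cast
        ring
      · rw [he' i n _ h, hv' i (n + 1) (by omega)]
        congr 1
        push_cast
        ring)
    (fun ⟨i, n⟩ => by
      rcases lt_or_ge n (N i) with h | h
      · rw [hc i n _ h, hv i (n + 1) h, Path.source]
      · obtain ⟨m, rfl⟩ := Nat.exists_eq_add_of_le h
        rw [hc', hv' i _ (by omega)]
        refine (circ_zero _).trans ?_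
        congr 1
        push_cast
        ring)
    (fun ⟨i, n⟩ => by
      rcases lt_or_ge n (N i) with h | h
      · rw [hc i n _ h, hv i (n + 1) h, Path.target]
      · obtain ⟨m, rfl⟩ := Nat.exists_eq_add_of_le h
        rw [hc', hv' i _ (by omega)]
        refine (circ_one _).trans ?_
        congr 1
        push_cast
        ring)
  have hN : ∀ i (s : unitInterval), f (ray i (N i + s)) = E i s := fun i s =>
    (h1 (i, N i) s).trans (heN i s)
  have hfloor : ∀ i t, 0 ≤ t → ∃ s : unitInterval, (⌊t⌋₊ : ℝ) + s = t ∧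
      f (ray i t) = e (i, ⌊t⌋₊) s := fun i t ht => by
    refine ⟨⟨t - ⌊t⌋₊, by linarith [Nat.floor_le ht], by linarith [Nat.lt_floor_add_one t]⟩,
      by simp, ?_⟩
    rw [← h1]
    simp
  refine ⟨f, ⟨fun i t ht => ?_, fun i m s => ?_⟩, fun i t ht0 ht => ?_, hN,
    fun i n s h => (h2 (i, n) s).trans (hc i n s h)⟩
  · have hNi : (0 : ℝ) ≤ N i := by positivity
    by_cases h : t ≤ N i + 1
    · have h3 := hN i ⟨t - N i, by linarith, by linarith⟩
      simp only [add_sub_cancel] at h3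
      rw [h3, ← Path.extend_extends' (E i), Path.extend_trans_of_half_le _ _ (by
        simp only
        linarith)]
      simp only
      rw [Path.extend_apply _ ⟨by linarith, by linarith⟩]
      simp only [Path.map_coe, Function.comp_apply, Path.segment_apply, AffineMap.lineMap_apply,
        vsub_eq_sub, smul_eq_mul, vadd_eq_add]
      congr 1
      ring
    · obtain ⟨s, hs, h3⟩ := hfloor i t (by linarith)
      have h4 : N i < ⌊t⌋₊ := Nat.lt_of_succ_le (Nat.le_floor (by push_cast; linarith))
      rw [h3, he' i _ _ h4]
      congr 1
      linarith
  · rw [circ_fract, circ_fract (σ i, k i + m)]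
    exact (h2 (i, N i + m) ⟨_, Int.fract_nonneg s, (Int.fract_lt_one s).le⟩).trans (hc' i m _)
  · rcases lt_or_eq_of_le ht with h | h
    · obtain ⟨s, hs, h3⟩ := hfloor i t ht0
      rw [h3, he i _ _ ((Nat.floor_lt ht0).2 h)]
    · have := hN i 0
      simp only [Set.Icc.coe_zero, add_zero, Path.source] at this
      rw [h, this]

end Construction

/-! ### Realizing rigid automorphisms by maps -/

section Existence

open FreeGroup (of lift lift_apply_of)

variable {r : ℕ} {ψ : MulAut (FreeGroup (Fin r × ℕ))} {σ : Equiv.Perm (Fin r)} {N k : Fin r → ℕ}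
  {g : Fin r → FreeGroup (Fin r × ℕ)}

/-- The hypotheses keep all prescribed words inside the target ball. The early circles trace the
images of their letters, and on each ray the half segment before the tail traces the conjugator. -/
theorem exists_represents_of_avoiding (i₀ : Fin r) (h : IsRigid ψ σ N k g)
    (hg : ∀ i, g i ∈ avoiding {j | k (σ⁻¹ j.1) ≤ j.2})
    (hψ : ∀ j, j.2 < N j.1 → ψ (of j) ∈ avoiding {j | k (σ⁻¹ j.1) ≤ j.2}) :
    ∃ f, Represents f ψ σ N k ∧ f '' ball N = ball fun i => k (σ⁻¹ i) := by
  classical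
  let K : Fin r → ℕ := fun i => k (σ⁻¹ i)
  have hK : ∀ i, K (σ i) = k i := fun i => by simp [K]
  obtain ⟨c, hc, hcr⟩ := exists_cover_path i₀ K
  choose q hq hqb using fun i => exists_path_in_ball i₀ (K := K) (hg i)
  have hL : ∀ j : Fin r × ℕ, ∃ p : Path (ray i₀ 0) (ray i₀ 0), j.2 < N j.1 →
      (word r).toFun p = ψ (of j) ∧ ∀ t, p t ∈ ball K := fun j => by
    by_cases hj : j.2 < N j.1
    · obtain ⟨p, hp⟩ := exists_path_in_ball i₀ (K := K) (hψ j hj)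
      exact ⟨p, fun _ => hp⟩
    · exact ⟨Path.refl _, fun h => absurd h hj⟩
  choose L hL using hL
  -- The sweep `c` provides surjectivity onto the ball, `q i` the conjugator, and the stem leads to
  -- the start of the image tail.
  let P : ∀ i, Path (ray i₀ 0) (ray (σ i) (k i + 1 / 2)) := fun i =>
    (c.trans (q i)).trans (stem i₀ (σ i) (k i + 1 / 2))
  have hPw : ∀ i, (word r).toFun (P i) = g i := fun i => by
    rw [(word r).map_trans, (word r).map_trans, hc, hq, word_stem, one_mul, mul_one]
  have hPb : ∀ i t, P i t ∈ ball K := fun i =>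
    trans_mem (trans_mem (fun t => hcr ▸ mem_range_self t) (hqb i))
      (stem_mem_ball i₀ (by positivity) (by rw [hK]))
  obtain ⟨f, hf, hf0, hfN, hfc⟩ := exists_tail_translation i₀ σ N k P L
  have hb : ∀ i, f (ray i 0) = ray i₀ 0 := fun i => hf0 i 0 le_rfl (by positivity)
  have hhalf : ∀ i (s : unitInterval), f (ray i (N i + s / 2)) = P i s := fun i s => by
    have h1 := hfN i ⟨s / 2, by linarith [s.2.1], by linarith [s.2.2]⟩
    rw [h1, Path.trans_apply, dif_pos (by linarith [s.2.2])]
    congr 1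
    exact Subtype.ext (by simp; ring)
  refine ⟨f, ⟨hf, ?_⟩, ?_⟩
  · obtain ⟨φ, a, ha⟩ := exists_realizes i₀ f
    have hstem : ∀ i t, a (ray i t) = a (ray i₀ 0) *
        ((word r).comap f).arc (continuous_ray i) 0 t := fun i t => by
      have h1 := ha ((Path.segment 0 t).map (continuous_ray i))
      rw [show (word r).toFun ((Path.segment 0 t).map (continuous_ray i)) = 1 from word_ray i 0 t,
        map_one, mul_one] at h1
      rw [PathHom.arc, PathHom.comap_apply, h1, congrArg a (ray_zero i i₀)]
      group
    have hconst : ∀ i (t : ℝ), 0 ≤ t → t ≤ N i →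
        ((word r).comap f).arc (continuous_ray i) 0 t = 1 := fun i t ht0 ht => by
      rw [← (word r).map_refl (ray i₀ 0)]
      refine (word r).congr fun s => ?_
      have h0 := s.2.1
      have h1 := s.2.2
      simp only [Path.map_coe, Function.comp_apply, Path.segment_apply, AffineMap.lineMap_apply,
        vsub_eq_sub, smul_eq_mul, vadd_eq_add, sub_zero, add_zero, Path.refl_apply]
      exact hf0 i _ (by positivity) (by nlinarith)
    -- Early circles are joined to the core vertex by stems on which `f` is constant; for the later
    -- ones, the image of the stem to the first tail vertex has word `g i`.
    have hletter : ∀ j, φ (of j) = a (ray i₀ 0) * ψ (of j) * (a (ray i₀ 0))⁻¹ := by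
      rintro ⟨i, n⟩
      rcases lt_or_ge n (N i) with hn | hn
      · have hn' : (n : ℝ) + 1 ≤ N i := by exact_mod_cast hn
        have h1 := ha (loop (i, n))
        rw [word_loop] at h1
        simp only at h1
        rw [hstem, hconst i _ (by positivity) hn', mul_one] at h1
        have h2 : (word r).toFun ((loop (i, n)).map f.continuous) = ψ (of (i, n)) := by
          rw [← (hL (i, n) hn).1]
          refine (word r).congr fun t => ?_
          rw [Path.map_coe, Function.comp_apply, loop_apply]
          exact hfc i n t hn
        rw [← h2, h1]
        group
      · obtain ⟨m, rfl⟩ := Nat.exists_eq_add_of_le hn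
        have h2 : ((word r).comap f).arc (continuous_ray i) 0 (N i + 1) = g i := by
          rw [← PathHom.arc_mul _ _ 0 (N i) (N i + 1), hconst i _ (by positivity) le_rfl, one_mul,
            ← hPw i]
          have h3 : (word r).toFun ((P i).trans ((Path.segment (k i + 1 / 2 : ℝ) (k i + 1)).map
              (continuous_ray (σ i)))) = (word r).toFun (P i) := by
            rw [(word r).map_trans]
            exact mul_eq_left.2 (word_ray _ _ _)
          rw [← h3]
          refine (word r).congr fun s => ?_
          rw [← hfN]
          simp [AffineMap.lineMap_apply, add_comm]
        rw [hf.conj_eq ha, hstem, h2, h i m]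
        group
    convert (show Realizes f φ from ⟨a, ha⟩).conj (a (ray i₀ 0))⁻¹ using 1
    refine FreeGroup.ext_hom _ _ fun j => ?_
    change ψ (of j) = MulAut.conj (a (ray i₀ 0))⁻¹ (φ (of j))
    rw [hletter, MulAut.conj_apply]
    group
  · refine Subset.antisymm ?_ fun x hx => ?_
    · rintro _ ⟨x, hx, rfl⟩
      rcases gam_cases x with ⟨i, t, ht, rfl⟩ | ⟨⟨i, n⟩, s, hs, rfl⟩
      · rcases le_or_gt t (N i) with htN | htN
        · rw [hf0 i t ht htN]
          exact (ray_mem_ball le_rfl).2 (by positivity)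
        · have h1 := (ray_mem_ball ht).1 hx
          have h2 := hhalf i ⟨2 * (t - N i), by linarith, by linarith⟩
          rw [show (N i : ℝ) + 2 * (t - N i) / 2 = t by ring] at h2
          rw [h2]
          exact hPb i _
      · have hn := circ_mem_ball.1 hx
        rw [hfc i n ⟨s, hs.1, hs.2.le⟩ hn]
        exact (hL (i, n) hn).2 _
    · have h1 : x ∈ range (P i₀) := by
        rw [Path.trans_range, Path.trans_range]
        exact Or.inl (Or.inl (hcr.symm ▸ hx))
      obtain ⟨s, rfl⟩ := h1
      refine ⟨_, ?_, hhalf i₀ s⟩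
      rw [ray_mem_ball (by have := s.2.1; positivity)]
      linarith [s.2.2]

/-- Every rigid automorphism is represented by a map which sends a ball onto a ball. -/
theorem IsRigid.exists_represents (i₀ : Fin r) (h : IsRigid ψ σ N k g) :
    ∃ f N k, Represents f ψ σ N k ∧ f '' ball N = ball fun i => k (σ⁻¹ i) := by
  classical
  -- Enlarging both balls by `M` makes the conjugators and the images of the early letters fit into
  -- the target ball; the letters newly included follow the rigid formula.
  obtain ⟨M, hM⟩ := exists_bound_letters
    (Finset.univ.image g ∪ (finite_ball_index N).toFinset.image fun j => ψ (of j))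
  have hle : avoiding (tails r M) ≤ avoiding {j : Fin r × ℕ | k (σ⁻¹ j.1) + M ≤ j.2} :=
    avoiding_anti fun j hj => (Nat.le_add_left M _).trans hj
  have hgM : ∀ i, g i ∈ avoiding {j : Fin r × ℕ | k (σ⁻¹ j.1) + M ≤ j.2} := fun i =>
    hle (hM _ (by simp))
  obtain ⟨f, hf⟩ := exists_represents_of_avoiding i₀ (h.shift fun _ => M) hgM fun ⟨i, n⟩ hn => by
    rcases lt_or_ge n (N i) with hn' | hn'
    · exact hle (hM _ (Finset.mem_union_right _ (Finset.mem_image_of_mem _ (by simpa using hn'))))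
    · obtain ⟨m, rfl⟩ := Nat.exists_eq_add_of_le hn'
      rw [h i m]
      refine mul_mem (mul_mem (hgM i) (of_mem_avoiding fun hj => ?_)) (inv_mem (hgM i))
      replace hj : k (σ⁻¹ (σ i)) + M ≤ k i + m := hj
      rw [show σ⁻¹ (σ i) = i from Equiv.symm_apply_apply σ i] at hj
      simp only at hn
      omega
  exact ⟨f, _, _, hf⟩

end Existence

/-! ### Balls as defining graphs -/

section DefiningGraph

open FreeGroup (of lift lift_apply_of)

theorem properlyHomotopic_of_compactSpace {X Y : Type*} [TopologicalSpace X] [TopologicalSpace Y]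
    [CompactSpace X] [T2Space Y] {f g : C(X, Y)} (h : f.Homotopic g) : ProperlyHomotopic f g := by
  obtain ⟨H⟩ := h
  exact ⟨H, H.continuous.isProperMap⟩

variable {r : ℕ} {f : C(Gam r, Gam r)} {σ : Equiv.Perm (Fin r)} {N k : Fin r → ℕ}

theorem TailRigid.map_ret (hf : TailRigid f σ N k)
    (hb : f '' ball N = ball fun i => k (σ⁻¹ i)) (x : Gam r) :
    f (ret N x) = ret (fun i => k (σ⁻¹ i)) (f x) := by
  have hσ : ∀ i, σ⁻¹ (σ i) = i := Equiv.symm_apply_apply σ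
  by_cases hx : x ∈ ball N
  · rw [ret_of_mem hx, ret_of_mem (hb ▸ mem_image_of_mem f hx)]
  · rcases gam_cases x with ⟨i, t, ht, rfl⟩ | ⟨⟨i, n⟩, s, hs, rfl⟩
    · rw [ray_mem_ball ht, not_le] at hx
      have h0 : (0 : ℝ) ≤ k i := by positivity
      rw [ret_ray ht, min_eq_right hx.le, hf.map_ray i _ le_rfl, hf.map_ray i _ hx.le,
        ret_ray (by linarith), hσ, min_eq_right (by linarith)]
      congr 1
      ring
    · rw [circ_mem_ball, not_lt] at hx
      obtain ⟨m, rfl⟩ := Nat.exists_eq_add_of_le hx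
      rw [ret_circ_of_le hx, hf.map_ray i _ le_rfl, hf.map_circ, ret_circ_of_le (by simp [hσ]), hσ]
      congr 1
      ring

/-- The retractions commute with `f`, so a homotopy inverse of `f` and both homotopies can be
retracted into the balls. Properness is automatic by compactness. -/
theorem TailRigid.isProperHomotopyEquiv_restrictToImage (hf : TailRigid f σ N k)
    (hb : f '' ball N = ball fun i => k (σ⁻¹ i)) {f' : C(Gam r, Gam r)}
    (h : (f'.comp f).Homotopic (ContinuousMap.id _)) (h' : (f.comp f').Homotopic (ContinuousMap.id _)) :
    IsProperHomotopyEquiv (restrictToImage f (ball N)) := by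
  have hc : CompactSpace (ball N) := isCompact_iff_compactSpace.1 (isCompact_ball N)
  have hc' : CompactSpace (f '' ball N) :=
    isCompact_iff_compactSpace.1 ((isCompact_ball N).image f.continuous)
  obtain ⟨H⟩ := h
  obtain ⟨H'⟩ := h'
  let G : C(f '' ball N, ball N) :=
    ⟨fun y => ⟨ret N (f' y), ret_mem _ _⟩, by fun_prop⟩
  refine ⟨(restrictToImage f _).continuous.isProperMap, G, G.continuous.isProperMap,
    properlyHomotopic_of_compactSpace ⟨?_⟩, properlyHomotopic_of_compactSpace ⟨?_⟩⟩
  · exact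
      { toFun := fun p => ⟨ret N (H (p.1, p.2)), ret_mem _ _⟩
        continuous_toFun := by fun_prop
        map_zero_left := fun x => Subtype.ext (by simp [G, restrictToImage])
        map_one_left := fun x => Subtype.ext (by simp [ret_of_mem x.2]) }
  · have hmem : ∀ x, ret (fun i => k (σ⁻¹ i)) x ∈ f '' ball N := fun x => hb ▸ ret_mem _ x
    exact
      { toFun := fun p => ⟨ret _ (H' (p.1, p.2)), hmem _⟩
        continuous_toFun := by fun_prop
        map_zero_left := fun x => Subtype.ext (by
          simp [G, restrictToImage, hf.map_ret hb])
        map_one_left := fun x => Subtype.ext (by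
          have hx : (x : Gam r) ∈ ball fun i => k (σ⁻¹ i) := hb ▸ x.2
          simpa using ret_of_mem hx) }

theorem TailRigid.image_piece {σ : Fin r → Fin r} (hf : TailRigid f σ N k) (i : Fin r) (m : ℕ) :
    f '' piece (i, N i + m) = piece (σ i, k i + m) ∧
      ∀ p ∈ piece (i, N i + m), (f p).1 = unmark (σ i, k i + m) (mark (i, N i + m) p) := by
  have hray : ∀ t : ℝ, ((N i + m : ℕ) : ℝ) + 1 / 2 ≤ t →
      f (ray i t) = ray (σ i) (t - (N i + m : ℕ) + (k i + m : ℕ)) := fun t ht => by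
    push_cast at ht ⊢
    have : (0 : ℝ) ≤ m := by positivity
    rw [hf.map_ray i t (by linarith)]
    congr 1
    ring
  constructor
  · ext p
    rw [mem_piece_iff]
    constructor
    · rintro ⟨x, hx, rfl⟩
      rcases mem_piece_iff.1 hx with ⟨t, ht, rfl⟩ | ⟨s, hs, rfl⟩
      · exact Or.inl ⟨_, ⟨by linarith [ht.1], by linarith [ht.2]⟩, hray t ht.1⟩
      · exact Or.inr ⟨s, hs, hf.map_circ i m s⟩
    · rintro (⟨t, ht, rfl⟩ | ⟨s, hs, rfl⟩)
      · have h1 : ((N i + m : ℕ) : ℝ) + 1 / 2 ≤ t - (k i + m : ℕ) + (N i + m : ℕ) := by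
          linarith [ht.1]
        refine ⟨_, mem_piece_iff.2 (Or.inl ⟨_, ⟨h1, by linarith [ht.2]⟩, rfl⟩), ?_⟩
        rw [hray _ h1]
        congr 1
        ring
      · exact ⟨_, mem_piece_iff.2 (Or.inr ⟨s, hs, rfl⟩), hf.map_circ i m s⟩
  · intro p hp
    rcases mem_piece_iff.1 hp with ⟨t, ht, rfl⟩ | ⟨s, hs, rfl⟩
    · rw [hray t ht.1, unmark_mark_ray ht.1]
    · rw [hf.map_circ, unmark_mark_circ]

theorem TailRigid.isDefiningGraph (i₀ : Fin r) (hf : TailRigid f σ N k)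
    (hb : f '' ball N = ball fun i => k (σ⁻¹ i)) {f' : C(Gam r, Gam r)}
    (h : (f'.comp f).Homotopic (ContinuousMap.id _))
    (h' : (f.comp f').Homotopic (ContinuousMap.id _)) : IsDefiningGraph f (ball N) := by
  refine ⟨isSuited_ball i₀ N, hf.isProperHomotopyEquiv_restrictToImage hb h h',
    hb ▸ isSuited_ball i₀ _, fun ⟨i, n⟩ hj => ?_⟩
  obtain ⟨m, rfl⟩ := Nat.exists_eq_add_of_le (show N i ≤ n from le_of_piece_subset hj)
  refine ⟨(σ i, k i + m), ?_, hf.image_piece i m⟩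
  rw [hb]
  refine piece_subset_closure_compl_ball ?_
  simp only
  rw [show σ⁻¹ (σ i) = i from Equiv.symm_apply_apply σ i]
  exact Nat.le_add_right _ _

theorem Represents.comp_properlyHomotopic_id {ψ : MulAut (FreeGroup (Fin r × ℕ))}
    {σ σ' : Fin r → Fin r} {N' k' : Fin r → ℕ} {f' : C(Gam r, Gam r)}
    (h : Represents f ψ σ N k) (h' : Represents f' ψ⁻¹ σ' N' k') :
    ProperlyHomotopic (f.comp f') (ContinuousMap.id _) := by
  have h1 := h.comp h'
  rw [mul_inv_cancel] at h1
  exact h1.properlyHomotopic Represents.id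

theorem Represents.isProperHomotopyEquiv {ψ : MulAut (FreeGroup (Fin r × ℕ))}
    {σ σ' : Fin r → Fin r} {N' k' : Fin r → ℕ} {f' : C(Gam r, Gam r)}
    (h : Represents f ψ σ N k) (h' : Represents f' ψ⁻¹ σ' N' k') : IsProperHomotopyEquiv f := by
  have h1 := h
  rw [← inv_inv ψ] at h1
  exact ⟨h.tailRigid.isProperMap, f', h'.tailRigid.isProperMap, h'.comp_properlyHomotopic_id h1,
    h.comp_properlyHomotopic_id h'⟩

/-- Every rigid automorphism is represented by an asymptotically rigid mapping class. -/
theorem IsRigid.exists_phe (i₀ : Fin r) {ψ : MulAut (FreeGroup (Fin r × ℕ))}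
    {g : Fin r → FreeGroup (Fin r × ℕ)} (h : IsRigid ψ σ N k g) :
    ∃ (f : PHE (Gam r)) (N k : Fin r → ℕ), Represents f.1 ψ σ N k ∧
      mapClass f ∈ asymptoticallyRigid r := by
  obtain ⟨f, N, k, hf, hb⟩ := h.exists_represents i₀
  obtain ⟨f', N', k', hf', -⟩ := h.inv.exists_represents i₀
  have h1 := hf.isProperHomotopyEquiv hf'
  have h2 := hf
  rw [← inv_inv ψ] at h2
  obtain ⟨H, -⟩ := hf'.comp_properlyHomotopic_id h2
  obtain ⟨H', -⟩ := hf.comp_properlyHomotopic_id hf'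
  exact ⟨⟨f, h1⟩, N, k, hf, ⟨f, h1⟩, rfl, _, hf.tailRigid.isDefiningGraph i₀ hb ⟨H⟩ ⟨H'⟩⟩

end DefiningGraph

/-! ### From asymptotically rigid maps to rigid automorphisms -/

section Converse

open FreeGroup (of lift lift_apply_of)

variable {r : ℕ} {f : C(Gam r, Gam r)}

theorem exists_pieces_subset_closure {Z : Set (Gam r)} (hZ : IsSuited Z) :
    ∃ M : ℕ, ∀ i n, M ≤ n → piece (i, n) ⊆ closure Zᶜ := by
  obtain ⟨-, F, rfl⟩ := hZ
  refine ⟨F.sup Prod.snd + 1, fun i n hn => (piece_subset_closure (i, n)).trans (closure_mono ?_)⟩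
  rintro p ⟨t, ht, hp⟩ hpZ
  have hn0 : (0 : ℝ) ≤ n := by positivity
  simp only at ht hp
  have ht0 : t ≠ 0 := by linarith
  rcases hpZ with ⟨i', t', ht', hp'⟩ | hpZ
  · obtain ⟨-, rfl⟩ := single_eq_single ht0 (hp.symm.trans hp')
    linarith [ht'.2]
  · simp only [mem_iUnion, exists_prop] at hpZ
    obtain ⟨j, hj, t', ht', hp'⟩ := hpZ
    obtain ⟨-, rfl⟩ := single_eq_single ht0 (hp.symm.trans hp')
    have h1 : j.2 + 1 ≤ n := (Nat.succ_le_succ (Finset.le_sup (f := Prod.snd) hj)).trans hn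
    have h2 : (j.2 : ℝ) + 1 ≤ n := by exact_mod_cast h1
    linarith [ht'.2]

theorem IsDefiningGraph.exists_tailRigid {Z : Set (Gam r)} (h : IsDefiningGraph f Z) :
    ∃ σ N k, TailRigid f σ N k := by
  obtain ⟨M, hM⟩ := exists_pieces_subset_closure h.1
  have hτ : ∀ i m, ∃ j : Fin r × ℕ,
      (∀ t ∈ Icc ((M + m : ℕ) + 1 / 2 : ℝ) ((M + m : ℕ) + 3 / 2),
        f (ray i t) = ray j.1 (t - (M + m : ℕ) + j.2)) ∧
      ∀ s, f (circ (i, M + m) s) = circ j s := fun i m => by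
    obtain ⟨j, -, -, hj⟩ := h.2.2.2 _ (hM i (M + m) (Nat.le_add_right _ _))
    refine ⟨j, fun t ht => Subtype.ext ?_, fun s => Subtype.ext ?_⟩
    · rw [hj _ (mem_piece_iff.2 (Or.inl ⟨t, ht, rfl⟩))]
      exact unmark_mark_ray (j := (i, M + m)) ht.1
    · rw [circ_fract, circ_fract j, hj _ (mem_piece_iff.2 (Or.inr
        ⟨_, ⟨Int.fract_nonneg s, Int.fract_lt_one s⟩, rfl⟩)), unmark_mark_circ]
  choose τ hτr hτc using hτ
  -- Consecutive pieces share an end point, so their images are consecutive pieces of one ray. Hence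
  -- the piecewise translations fit together.
  have hsucc : ∀ i m, τ i (m + 1) = ((τ i m).1, (τ i m).2 + 1) := fun i m => by
    have h1 := hτr i m ((M + m : ℕ) + 3 / 2) ⟨by linarith, le_rfl⟩
    have h2 := hτr i (m + 1) ((M + m : ℕ) + 3 / 2)
      ⟨by push_cast; linarith, by push_cast; linarith⟩
    have h3 : (0 : ℝ) ≤ (τ i m).2 := by positivity
    have h4 : (0 : ℝ) ≤ (τ i (m + 1)).2 := by positivity
    push_cast at h1 h2
    obtain ⟨h5, h6⟩ := ray_eq_ray (by linarith) (by linarith) (h1.symm.trans h2)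
    refine Prod.ext (h6.resolve_left fun h7 => ?_).symm ?_
    · linarith
    · have : ((τ i (m + 1)).2 : ℝ) = (τ i m).2 + 1 := by linarith
      exact_mod_cast this
  have hτm : ∀ i m, τ i m = ((τ i 0).1, (τ i 0).2 + m) := fun i m => by
    induction m with
    | zero => rfl
    | succ m ih => rw [hsucc, ih]; rfl
  refine ⟨fun i => (τ i 0).1, fun _ => M, fun i => (τ i 0).2, ⟨fun i t ht => ?_, fun i m s => ?_⟩⟩
  · have h0 : (0 : ℝ) ≤ M := by positivity
    have h1 : M ≤ ⌊t - 1 / 2⌋₊ := Nat.le_floor (by linarith)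
    obtain ⟨m, hm⟩ := Nat.exists_eq_add_of_le h1
    have h2 := Nat.floor_le (show 0 ≤ t - 1 / 2 by linarith)
    have h3 := Nat.lt_floor_add_one (t - 1 / 2)
    rw [hm] at h2 h3
    rw [hτr i m t ⟨by linarith, by linarith⟩, hτm]
    congr 1
    push_cast
    ring
  · rw [hτc, hτm]

/-- Homotopy equivalences induce automorphisms. -/
theorem PHE.exists_realizes (i₀ : Fin r) (f : PHE (Gam r)) :
    ∃ ψ : MulAut (FreeGroup (Fin r × ℕ)), Realizes f.1 ψ.toMonoidHom := by
  obtain ⟨φ, hφ⟩ := GraphHoughton.exists_realizes i₀ f.1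
  obtain ⟨φ', hφ'⟩ := GraphHoughton.exists_realizes i₀ f.inv.1
  obtain ⟨H, -⟩ := f.inv_comp
  obtain ⟨H', -⟩ := f.comp_inv
  obtain ⟨u, hu⟩ := realizes_id.unique i₀ ((hφ'.comp hφ).homotopic ⟨H⟩)
  obtain ⟨v, hv⟩ := realizes_id.unique i₀ ((hφ.comp hφ').homotopic ⟨H'⟩)
  simp only [MonoidHom.comp_apply, MonoidHom.id_apply] at hu hv
  -- Both composites of `φ` and `φ'` are inner, which gives injectivity and surjectivity.
  refine ⟨MulEquiv.ofBijective φ ⟨fun x y hxy => ?_, fun w => ⟨φ' (v⁻¹ * w * v), ?_⟩⟩, hφ⟩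
  · have h1 := (hu x).symm.trans ((congrArg φ' hxy).trans (hu y))
    exact mul_left_cancel (mul_right_cancel h1)
  · rw [hv]
    group

theorem exists_represents_of_mem (i₀ : Fin r) {c : MapGroup (Gam r)}
    (hc : c ∈ asymptoticallyRigid r) : ∃ (f : PHE (Gam r)) (ψ : MulAut (FreeGroup (Fin r × ℕ)))
      (σ : Equiv.Perm (Fin r)) (N k : Fin r → ℕ), mapClass f = c ∧ Represents f.1 ψ σ N k := by
  obtain ⟨f, rfl, Z, hZ⟩ := hc
  obtain ⟨σ, N, k, hf⟩ := hZ.exists_tailRigid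
  obtain ⟨ψ, hψ⟩ := f.exists_realizes i₀
  have h : Represents f.1 ψ σ N k := ⟨hf, hψ⟩
  exact ⟨f, ψ, Equiv.ofBijective σ (Finite.injective_iff_bijective.1 h.injective), N, k, rfl, h⟩

theorem Represents.exists_isRigid {ψ : MulAut (FreeGroup (Fin r × ℕ))} {σ : Equiv.Perm (Fin r)}
    {N k : Fin r → ℕ} (h : Represents f ψ σ N k) : ∃ g, IsRigid ψ σ N k g := h.exists_conj

end Converse

/-! ### Which tail-rigid maps fix the ends -/

section Ends

variable {r : ℕ} {f : C(Gam r, Gam r)} {σ : Fin r → Fin r} {N k : Fin r → ℕ}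

/-- The part of the `i`-th half-line beyond height `M`, with its circles. -/
def branch (i : Fin r) (M : ℝ) : Set (Gam r) := {p | M < p.1.1 i}

theorem mem_branch_of_single {i i' : Fin r} {M t : ℝ} (hM : 0 ≤ M) {p : Gam r}
    (hp : p.1.1 = Pi.single i' t) : p ∈ branch i M ↔ i' = i ∧ M < t := by
  simp only [branch, mem_ofPred_eq, hp]
  by_cases h : i = i'
  · subst h
    simp
  · rw [Pi.single_eq_of_ne h]
    simp [Ne.symm h, hM]

theorem isPreconnected_branch (i : Fin r) {M : ℝ} (hM : 0 ≤ M) : IsPreconnected (branch i M) := by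
  refine isPreconnected_of_forall (ray i (M + 1)) fun p hp => ?_
  have hR : IsPreconnected (ray i '' Ioi M) :=
    isPreconnected_Ioi.image _ (continuous_ray i).continuousOn
  have hR' : ray i '' Ioi M ⊆ branch i M := by
    rintro _ ⟨t, ht, rfl⟩
    have ht' : M < t := ht
    exact (mem_branch_of_single hM (ray_fst (by linarith))).2 ⟨rfl, ht⟩
  have h1 : ray i (M + 1) ∈ ray i '' Ioi M := ⟨_, lt_add_one M, rfl⟩
  rcases gam_cases p with ⟨i', t, ht, rfl⟩ | ⟨⟨i', n⟩, s, hs, rfl⟩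
  · obtain ⟨rfl, h2⟩ := (mem_branch_of_single hM (ray_fst ht)).1 hp
    exact ⟨_, hR', h1, ⟨t, h2, rfl⟩, hR⟩
  · obtain ⟨rfl, h2⟩ := (mem_branch_of_single hM (circ_fst _ _)).1 hp
    refine ⟨ray i' '' Ioi M ∪ range (circ (i', n)), union_subset hR' ?_, Or.inl h1,
      Or.inr ⟨s, rfl⟩, IsPreconnected.union (ray i' (n + 1)) ⟨_, h2, rfl⟩ ⟨0, circ_zero _⟩ hR
        (isPreconnected_range (continuous_circ _))⟩
    rintro _ ⟨s, rfl⟩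
    exact (mem_branch_of_single hM (circ_fst _ _)).2 ⟨rfl, h2⟩

theorem isOpen_branch (i : Fin r) (M : ℝ) : IsOpen (branch i M) :=
  isOpen_lt continuous_const (by fun_prop)

theorem exists_mem_branch {M : ℝ} (hM : 0 ≤ M) {p : Gam r} (hp : M < height p) :
    ∃ i, p ∈ branch i M := by
  obtain ⟨i, t, ht, h⟩ := exists_single p
  rw [height, h, Pi.norm_single, Real.norm_of_nonneg ht] at hp
  exact ⟨i, (mem_branch_of_single hM h).2 ⟨rfl, hp⟩⟩

theorem lt_height_of_mem_branch {M : ℝ} {i : Fin r} {p : Gam r} (hp : p ∈ branch i M) :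
    M < height p := lt_of_lt_of_le hp ((le_abs_self _).trans (norm_le_pi_norm p.1.1 i))

theorem TailRigid.map_mem_branch (hf : TailRigid f σ N k) {i : Fin r} {M L : ℝ} (hM : 0 ≤ M)
    (hL : N i + 1 / 2 ≤ L) (hLM : M + N i ≤ L) {p : Gam r} (hp : p ∈ branch i L) :
    f p ∈ branch (σ i) M := by
  have hN : (0 : ℝ) ≤ N i := by positivity
  have hk : (0 : ℝ) ≤ k i := by positivity
  rcases gam_cases p with ⟨i', t, ht, rfl⟩ | ⟨⟨i', n⟩, s, hs, rfl⟩
  · obtain ⟨rfl, h2⟩ := (mem_branch_of_single (by linarith) (ray_fst ht)).1 hp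
    rw [hf.map_ray _ _ (by linarith), mem_branch_of_single hM (ray_fst (by linarith))]
    exact ⟨rfl, by linarith⟩
  · obtain ⟨rfl, h2⟩ := (mem_branch_of_single (by linarith) (circ_fst _ _)).1 hp
    simp only at h2
    have h3 : N i' < n + 1 := by
      have : (N i' : ℝ) < n + 1 := by linarith
      exact_mod_cast this
    obtain ⟨m, rfl⟩ := Nat.exists_eq_add_of_le (Nat.lt_succ_iff.1 h3)
    rw [hf.map_circ, mem_branch_of_single hM (circ_fst _ _)]
    push_cast at h2 ⊢
    exact ⟨rfl, by linarith⟩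

/-- A point of the end `e` far outside lies on some branch, and `f` keeps it on that branch beyond
`K`. As the branch is connected, the point and its image are in the same component. -/
theorem TailRigid.fixesEnd (hf : TailRigid f _root_.id N k) (e : TopEnd (Gam r)) : FixesEnd f e := by
  intro K L hKL
  obtain ⟨M, hM⟩ := exists_height_le K.2
  obtain ⟨A, hA⟩ := exists_height_le L.2
  obtain ⟨B, hB⟩ := exists_le_all N
  have hM0 : (0 : ℝ) ≤ M := by positivity
  have hA0 : (0 : ℝ) ≤ A := by positivity
  have hB0 : (0 : ℝ) ≤ B := by positivity
  let C : TopologicalSpace.Compacts (Gam r) := ⟨_, isCompact_height_le (M + A + B + 1)⟩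
  have hmem : ∀ p, p ∈ (C : Set (Gam r)) ↔ height p ≤ M + A + B + 1 := fun p => Iff.rfl
  have hKC : (K : Set (Gam r)) ⊆ C := fun p hp => (hmem p).2 (by linarith [hM p hp])
  have hLC : (L : Set (Gam r)) ⊆ C := fun p hp => (hmem p).2 (by linarith [hA p hp])
  obtain ⟨x, hxC, hx⟩ := e.isComponent C
  have hxe : x ∈ e.comp C := by rw [hx]; exact mem_connectedComponentIn hxC
  rw [hmem, not_le] at hxC
  obtain ⟨i, hi⟩ := exists_mem_branch (by linarith) hxC
  have hNi : (N i : ℝ) ≤ B := by exact_mod_cast hB i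
  have h1 : x ∈ branch i M :=
    lt_trans (show (M : ℝ) < M + A + B + 1 by linarith) hi
  have h2 : f x ∈ branch i M := hf.map_mem_branch hM0 (by linarith) (by linarith) hi
  have hbK : branch i M ⊆ (K : Set (Gam r))ᶜ := fun p hp hpK =>
    absurd (hM p hpK) (not_le.2 (lt_height_of_mem_branch hp))
  have hxK := e.mono K C hKC hxe
  have hxL := e.mono L C hLC hxe
  obtain ⟨y, -, hy⟩ := e.isComponent K
  obtain ⟨z, -, hz⟩ := e.isComponent L
  rw [hy] at hxK ⊢
  rw [hz] at hxL ⊢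
  rw [connectedComponentIn_eq hxK]
  have h3 : f x ∈ connectedComponentIn (K : Set (Gam r))ᶜ x :=
    (isPreconnected_branch i hM0).subset_connectedComponentIn h1 hbK h2
  rw [connectedComponentIn_eq h3]
  refine (isPreconnected_connectedComponentIn.image _
    f.continuous.continuousOn).subset_connectedComponentIn ⟨x, hxL, rfl⟩ ?_
  rintro _ ⟨w, hw, rfl⟩ hwK
  exact connectedComponentIn_subset _ _ hw (hKL hwK)

/-- The end of the `i`-th half-line. -/
theorem exists_topEnd (i : Fin r) : ∃ e : TopEnd (Gam r), ∀ (K : TopologicalSpace.Compacts (Gam r))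
    (M : ℝ), 0 ≤ M → (∀ p ∈ (K : Set (Gam r)), height p ≤ M) → branch i M ⊆ e.comp K := by
  have hb := fun K : TopologicalSpace.Compacts (Gam r) => exists_height_le K.2
  choose B hB using hb
  have hray : ∀ (t M : ℝ), 0 ≤ M → M < t → ray i t ∈ branch i M := fun t M hM ht =>
    (mem_branch_of_single hM (ray_fst (by linarith))).2 ⟨rfl, ht⟩
  have hsub : ∀ (K : TopologicalSpace.Compacts (Gam r)) (M : ℝ), 0 ≤ M →
      (∀ p ∈ (K : Set (Gam r)), height p ≤ M) →
      branch i M ⊆ connectedComponentIn (K : Set (Gam r))ᶜ (ray i (B K + 1)) := by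
    intro K M hM hKM p hp
    have hB0 : (0 : ℝ) ≤ B K := by positivity
    have key : ∀ A : ℝ, 0 ≤ A → (∀ p ∈ (K : Set (Gam r)), height p ≤ A) →
        ∀ x ∈ branch i A, ∀ y ∈ branch i A, y ∈ connectedComponentIn (K : Set (Gam r))ᶜ x :=
      fun A hA hKA x hx y hy => by
        have hAK : branch i A ⊆ (K : Set (Gam r))ᶜ := fun q hq hqK =>
          absurd (hKA q hqK) (not_le.2 (lt_height_of_mem_branch hq))
        exact (isPreconnected_branch i hA).subset_connectedComponentIn hx hAK hy
    have h1 := key _ hB0 (hB K) _ (hray (B K + 1) _ hB0 (by linarith))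
      _ (hray (B K + M + 1) _ hB0 (by linarith))
    rw [connectedComponentIn_eq h1]
    exact key M hM hKM _ (hray (B K + M + 1) _ hM (by linarith)) p hp
  have hmem : ∀ K : TopologicalSpace.Compacts (Gam r), ray i (B K + 1) ∉ (K : Set (Gam r)) :=
    fun K hK => by
      have := hB K _ hK
      rw [height_ray (by positivity)] at this
      linarith
  refine ⟨⟨fun K => connectedComponentIn (K : Set (Gam r))ᶜ (ray i (B K + 1)),
    fun K => ⟨_, hmem K, rfl⟩, fun K L hKL => ?_⟩, hsub⟩
  have hB0 : (0 : ℝ) ≤ B L := by positivity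
  have h1 := hsub K (B L) hB0 (fun p hp => hB L p (hKL hp)) (hray (B L + 1) _ hB0 (by linarith))
  rw [connectedComponentIn_eq h1]
  exact connectedComponentIn_mono _ (compl_subset_compl.2 hKL)

/-- Removing the core vertex separates the branches. If `f` moved the branch `i`, the component of
its end would be connected and yet meet two disjoint open parts. -/
theorem TailRigid.eq_of_fixesEnd (hf : TailRigid f σ N k) (he : ∀ e, FixesEnd f e) (i : Fin r) :
    σ i = i := by
  obtain ⟨e, h⟩ := exists_topEnd i
  let K : TopologicalSpace.Compacts (Gam r) := ⟨_, isCompact_height_le 0⟩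
  let L : TopologicalSpace.Compacts (Gam r) := ⟨f ⁻¹' K, hf.isProperMap.isCompact_preimage K.2⟩
  obtain ⟨A, hA⟩ := exists_height_le L.2
  have hA0 : (0 : ℝ) ≤ A := by positivity
  have hN : (0 : ℝ) ≤ N i := by positivity
  have h1 : ray i (A + N i + 1) ∈ e.comp L :=
    h L A hA0 hA ((mem_branch_of_single hA0 (ray_fst (by linarith))).2 ⟨rfl, by linarith⟩)
  have h2 := he e K L subset_rfl ⟨_, h1, rfl⟩
  have h3 : ray i 1 ∈ e.comp K := h K 0 le_rfl (fun p hp => hp)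
    ((mem_branch_of_single le_rfl (ray_fst (by linarith))).2 ⟨rfl, by linarith⟩)
  have h4 : f (ray i (A + N i + 1)) ∈ branch (σ i) 0 :=
    hf.map_mem_branch (L := A + N i + 1 / 2) le_rfl (by linarith) (by linarith)
      ((mem_branch_of_single (by linarith) (ray_fst (by linarith))).2 ⟨rfl, by linarith⟩)
  obtain ⟨y, -, hy⟩ := e.isComponent K
  have hc : IsPreconnected (e.comp K) := by rw [hy]; exact isPreconnected_connectedComponentIn
  have hcK : e.comp K ⊆ (K : Set (Gam r))ᶜ := by rw [hy]; exact connectedComponentIn_subset _ _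
  have hunion : e.comp K ⊆ branch (σ i) 0 ∪ ⋃ i' ∈ ({σ i}ᶜ : Set (Fin r)), branch i' 0 := by
    intro p hp
    obtain ⟨i', hi'⟩ := exists_mem_branch le_rfl (not_le.1 (hcK hp))
    by_cases hi : i' = σ i
    · exact Or.inl (hi ▸ hi')
    · exact Or.inr (mem_biUnion (show i' ∈ ({σ i}ᶜ : Set (Fin r)) from hi) hi')
  by_contra hne
  obtain ⟨p, hp, hp1, hp2⟩ := hc _ _ (isOpen_branch _ _)
    (isOpen_biUnion fun i' _ => isOpen_branch i' 0) hunion ⟨_, h2, h4⟩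
    ⟨_, h3, mem_biUnion (show i ∈ ({σ i}ᶜ : Set (Fin r)) from Ne.symm hne)
      ((mem_branch_of_single le_rfl (ray_fst (by linarith))).2 ⟨rfl, by linarith⟩)⟩
  simp only [mem_iUnion] at hp2
  obtain ⟨i', hi', hp2⟩ := hp2
  obtain ⟨i'', t, ht, hs⟩ := exists_single p
  exact hi' (((mem_branch_of_single le_rfl hs).1 hp2).1.symm.trans
    ((mem_branch_of_single le_rfl hs).1 hp1).1)

/-- Independence of the representative: the inverse of `f` is also an inverse of any other
representative `g` up to proper homotopy, so `FixesEnd.inv` is applied twice. -/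
theorem mem_pureMapGroup_iff {X : Type*} [TopologicalSpace X] {f : PHE X} :
    mapClass f ∈ pureMapGroup X ↔ ∀ e, FixesEnd f.1 e := by
  refine ⟨fun ⟨g, hg, h⟩ e => ?_, fun h => ⟨f, rfl, h⟩⟩
  have hgf : ProperlyHomotopic g.1 f.1 := Quotient.exact hg
  have h1 : FixesEnd f.inv.1 e := (h e).inv g.2.1
    (((hgf.comp g.2.1 f.inv.2.1 (ProperlyHomotopic.refl f.inv.2.1))).trans f.inv_comp)
  exact h1.inv f.inv.2.1 f.comp_inv

end Ends

/-! ### Words under homomorphisms -/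

section WordProblemTransfer

variable {G H : Type*} [Group G] [Group H]

theorem map_evalWord (φ : G →* H) {n : ℕ} (s : Fin n → G) (w : List (Fin n × Bool)) :
    φ (evalWord s w) = evalWord (fun k => φ (s k)) w := by
  simp only [evalWord, map_list_prod, List.map_map]
  congr 2
  funext a
  simp only [Function.comp_apply]
  split <;> simp

end WordProblemTransfer

/-! ### The pure graph Houghton group as a group of automorphisms -/

section Isomorphism

open FreeGroup (of lift lift_apply_of)

variable {r : ℕ}

theorem exists_phe_of_mem_normalizedRigid (i₀ : Fin r) (ψ : normalizedRigid i₀) :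
    ∃ (f : PHE (Gam r)) (N k : Fin r → ℕ), Represents f.1 ψ id N k ∧
      mapClass f ∈ asymptoticallyRigid r := by
  obtain ⟨N, k, g, h, -⟩ := ψ.2
  exact h.exists_phe i₀

/-- A map which represents a normalized rigid automorphism. -/
noncomputable def realization (i₀ : Fin r) (ψ : normalizedRigid i₀) : PHE (Gam r) :=
  (exists_phe_of_mem_normalizedRigid i₀ ψ).choose

theorem realization_spec (i₀ : Fin r) (ψ : normalizedRigid i₀) :
    ∃ (N k : Fin r → ℕ), Represents (realization i₀ ψ).1 ψ id N k ∧
      mapClass (realization i₀ ψ) ∈ asymptoticallyRigid r :=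
  (exists_phe_of_mem_normalizedRigid i₀ ψ).choose_spec

theorem mapClass_realization {i₀ : Fin r} {ψ : normalizedRigid i₀} {f : PHE (Gam r)}
    {σ : Fin r → Fin r} {N k : Fin r → ℕ} (h : Represents f.1 ψ σ N k) :
    mapClass (realization i₀ ψ) = mapClass f := by
  obtain ⟨N', k', h', -⟩ := realization_spec i₀ ψ
  exact Quotient.sound (h'.properlyHomotopic h)

/-- The mapping class which is represented by a normalized rigid automorphism. -/
noncomputable def realizationHom (i₀ : Fin r) : normalizedRigid i₀ →* MapGroup (Gam r) :=
  MonoidHom.mk' (fun ψ => mapClass (realization i₀ ψ)) fun ψ ψ' => by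
    obtain ⟨N, k, h, -⟩ := realization_spec i₀ ψ
    obtain ⟨N', k', h', -⟩ := realization_spec i₀ ψ'
    exact mapClass_realization (h.comp h')

/-- A trivial class forces the automorphism to be inner. As it is a translation on the tail of `i₀`,
the conjugating element commutes with two letters and is trivial. -/
theorem realizationHom_injective (i₀ : Fin r) : Function.Injective (realizationHom i₀) := by
  refine (injective_iff_map_eq_one _).2 fun ψ hψ => Subtype.ext ?_
  obtain ⟨N', k', h, -⟩ := realization_spec i₀ ψ
  obtain ⟨H, -⟩ := Quotient.exact (hψ.trans mapClass_one)
  obtain ⟨u, hu⟩ := realizes_id.unique i₀ (h.realizes.homotopic ⟨H⟩)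
  obtain ⟨N, k, g, hg, hg0⟩ := ψ.2
  have hfix : ∀ m, u * of (i₀, N i₀ + m) * u⁻¹ = of (i₀, k i₀ + m) := fun m => by
    have h1 := hg i₀ m
    rw [hg0, one_mul, inv_one, mul_one] at h1
    exact (hu _).symm.trans h1
  have hcomm : ∀ m, u * of (i₀, N i₀ + m) = of (i₀, N i₀ + m) * u := fun m => by
    have h1 := hfix m
    rw [← eq_of_conj_of_eq (h1.trans (by group : _ = 1 * of (i₀, k i₀ + m) * 1⁻¹))] at h1
    exact mul_inv_eq_iff_eq_mul.1 h1
  have hu1 : u = 1 := eq_one_of_commute_pair (i := (i₀, N i₀ + 0)) (j := (i₀, N i₀ + 1)) (by simp)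
    (hcomm 0) (hcomm 1)
  refine mulAut_ext fun j => (hu _).trans ?_
  simp [hu1]

/-- Being represented by a tail-rigid map survives products and inverses, hence passes to the
generated subgroup; inverses are supplied by realizing the inverse automorphism. -/
theorem exists_represents_of_mem_graphHoughton (i₀ : Fin r) {c : MapGroup (Gam r)}
    (hc : c ∈ graphHoughton r) : ∃ (f : PHE (Gam r)) (ψ : MulAut (FreeGroup (Fin r × ℕ)))
      (σ : Equiv.Perm (Fin r)) (N k : Fin r → ℕ), mapClass f = c ∧ Represents f.1 ψ σ N k := by
  induction hc using Subgroup.closure_induction with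
  | mem c hc => exact exists_represents_of_mem i₀ hc
  | one => exact ⟨_, 1, 1, _, _, mapClass_one.symm, Represents.id⟩
  | mul c c' _ _ h h' =>
    obtain ⟨f, ψ, σ, N, k, rfl, hf⟩ := h
    obtain ⟨f', ψ', σ', N', k', rfl, hf'⟩ := h'
    exact ⟨_, ψ * ψ', σ * σ', _, _, (mapClass_mul f f').symm, hf.comp hf'⟩
  | inv c _ h =>
    obtain ⟨f, ψ, σ, N, k, rfl, hf⟩ := h
    obtain ⟨g, hg⟩ := hf.exists_isRigid
    obtain ⟨f', N', k', hf', -⟩ := hg.inv.exists_phe i₀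
    exact ⟨f', ψ⁻¹, σ⁻¹, N', k', eq_inv_of_mul_eq_one_right
      (Quotient.sound (hf.comp_properlyHomotopic_id hf')), hf'⟩

theorem range_realizationHom (i₀ : Fin r) : (realizationHom i₀).range = pureGraphHoughton r := by
  refine le_antisymm ?_ fun c hc => ?_
  · rintro _ ⟨ψ, rfl⟩
    obtain ⟨N, k, h, hc⟩ := realization_spec i₀ ψ
    exact ⟨Subgroup.subset_closure hc, mem_pureMapGroup_iff.2 h.tailRigid.fixesEnd⟩
  · obtain ⟨f, ψ, σ, N, k, rfl, hf⟩ := exists_represents_of_mem_graphHoughton i₀ hc.1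
    obtain rfl : σ = 1 :=
      Equiv.ext fun i => hf.tailRigid.eq_of_fixesEnd (mem_pureMapGroup_iff.1 hc.2) i
    obtain ⟨g, hg⟩ := hf.exists_isRigid
    -- An inner correction normalizes the ray `i₀` and does not change the mapping class that is
    -- represented.
    have hmem : MulAut.conj (g i₀)⁻¹ * ψ ∈ normalizedRigid i₀ :=
      ⟨N, k, fun i => (g i₀)⁻¹ * g i, fun i m => by
        rw [MulAut.mul_apply, hg, MulAut.conj_apply]
        group, inv_mul_cancel _⟩
    exact ⟨⟨_, hmem⟩, mapClass_realization (hf.conj (g i₀)⁻¹)⟩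

/-- The pure graph Houghton group is isomorphic to the group of normalized rigid automorphisms. -/
noncomputable def normalizedRigidEquiv (i₀ : Fin r) : normalizedRigid i₀ ≃* pureGraphHoughton r :=
  (MonoidHom.ofInjective (realizationHom_injective i₀)).trans
    (MulEquiv.subgroupCongr (range_realizationHom i₀))

end Isomorphism

end GraphHoughton

theorem corollary7p6 (r : ℕ) (hr : 3 ≤ r) :
    GraphHoughton.HasSolvableWordProblem (GraphHoughton.pureGraphHoughton r) := by
  let i₀ : Fin r := ⟨0, by omega⟩
  let e := GraphHoughton.normalizedRigidEquiv i₀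
  have hfg := GraphHoughton.normalizedRigid_fg i₀ (by omega)
  refine ⟨Group.fg_of_surjective (f := e.toMonoidHom) e.surjective, fun n s _ => ?_⟩
  -- The embedding into the automorphism group turns triviality of a word in any family `s` into
  -- triviality of a word in normalized rigid automorphisms.
  let φ := (GraphHoughton.normalizedRigid i₀).subtype.comp e.symm.toMonoidHom
  have hφ : Function.Injective φ := Subtype.val_injective.comp e.symm.injective
  refine (GraphHoughton.computablePred_evalWord (i₀ := i₀) (ψ := fun k => φ (s k))
    fun k => (e.symm (s k)).2).of_eq fun w => ?_
  rw [← GraphHoughton.map_evalWord, map_eq_one_iff φ hφ]
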